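/- **Theorem 1 (capacity region of the MABC protocol).** Consider a discrete memoryless half-duplex bi-directional relay channel with two terminals $a,b$ and a relay $r$. Node $i\in\{a,b,r\}$ has input alphabet $\mathcal X_i\cup\{\varnothing\}$ and output alphabet $\mathcal Y_i\cup\{\varnothing\}$, where $\mathcal X_i,\mathcal Y_i$ are finite and $\mathcal X_i\ne\emptyset$; one channel use is governed by a transition law $p(y_a,y_b,y_r\mid x_a,x_b,x_r)$ under which, with probability one, $X_i=\varnothing$ if and only if $Y_i\neq\varnothing$, for every node $i$. A code of length $n$ for the Multiple Access Broadcast (MABC) protocol has a first phase consisting of the first $n\Delta_{1,n}$ channel uses, in which $a$ and $b$ send symbols of $\mathcal X_a$, $\mathcal X_b$ and $X_r=\varnothing$, followed by a second phase consisting of the remaining $n\Delta_{2,n}$ channel uses, in which $X_a=X_b=\varnothing$ and $r$ sends symbols of $\mathcal X_r$. The messages $W_a,W_b$ of $a$ and $b$ are independent and uniform on sets of sizes $\lfloor 2^{nR_a}\rfloor$ and $\lfloor 2^{nR_b}\rfloor$; the input of each node at time $k$ is a function of its own message (the relay has none) and of its outputs before time $k$. At the end of the block, $b$ estimates $W_a$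 and $a$ estimates $W_b$ (each from its own outputs and its own message), and the relay estimates both $W_a$ and $W_b$ from its outputs. Fix $\Delta_1,\Delta_2\ge 0$ with $\Delta_1+\Delta_2=1$. A pair $(R_a,R_b)$ with $R_a,R_b\ge 0$ is achievable if there are codes of length $n=1,2,\dots$ with $\Delta_{\ell,n}\to\Delta_\ell$ for $\ell=1,2$ for which all four error probabilities ($W_a$ at $b$, $W_b$ at $a$, $W_a$ at $r$, $W_b$ at $r$) tend to $0$ as $n\to\infty$. The capacity region is the closure of the set of achievable pairs. Then the capacity region is the set of pairs $(R_a,R_b)$ with $R_a\ge 0$, $R_b\ge 0$ that lie in the closure (in $\mathbb R^2$) of the set of all $(R_a,R_b)\in\mathbb R^2$ satisfying \begin{align*} R_a &< \min\big\{\Delta_1 I(X_a^{(1)};Y_r^{(1)}\mid X_b^{(1)},X_r^{(1)}=\varnothing,Q),\ \Delta_2 I(X_r^{(2)};Y_b^{(2)}\mid X_a^{(2)}=X_b^{(2)}=\varnothing,Q)\big\},\\ R_b &< \min\big\{\Delta_1 I(X_b^{(1)};Y_r^{(1)}\mid X_a^{(1)},X_r^{(1)}=\varnothing,Q),\ \Delta_2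 I(X_r^{(2)};Y_a^{(2)}\mid X_a^{(2)}=X_b^{(2)}=\varnothing,Q)\big\},\\ R_a+R_b &< \Delta_1 I(X_a^{(1)},X_b^{(1)};Y_r^{(1)}\mid X_r^{(1)}=\varnothing,Q) \end{align*} for some joint distribution $p(q)\,p^{(1)}(x_a\mid q)\,p^{(1)}(x_b\mid q)\,p^{(2)}(x_r\mid q)$ on $\mathcal Q\times\mathcal X_a\times\mathcal X_b\times\mathcal X_r$ with $|\mathcal Q|\le 5$. Here $X_i^{(\ell)},Y_i^{(\ell)}$ are the channel inputs and outputs in a channel use of phase $\ell$ with that input distribution, and mutual informations are in bits. -/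

import Mathlib

open Filter Topology

noncomputable section

namespace MABC

/-- A discrete memoryless half-duplex channel with two terminals `a`, `b` and a relay `r`.
Every node `i` has input alphabet `X_i ∪ {∅}` and output alphabet `Y_i ∪ {∅}`, with `∅` modelled
by `none`. `prob xa xb xr (ya, yb, yr)` is the transition probability of one channel use. A node
receives a symbol of `Y_i` if and only if it is silent. -/
structure HalfDuplexChannel (XA XB XR YA YB YR : Type*)
    [Fintype YA] [Fintype YB] [Fintype YR] where
  prob : Option XA → Option XB → Option XR → Option YA × Option YB × Option YR → ℝ
  prob_mem : ∀ xa xb xr, prob xa xb xr ∈ stdSimplex ℝ (Option YA × Option YB × Option YR)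
  halfDuplex : ∀ xa xb xr y, prob xa xb xr y ≠ 0 →
    (xa = none ↔ y.1 ≠ none) ∧ (xb = none ↔ y.2.1 ≠ none) ∧ (xr = none ↔ y.2.2 ≠ none)

/-- A block code of length `n` for the multiple access broadcast protocol: during the first
`phase1` channel uses both terminals transmit and the relay is silent, during the remaining ones
the relay transmits and both terminals are silent. Terminal `a` has a message in `Fin Ma`,
terminal `b` has a message in `Fin Mb`. The input of a node at time `k` is a function of its own
message and of the outputs it has seen at times before `k`. Terminals `a` and `b` decode each
other's message, the relay decodes both. -/
structure Code (XA XB XR YA YB YR : Type*) (n Ma Mb : ℕ) where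
  /-- number of channel uses in the first phase -/
  phase1 : ℕ
  phase1_le : phase1 ≤ n
  encA : Fin Ma → (k : Fin n) → (Fin k → Option YA) → Option XA
  encB : Fin Mb → (k : Fin n) → (Fin k → Option YB) → Option XB
  encR : (k : Fin n) → (Fin k → Option YR) → Option XR
  encA_phase1 : ∀ w (k : Fin n) past, (k : ℕ) < phase1 → encA w k past ≠ none
  encB_phase1 : ∀ w (k : Fin n) past, (k : ℕ) < phase1 → encB w k past ≠ none
  encR_phase1 : ∀ (k : Fin n) past, (k : ℕ) < phase1 → encR k past = none
  encA_phase2 : ∀ w (k : Fin n) past, phase1 ≤ (k : ℕ) → encA w k past = none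
  encB_phase2 : ∀ w (k : Fin n) past, phase1 ≤ (k : ℕ) → encB w k past = none
  encR_phase2 : ∀ (k : Fin n) past, phase1 ≤ (k : ℕ) → encR k past ≠ none
  /-- estimate of the message of `b` at node `a` -/
  decA : (Fin n → Option YA) → Fin Ma → Fin Mb
  /-- estimate of the message of `a` at node `b` -/
  decB : (Fin n → Option YB) → Fin Mb → Fin Ma
  /-- estimate of the pair of messages at the relay -/
  decR : (Fin n → Option YR) → Fin Ma × Fin Mb

section

variable {XA XB XR YA YB YR : Type*}

namespace Code

variable {n Ma Mb : ℕ}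

/-- The probability that the outputs at the three nodes over the whole block are `y`, when the
messages are `wa` and `wb`. -/
def outputProb [Fintype YA] [Fintype YB] [Fintype YR]
    (C : Code XA XB XR YA YB YR n Ma Mb) (ch : HalfDuplexChannel XA XB XR YA YB YR)
    (wa : Fin Ma) (wb : Fin Mb) (y : Fin n → Option YA × Option YB × Option YR) : ℝ :=
  ∏ k : Fin n, ch.prob
    (C.encA wa k fun j => (y ⟨j, j.2.trans k.2⟩).1)
    (C.encB wb k fun j => (y ⟨j, j.2.trans k.2⟩).2.1)
    (C.encR k fun j => (y ⟨j, j.2.trans k.2⟩).2.2)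
    (y k)

open Classical in
/-- The probability of the event `E` (on messages and outputs) when the two messages are
independent and uniformly distributed. -/
def eventProb [Fintype YA] [Fintype YB] [Fintype YR]
    (C : Code XA XB XR YA YB YR n Ma Mb) (ch : HalfDuplexChannel XA XB XR YA YB YR)
    (E : Fin Ma → Fin Mb → (Fin n → Option YA × Option YB × Option YR) → Prop) : ℝ :=
  (∑ wa : Fin Ma, ∑ wb : Fin Mb, ∑ y : Fin n → Option YA × Option YB × Option YR,
    if E wa wb y then C.outputProb ch wa wb y else 0) / ((Ma : ℝ) * (Mb : ℝ))

variable [Fintype YA] [Fintype YB] [Fintype YR]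
  (C : Code XA XB XR YA YB YR n Ma Mb) (ch : HalfDuplexChannel XA XB XR YA YB YR)

/-- error probability of the message of `a` at node `b` -/
def errAB : ℝ := C.eventProb ch fun wa wb y => C.decB (fun k => (y k).2.1) wb ≠ wa

/-- error probability of the message of `b` at node `a` -/
def errBA : ℝ := C.eventProb ch fun wa wb y => C.decA (fun k => (y k).1) wa ≠ wb

/-- error probability of the message of `a` at the relay -/
def errAR : ℝ := C.eventProb ch fun wa _ y => (C.decR fun k => (y k).2.2).1 ≠ wa

/-- error probability of the message of `b` at the relay -/
def errBR : ℝ := C.eventProb ch fun _ wb y => (C.decR fun k => (y k).2.2).2 ≠ wb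

end Code

variable [Fintype YA] [Fintype YB] [Fintype YR]

/-- The rate pair `(Ra, Rb)` is achievable with relative phase durations `Δ₁`, `Δ₂`. -/
def Achievable (ch : HalfDuplexChannel XA XB XR YA YB YR) (Δ₁ Δ₂ Ra Rb : ℝ) : Prop :=
  0 ≤ Ra ∧ 0 ≤ Rb ∧
  ∃ C : ∀ n : ℕ, Code XA XB XR YA YB YR n
      ⌊(2 : ℝ) ^ ((n : ℝ) * Ra)⌋₊ ⌊(2 : ℝ) ^ ((n : ℝ) * Rb)⌋₊,
    Tendsto (fun n : ℕ => ((C n).phase1 : ℝ) / (n : ℝ)) atTop (𝓝 Δ₁) ∧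
    Tendsto (fun n : ℕ => ((n : ℝ) - ((C n).phase1 : ℝ)) / (n : ℝ)) atTop (𝓝 Δ₂) ∧
    Tendsto (fun n : ℕ => (C n).errAB ch) atTop (𝓝 0) ∧
    Tendsto (fun n : ℕ => (C n).errBA ch) atTop (𝓝 0) ∧
    Tendsto (fun n : ℕ => (C n).errAR ch) atTop (𝓝 0) ∧
    Tendsto (fun n : ℕ => (C n).errBR ch) atTop (𝓝 0)

/-- The capacity region of the protocol for fixed relative phase durations. -/
def capacityRegion (ch : HalfDuplexChannel XA XB XR YA YB YR) (Δ₁ Δ₂ : ℝ) : Set (ℝ × ℝ) :=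
  closure {R | Achievable ch Δ₁ Δ₂ R.1 R.2}

end

/-- The conditional mutual information `I(A; B | C)`, in bits, of a joint probability mass
function `p` on a product of finite sets. -/
def condMutualInfo {A B C : Type*} [Fintype A] [Fintype B] [Fintype C] (p : A → B → C → ℝ) : ℝ :=
  ∑ a, ∑ b, ∑ c, p a b c * Real.logb 2
    (p a b c * (∑ a', ∑ b', p a' b' c) / ((∑ b', p a b' c) * (∑ a', p a' b c)))

/-- A time-sharing variable `Q` with values in `Fin m` together with conditional input
distributions `p(q) p⁽¹⁾(xa|q) p⁽¹⁾(xb|q) p⁽²⁾(xr|q)`. -/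
structure InputDist (m : ℕ) (XA XB XR : Type*) [Fintype XA] [Fintype XB] [Fintype XR] where
  pQ : Fin m → ℝ
  pA : Fin m → XA → ℝ
  pB : Fin m → XB → ℝ
  pR : Fin m → XR → ℝ
  pQ_mem : pQ ∈ stdSimplex ℝ (Fin m)
  pA_mem : ∀ q, pA q ∈ stdSimplex ℝ XA
  pB_mem : ∀ q, pB q ∈ stdSimplex ℝ XB
  pR_mem : ∀ q, pR q ∈ stdSimplex ℝ XR

namespace InputDist

variable {m : ℕ} {XA XB XR YA YB YR : Type*} [Fintype XA] [Fintype XB] [Fintype XR]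
  [Fintype YA] [Fintype YB] [Fintype YR]
  (P : InputDist m XA XB XR) (ch : HalfDuplexChannel XA XB XR YA YB YR)

/-- joint law of `Q`, of the inputs of `a` and `b` and of the output of `r` in phase 1, where
`Xr = ∅` -/
def joint1 (q : Fin m) (xa : XA) (xb : XB) (yr : Option YR) : ℝ :=
  P.pQ q * P.pA q xa * P.pB q xb * ∑ ya, ∑ yb, ch.prob (some xa) (some xb) none (ya, yb, yr)

/-- joint law of `Q`, of the input of `r` and of the outputs of `a` and `b` in phase 2, where
`Xa = Xb = ∅` -/
def joint2 (q : Fin m) (xr : XR) (ya : Option YA) (yb : Option YB) : ℝ :=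
  P.pQ q * P.pR q xr * ∑ yr, ch.prob none none (some xr) (ya, yb, yr)

/-- `I(Xa⁽¹⁾; Yr⁽¹⁾ | Xb⁽¹⁾, Xr⁽¹⁾ = ∅, Q)` -/
def infoAR : ℝ :=
  condMutualInfo fun (xa : XA) (yr : Option YR) (c : XB × Fin m) => P.joint1 ch c.2 xa c.1 yr

/-- `I(Xb⁽¹⁾; Yr⁽¹⁾ | Xa⁽¹⁾, Xr⁽¹⁾ = ∅, Q)` -/
def infoBR : ℝ :=
  condMutualInfo fun (xb : XB) (yr : Option YR) (c : XA × Fin m) => P.joint1 ch c.2 c.1 xb yr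

/-- `I(Xa⁽¹⁾, Xb⁽¹⁾; Yr⁽¹⁾ | Xr⁽¹⁾ = ∅, Q)` -/
def infoABR : ℝ :=
  condMutualInfo fun (x : XA × XB) (yr : Option YR) (q : Fin m) => P.joint1 ch q x.1 x.2 yr

/-- `I(Xr⁽²⁾; Yb⁽²⁾ | Xa⁽²⁾ = Xb⁽²⁾ = ∅, Q)` -/
def infoRB : ℝ :=
  condMutualInfo fun (xr : XR) (yb : Option YB) (q : Fin m) => ∑ ya, P.joint2 ch q xr ya yb

/-- `I(Xr⁽²⁾; Ya⁽²⁾ | Xa⁽²⁾ = Xb⁽²⁾ = ∅, Q)` -/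
def infoRA : ℝ :=
  condMutualInfo fun (xr : XR) (ya : Option YA) (q : Fin m) => ∑ yb, P.joint2 ch q xr ya yb

end InputDist

end MABC

end

/-! Converse. Half-duplex operation makes feedback useless: a terminal hears only `none` while it
transmits, so in phase 1 terminals send fixed codewords, and the relay input in phase 2 depends only
on the relay outputs. Hence, given the messages, the relay outputs are a product law, and given the
relay outputs, those of a terminal are a product law (`Code.outputProb_eq`,
`Code.sum_outputProb_mul`). Fano's inequality is used as a change of measure
(`prob_mul_logb_sub_one_le_sum_divergence`): under a reference product law that hides a message,
decoding succeeds with probability `1 / M`, so success under the true law costs relative entropy,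
and this is a sum of single-letter terms. Averaging the reference law over one or both messages
produces the three multiple access informations; the output law of one time-averaged relay input
produces the two broadcast ones. Carathéodory's theorem in dimension 3 compresses the average over
phase 1 to at most four values of the time-sharing variable (`exists_timeSharing`), and phase 2
needs none (`Code.exists_inputDist`). For large `n` the pair lowered by `ε` satisfies the strict
inequalities with the distribution of that `n`, so no compactness argument is needed.

Achievability. The relay decodes both messages and forwards a codeword indexed by the pair; each
terminal decodes knowing its own message. Random coding with maximum likelihood decoding bounds each
error by `N ^ ρ * gallager ρ p V`, with `N` the number of competitors (`sum_mul_competitor_le`). The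
function `gallager` is multiplicative over channel uses and its logarithmic derivative at `ρ = 0` is
minus the mutual information in nats, so below the mutual information some small `ρ` gives
exponential decay (`exists_tendsto_gallager`).

Boundary. A message of rate zero has no competitors, so its constraints disappear. This lets the
final step replace negative coordinates by `0` and pass to the closure. -/

noncomputable section

namespace MABC

/-! ### Sums over finite product spaces. -/

section FiniteSums

variable {ι X T : Type*} [Fintype ι] [Fintype X] [Fintype T]

theorem sum_pi_prod [DecidableEq ι] (f : ι → X → ℝ) :
    ∑ x : ι → X, ∏ k, f k (x k) = ∏ k, ∑ a, f k a := by
  rw [Finset.prod_univ_sum, Fintype.piFinset_univ]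

theorem sum_pi_prod_mul_apply [DecidableEq ι] (p : ι → X → ℝ) (i : ι)
    (hp : ∀ k, k ≠ i → ∑ a, p k a = 1) (g : X → ℝ) :
    ∑ x : ι → X, (∏ k, p k (x k)) * g (x i) = ∑ a, p i a * g a := by
  have h : ∀ x : ι → X, (∏ k, p k (x k)) * g (x i)
      = ∏ k, p k (x k) * (if k = i then g (x k) else 1) := by
    intro x
    rw [Finset.prod_mul_distrib, Finset.prod_ite_eq' Finset.univ i fun k => g (x k)]
    simp
  simp_rw [h]
  rw [sum_pi_prod (fun k a => p k a * if k = i then g a else 1)]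
  rw [Finset.prod_eq_single i]
  · simp
  · intro k _ hk
    simp [hk, hp k hk]
  · simp

theorem sum_pi_prod_mul_apply₂ [DecidableEq ι] (p : X → ℝ) (hp : ∑ a, p a = 1) {i j : ι}
    (hij : i ≠ j) (f : X → X → ℝ) :
    ∑ x : ι → X, (∏ k, p (x k)) * f (x i) (x j) = ∑ a, ∑ b, p a * p b * f a b := by
  classical
  -- Splitting according to the value `a` of `x i` leaves an integrand that is a product over
  -- coordinates.
  have h : ∀ x : ι → X, (∏ k, p (x k)) * f (x i) (x j)
      = ∑ a, (∏ k, p (x k) * (if k = i then (if x k = a then 1 else 0) else 1)) * f a (x j) := by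
    intro x
    have : ∀ a, (∏ k, p (x k) * (if k = i then (if x k = a then (1 : ℝ) else 0) else 1))
        = (∏ k, p (x k)) * if x i = a then 1 else 0 := by
      intro a
      rw [Finset.prod_mul_distrib,
        Finset.prod_ite_eq' Finset.univ i fun k => if x k = a then (1 : ℝ) else 0]
      simp
    simp_rw [this]
    simp
  simp_rw [h]
  rw [Finset.sum_comm]
  refine Finset.sum_congr rfl fun a _ => ?_
  have h2 : ∀ x : ι → X,
      (∏ k, p (x k) * (if k = i then (if x k = a then (1 : ℝ) else 0) else 1)) * f a (x j)
      = ∏ k, p (x k) * ((if k = i then (if x k = a then (1 : ℝ) else 0) else 1) *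
          if k = j then f a (x k) else 1) := by
    intro x
    simp_rw [← mul_assoc]
    rw [Finset.prod_mul_distrib (g := fun k => if k = j then f a (x k) else 1),
      Finset.prod_ite_eq' Finset.univ j fun k => f a (x k)]
    simp
  simp_rw [h2]
  rw [sum_pi_prod (fun k c => p c * ((if k = i then (if c = a then (1 : ℝ) else 0) else 1) *
          if k = j then f a c else 1))]
  rw [← Finset.mul_prod_erase Finset.univ _ (Finset.mem_univ i),
    ← Finset.mul_prod_erase (Finset.univ.erase i) _
      (Finset.mem_erase.2 ⟨hij.symm, Finset.mem_univ j⟩)]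
  rw [Finset.prod_eq_one]
  · simp [hij, hij.symm, Finset.mul_sum, mul_assoc]
  · intro k hk
    simp only [Finset.mem_erase, Finset.mem_univ, and_true] at hk
    simp [hk.1, hk.2, hp]

theorem pi_prod_mem_stdSimplex [DecidableEq ι] {p : ι → X → ℝ} (hp : ∀ k, p k ∈ stdSimplex ℝ X) :
    (fun x : ι → X => ∏ k, p k (x k)) ∈ stdSimplex ℝ (ι → X) := by
  refine ⟨fun x => Finset.prod_nonneg fun k _ => (hp k).1 _, ?_⟩
  rw [sum_pi_prod]
  exact Finset.prod_eq_one fun k _ => (hp k).2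

/-- A weighted average is at least one of the averaged values. -/
theorem exists_le_of_sum_mul_le {p f : X → ℝ} (hp : p ∈ stdSimplex ℝ X) {b : ℝ}
    (h : ∑ x, p x * f x ≤ b) : ∃ x, f x ≤ b := by
  by_contra! hf
  have h1 : ∑ x, p x * (f x - b) ≤ 0 := by
    simp_rw [mul_sub]
    rw [Finset.sum_sub_distrib, ← Finset.sum_mul, hp.2]
    linarith
  have h2 : ∀ x ∈ Finset.univ, 0 ≤ p x * (f x - b) := fun x _ =>
    mul_nonneg (hp.1 x) (by linarith [hf x])
  have h3 := (Finset.sum_eq_zero_iff_of_nonneg h2).1 (le_antisymm h1 (Finset.sum_nonneg h2))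
  have h4 : ∀ x, p x = 0 := fun x => by
    rcases mul_eq_zero.1 (h3 x (Finset.mem_univ x)) with h | h
    · exact h
    · linarith [hf x]
  have := hp.2
  simp [h4] at this

end FiniteSums

/-! ### Fano's inequality by change of measure. -/

section Fano

/-- Fano's inequality in the form obtained from the variational characterization of relative
entropy: if `E` has probability at most `1 / M` under the reference law `μ(u) ∏ q_k(t_k | u)`, its
probability under `μ(u) ∏ W_k(t_k | u)` is controlled by the sum of single-letter divergences. -/
theorem prob_mul_logb_sub_one_le_sum_divergence {ι U T : Type*} [Fintype ι] [DecidableEq ι]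
    [Fintype U] [Fintype T]
    {μ : U → ℝ} (hμ : μ ∈ stdSimplex ℝ U) {W q : ι → U → T → ℝ}
    (hW : ∀ k u, W k u ∈ stdSimplex ℝ T) (hq : ∀ k u, q k u ∈ stdSimplex ℝ T)
    (hWq : ∀ k u t, μ u ≠ 0 → q k u t = 0 → W k u t = 0)
    (E : U → (ι → T) → ℝ) (hE : ∀ u t, E u t = 0 ∨ E u t = 1) {M : ℝ} (hM : 0 < M)
    (hQ : ∑ u, μ u * ∑ t : ι → T, (∏ k, q k u (t k)) * E u t ≤ 1 / M) :
    (∑ u, μ u * ∑ t : ι → T, (∏ k, W k u (t k)) * E u t) * Real.logb 2 M - 1 ≤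
      ∑ k, ∑ u, μ u * ∑ a, W k u a * Real.logb 2 (W k u a / q k u a) := by
  have hW' : ∀ u, ∑ t : ι → T, ∏ k, W k u (t k) = 1 := fun u =>
    (pi_prod_mem_stdSimplex fun k => hW k u).2
  have hq' : ∀ u, ∑ t : ι → T, ∏ k, q k u (t k) = 1 := fun u =>
    (pi_prod_mem_stdSimplex fun k => hq k u).2
  -- The test function is `log ((1 + M * E) / 2)`, whose exponential has mean at most 1 under the
  -- reference law. The pointwise bound is `1 - 1 / x ≤ log x`; the `log 2` becomes the one bit lost
  -- in the conclusion.
  have key : ∀ u (t : ι → T),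
      μ u * (∏ k, W k u (t k)) - μ u * (∏ k, q k u (t k)) * ((1 + M * E u t) / 2) ≤
      μ u * ((∏ k, W k u (t k)) * (∑ k, Real.log (W k u (t k) / q k u (t k)) -
        (E u t * Real.log M - Real.log 2))) := by
    intro u t
    have hg : 0 < (1 + M * E u t) / 2 := by
      rcases hE u t with h | h <;> rw [h] <;> linarith
    have hgl : E u t * Real.log M - Real.log 2 ≤ Real.log ((1 + M * E u t) / 2) := by
      rw [Real.log_div (by linarith) two_ne_zero]
      rcases hE u t with h | h <;> rw [h]
      · simp
      · have := Real.log_le_log hM (show M ≤ 1 + M * 1 by linarith)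
        linarith
    have hQ0 : 0 ≤ ∏ k, q k u (t k) := Finset.prod_nonneg fun k _ => (hq k u).1 _
    rcases (hμ.1 u).eq_or_lt with h0 | h0
    · simp [← h0]
    have hP0 : 0 ≤ ∏ k, W k u (t k) := Finset.prod_nonneg fun k _ => (hW k u).1 _
    rcases hP0.eq_or_lt with hP | hP
    · rw [← hP]
      have := mul_nonneg (mul_nonneg h0.le hQ0) hg.le
      linarith
    have hWk : ∀ k, W k u (t k) ≠ 0 := fun k => Finset.prod_ne_zero_iff.1 hP.ne' k (Finset.mem_univ k)
    have hqk : ∀ k, q k u (t k) ≠ 0 := fun k h => hWk k (hWq k u _ h0.ne' h)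
    have hQ1 : 0 < ∏ k, q k u (t k) :=
      lt_of_le_of_ne hQ0 (Finset.prod_ne_zero_iff.2 fun k _ => hqk k).symm
    rw [mul_assoc, ← mul_sub]
    refine mul_le_mul_of_nonneg_left ?_ h0.le
    rw [← Real.log_prod (fun k _ => div_ne_zero (hWk k) (hqk k)), Finset.prod_div_distrib]
    have h1 : 1 - ((∏ k, q k u (t k)) * ((1 + M * E u t) / 2)) / (∏ k, W k u (t k)) ≤
        Real.log ((∏ k, W k u (t k)) / ∏ k, q k u (t k)) - Real.log ((1 + M * E u t) / 2) := by
      rw [← Real.log_div (div_pos hP hQ1).ne' hg.ne']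
      have := Real.one_sub_inv_le_log_of_pos (div_pos (div_pos hP hQ1) hg)
      refine le_trans (le_of_eq ?_) this
      field_simp
    have h2 := mul_le_mul_of_nonneg_left h1 hP.le
    rw [mul_sub, mul_one, mul_div_cancel₀ _ hP.ne'] at h2
    refine h2.trans (mul_le_mul_of_nonneg_left ?_ hP.le)
    linarith
  have hsum := Finset.sum_le_sum fun u (_ : u ∈ Finset.univ) =>
    Finset.sum_le_sum fun t (_ : t ∈ Finset.univ) => key u t
  -- The left sides of `key` add up to 1 minus half of `1 + M` times the reference probability of
  -- `E`; this is nonnegative by `hQ`.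
  have hL : 0 ≤ ∑ u, ∑ t : ι → T, (μ u * (∏ k, W k u (t k)) -
      μ u * (∏ k, q k u (t k)) * ((1 + M * E u t) / 2)) := by
    have h1 : ∀ u (t : ι → T), μ u * (∏ k, q k u (t k)) * ((1 + M * E u t) / 2) =
        μ u * (∏ k, q k u (t k)) / 2 + M / 2 * (μ u * ((∏ k, q k u (t k)) * E u t)) := by
      intro u t; ring
    simp_rw [h1, Finset.sum_sub_distrib, Finset.sum_add_distrib, ← Finset.mul_sum,
      ← Finset.sum_div, ← Finset.mul_sum, hW', hq', mul_one, hμ.2]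
    have := mul_le_mul_of_nonneg_left hQ (show 0 ≤ M / 2 by linarith)
    have h2 : M / 2 * (1 / M) = 1 / 2 := by field_simp
    linarith
  have hR : ∑ u, ∑ t : ι → T, μ u * ((∏ k, W k u (t k)) *
      (∑ k, Real.log (W k u (t k) / q k u (t k)) - (E u t * Real.log M - Real.log 2))) =
      ∑ k, ∑ u, μ u * ∑ a, W k u a * Real.log (W k u a / q k u a) -
      (∑ u, μ u * ∑ t : ι → T, (∏ k, W k u (t k)) * E u t) * Real.log M + Real.log 2 := by
    have h1 : ∀ u (t : ι → T), μ u * ((∏ k, W k u (t k)) *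
      (∑ k, Real.log (W k u (t k) / q k u (t k)) - (E u t * Real.log M - Real.log 2))) =
      μ u * ∑ k, (∏ k, W k u (t k)) * Real.log (W k u (t k) / q k u (t k)) -
        μ u * ((∏ k, W k u (t k)) * E u t) * Real.log M +
        μ u * (∏ k, W k u (t k)) * Real.log 2 := by
      intro u t; rw [← Finset.mul_sum]; ring
    simp_rw [h1, Finset.sum_add_distrib, Finset.sum_sub_distrib, ← Finset.sum_mul,
      ← Finset.mul_sum, hW', mul_one, hμ.2, one_mul]
    congr 2
    rw [Finset.sum_comm (s := Finset.univ (α := ι))]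
    refine Finset.sum_congr rfl fun u _ => ?_
    rw [← Finset.mul_sum]
    congr 1
    simp_rw [Finset.mul_sum]
    rw [Finset.sum_comm]
    refine Finset.sum_congr rfl fun k _ => ?_
    exact sum_pi_prod_mul_apply (fun k a => W k u a) k (fun j _ => (hW j u).2)
      (fun a => Real.log (W k u a / q k u a))
  rw [hR] at hsum
  have hl2 : 0 < Real.log 2 := Real.log_pos one_lt_two
  have h3 : ∑ k, ∑ u, μ u * ∑ a, W k u a * Real.logb 2 (W k u a / q k u a) =
      (∑ k, ∑ u, μ u * ∑ a, W k u a * Real.log (W k u a / q k u a)) / Real.log 2 := by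
    simp_rw [Real.logb, mul_div_assoc', ← Finset.sum_div, mul_div_assoc', ← Finset.sum_div]
  rw [h3, le_div_iff₀ hl2, Real.logb, sub_mul, mul_assoc, div_mul_cancel₀ _ hl2.ne']
  linarith

end Fano

/-! ### Single-letter mutual information. -/

section SingleLetter

variable {X T : Type*} [Fintype X] [Fintype T]

/-- The mutual information, in bits, between the input and the output of the channel `V` with input
law `p`. -/
def mutualInfo (p : X → ℝ) (V : X → T → ℝ) : ℝ :=
  ∑ a, p a * ∑ t, V a t * Real.logb 2 (V a t / ∑ b, p b * V b t)

theorem sum_mul_pos {p : X → ℝ} (hp : p ∈ stdSimplex ℝ X) {V : X → T → ℝ}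
    (hV : ∀ a, V a ∈ stdSimplex ℝ T) {a : X} {t : T} (ha : p a ≠ 0) (ht : V a t ≠ 0) :
    0 < ∑ b, p b * V b t :=
  Finset.sum_pos' (fun b _ => mul_nonneg (hp.1 b) ((hV b).1 t))
    ⟨a, Finset.mem_univ a, mul_pos (lt_of_le_of_ne (hp.1 a) ha.symm)
      (lt_of_le_of_ne ((hV a).1 t) ht.symm)⟩

theorem sum_mul_mem_stdSimplex {p : X → ℝ} (hp : p ∈ stdSimplex ℝ X) {V : X → T → ℝ}
    (hV : ∀ a, V a ∈ stdSimplex ℝ T) : (fun t => ∑ b, p b * V b t) ∈ stdSimplex ℝ T := by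
  refine ⟨fun t => Finset.sum_nonneg fun b _ => mul_nonneg (hp.1 b) ((hV b).1 t), ?_⟩
  rw [Finset.sum_comm]
  simp_rw [← Finset.mul_sum, fun b => (hV b).2, mul_one, hp.2]

theorem le_one_of_mem_stdSimplex {p : X → ℝ} (hp : p ∈ stdSimplex ℝ X) (a : X) : p a ≤ 1 :=
  (Finset.single_le_sum (fun i _ => hp.1 i) (Finset.mem_univ a)).trans hp.2.le

theorem abs_sum_mul_le {w : X → ℝ} (hw : w ∈ stdSimplex ℝ X) {f : X → ℝ} {b : ℝ}
    (hf : ∀ a, |f a| ≤ b) : |∑ a, w a * f a| ≤ b := by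
  refine (Finset.abs_sum_le_sum_abs _ _).trans ?_
  refine (Finset.sum_le_sum fun a _ => ?_).trans_eq
    ((Finset.sum_mul (Finset.univ : Finset X) w b).symm.trans (by rw [hw.2, one_mul]))
  rw [abs_mul, abs_of_nonneg (hw.1 a)]
  exact mul_le_mul_of_nonneg_left (hf a) (hw.1 a)

/-- Every summand is at most 1 nat in absolute value: with output law `Q` one has `p * V ≤ Q ≤ 1`,
and `1 - 1 / x ≤ log x ≤ x - 1` at `x = V / Q`. Only uniformity in `p` matters later. -/
theorem abs_mutualInfo_le {p : X → ℝ} (hp : p ∈ stdSimplex ℝ X) {V : X → T → ℝ}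
    (hV : ∀ a, V a ∈ stdSimplex ℝ T) :
    |mutualInfo p V| ≤ (Fintype.card X * Fintype.card T) / Real.log 2 := by
  have hl2 : 0 < Real.log 2 := Real.log_pos one_lt_two
  have key : ∀ a t, |p a * (V a t * Real.logb 2 (V a t / ∑ b, p b * V b t))| ≤ 1 / Real.log 2 := by
    intro a t
    by_cases ha : p a = 0
    · simp [ha, hl2.le]
    by_cases ht : V a t = 0
    · simp [ht, hl2.le]
    have hq := sum_mul_pos hp hV ha ht
    have hq1 : ∑ b, p b * V b t ≤ 1 := le_one_of_mem_stdSimplex (sum_mul_mem_stdSimplex hp hV) t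
    have hv1 : V a t ≤ 1 := le_one_of_mem_stdSimplex (hV a) t
    have hp1 : p a ≤ 1 := le_one_of_mem_stdSimplex hp a
    have hle' : p a * V a t ≤ ∑ b, p b * V b t :=
      Finset.single_le_sum (f := fun b => p b * V b t)
        (fun b _ => mul_nonneg (hp.1 b) ((hV b).1 t)) (Finset.mem_univ a)
    have hp0 : 0 < p a := lt_of_le_of_ne (hp.1 a) (Ne.symm ha)
    have hv0 : 0 < V a t := lt_of_le_of_ne ((hV a).1 t) (Ne.symm ht)
    set Q := ∑ b, p b * V b t
    have h1 := Real.log_le_sub_one_of_pos (div_pos hv0 hq)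
    have h2 := Real.one_sub_inv_le_log_of_pos (div_pos hv0 hq)
    have hpv : 0 < p a * V a t := mul_pos hp0 hv0
    have h3 := mul_le_mul_of_nonneg_left h1 hpv.le
    have h4 := mul_le_mul_of_nonneg_left h2 hpv.le
    have h5 : p a * V a t * (V a t / Q) ≤ 1 := by
      rw [mul_div_assoc', div_le_one hq]
      nlinarith
    have h6 : p a * V a t * (V a t / Q)⁻¹ = p a * Q := by
      field_simp
    have h7 : p a * Q ≤ 1 := by nlinarith
    rw [Real.logb, ← mul_assoc, mul_div_assoc', abs_div, abs_of_pos hl2]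
    refine div_le_div_of_nonneg_right ?_ hl2.le
    rw [abs_le]
    constructor
    · rw [mul_sub, h6] at h4; linarith
    · rw [mul_sub] at h3; linarith
  unfold mutualInfo
  simp_rw [Finset.mul_sum]
  refine (Finset.abs_sum_le_sum_abs _ _).trans ?_
  refine (Finset.sum_le_sum fun a _ => (Finset.abs_sum_le_sum_abs _ _).trans
    (Finset.sum_le_sum fun t _ => key a t)).trans (le_of_eq ?_)
  simp only [Finset.sum_const, Finset.card_univ, nsmul_eq_mul]
  ring

variable {C : Type*} [Fintype C]

/-- When the joint law is disintegrated over the conditioning variable, the factors `w c` and `p c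
a` cancel inside the logarithm wherever they are nonzero, and the term vanishes elsewhere. -/
theorem condMutualInfo_eq_sum_mutualInfo {w : C → ℝ} {p : C → X → ℝ} {V : C → X → T → ℝ}
    (hp : ∀ c, p c ∈ stdSimplex ℝ X) (hV : ∀ c a, V c a ∈ stdSimplex ℝ T) :
    condMutualInfo (fun a t c => w c * p c a * V c a t) =
      ∑ c, w c * mutualInfo (p c) (V c) := by
  unfold condMutualInfo mutualInfo
  have h : ∀ a, ∑ t, ∑ c, w c * p c a * V c a t * Real.logb 2 (w c * p c a * V c a t *
      (∑ a', ∑ b', w c * p c a' * V c a' b') /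
        ((∑ b', w c * p c a * V c a b') * ∑ a', w c * p c a' * V c a' t)) =
      ∑ c, ∑ t, w c * (p c a * (V c a t * Real.logb 2 (V c a t / ∑ b, p c b * V c b t))) := by
    intro a
    rw [Finset.sum_comm]
    refine Finset.sum_congr rfl fun c _ => Finset.sum_congr rfl fun t _ => ?_
    by_cases hw : w c = 0
    · simp [hw]
    by_cases ha : p c a = 0
    · simp [ha]
    simp_rw [← Finset.mul_sum, (hV c _).2, mul_one, ← Finset.mul_sum, (hp c).2, mul_one, mul_assoc,
      ← Finset.mul_sum]
    congr 4
    -- At an output of probability zero both quotients are `0` by the convention for division.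
    rcases eq_or_ne (∑ i, p c i * V c i t) 0 with h0 | h0
    · simp [h0]
    · field_simp
  rw [Finset.sum_congr rfl fun a _ => h a, Finset.sum_comm]
  exact Finset.sum_congr rfl fun c _ => by simp_rw [Finset.mul_sum]

theorem prod_mem_stdSimplex {p : X → ℝ} {q : T → ℝ} (hp : p ∈ stdSimplex ℝ X)
    (hq : q ∈ stdSimplex ℝ T) : (fun x : X × T => p x.1 * q x.2) ∈ stdSimplex ℝ (X × T) := by
  refine ⟨fun x => mul_nonneg (hp.1 _) (hq.1 _), ?_⟩
  rw [Fintype.sum_prod_type]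
  simp_rw [← Finset.mul_sum, hq.2, mul_one, hp.2]

end SingleLetter

/-! ### The effective channels of the two phases and the five informations. -/

section Kernels

variable {XA XB XR YA YB YR T : Type*} [Fintype YA] [Fintype YB] [Fintype YR]
  (ch : HalfDuplexChannel XA XB XR YA YB YR)

namespace HalfDuplexChannel

/-- The law of the output of the relay when both terminals transmit. -/
def relayKernel (xa : XA) (xb : XB) (s : Option YR) : ℝ :=
  ∑ ya, ∑ yb, ch.prob (some xa) (some xb) none (ya, yb, s)

open Classical in
/-- The law of the function `g` of the outputs when the relay transmits. -/
def terminalKernel (g : Option YA × Option YB × Option YR → T) (xr : XR) (t : T) : ℝ :=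
  ∑ z, if g z = t then ch.prob none none (some xr) z else 0

theorem relayKernel_mem (xa : XA) (xb : XB) :
    ch.relayKernel xa xb ∈ stdSimplex ℝ (Option YR) := by
  refine ⟨fun s => Finset.sum_nonneg fun _ _ => Finset.sum_nonneg fun _ _ =>
    (ch.prob_mem _ _ _).1 _, ?_⟩
  rw [← (ch.prob_mem (some xa) (some xb) none).2]
  unfold relayKernel
  rw [Finset.sum_comm, Fintype.sum_prod_type]
  refine Finset.sum_congr rfl fun ya _ => ?_
  rw [Finset.sum_comm, Fintype.sum_prod_type]

theorem terminalKernel_mem [Fintype T] (g : Option YA × Option YB × Option YR → T) (xr : XR) :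
    ch.terminalKernel g xr ∈ stdSimplex ℝ T := by
  classical
  refine ⟨fun t => Finset.sum_nonneg fun z _ => ?_, ?_⟩
  · split_ifs
    · exact (ch.prob_mem _ _ _).1 _
    · exact le_rfl
  · unfold terminalKernel
    rw [Finset.sum_comm]
    simp [(ch.prob_mem none none (some xr)).2]

theorem terminalKernel_fst (xr : XR) (t : Option YA) :
    ch.terminalKernel Prod.fst xr t = ∑ yb, ∑ yr, ch.prob none none (some xr) (t, yb, yr) := by
  classical
  unfold terminalKernel
  rw [Fintype.sum_prod_type, Finset.sum_eq_single t]
  · simp [Fintype.sum_prod_type]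
  · intro b _ hb
    simp [hb]
  · simp

theorem terminalKernel_snd_fst (xr : XR) (t : Option YB) :
    ch.terminalKernel (fun z => z.2.1) xr t =
      ∑ ya, ∑ yr, ch.prob none none (some xr) (ya, t, yr) := by
  classical
  unfold terminalKernel
  rw [Fintype.sum_prod_type]
  refine Finset.sum_congr rfl fun ya _ => ?_
  rw [Fintype.sum_prod_type, Finset.sum_eq_single t]
  · simp
  · intro b _ hb
    simp [hb]
  · simp

theorem fst_eq_none (xa : XA) (xb : XB) (xr : Option XR) (z : Option YA × Option YB × Option YR)
    (hz : ch.prob (some xa) (some xb) xr z ≠ 0) : z.1 = none := by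
  by_contra h
  simpa using (ch.halfDuplex _ _ _ _ hz).1.2 h

theorem snd_fst_eq_none (xa : XA) (xb : XB) (xr : Option XR)
    (z : Option YA × Option YB × Option YR)
    (hz : ch.prob (some xa) (some xb) xr z ≠ 0) : z.2.1 = none := by
  by_contra h
  simpa using (ch.halfDuplex _ _ _ _ hz).2.1.2 h

end HalfDuplexChannel

namespace InputDist

variable [Fintype XA] [Fintype XB] [Fintype XR] {m : ℕ} (P : InputDist m XA XB XR)

theorem infoAR_eq : P.infoAR ch = ∑ q, P.pQ q * ∑ xb, P.pB q xb *
    mutualInfo (P.pA q) fun xa => ch.relayKernel xa xb := by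
  have := condMutualInfo_eq_sum_mutualInfo (w := fun c : XB × Fin m => P.pQ c.2 * P.pB c.2 c.1)
    (p := fun c => P.pA c.2) (V := fun c xa => ch.relayKernel xa c.1) (fun c => P.pA_mem c.2)
    (fun c xa => ch.relayKernel_mem xa c.1)
  unfold infoAR joint1
  convert this using 1
  · congr 1
    ext a t c
    unfold HalfDuplexChannel.relayKernel
    ring
  · rw [Fintype.sum_prod_type_right]
    simp_rw [Finset.mul_sum, mul_assoc]

theorem infoBR_eq : P.infoBR ch = ∑ q, P.pQ q * ∑ xa, P.pA q xa *
    mutualInfo (P.pB q) fun xb => ch.relayKernel xa xb := by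
  have := condMutualInfo_eq_sum_mutualInfo (w := fun c : XA × Fin m => P.pQ c.2 * P.pA c.2 c.1)
    (p := fun c => P.pB c.2) (V := fun c xb => ch.relayKernel c.1 xb) (fun c => P.pB_mem c.2)
    (fun c xb => ch.relayKernel_mem c.1 xb)
  unfold infoBR joint1
  convert this using 1
  · rfl
  rw [Fintype.sum_prod_type_right]
  simp_rw [Finset.mul_sum, mul_assoc]

theorem infoABR_eq : P.infoABR ch = ∑ q, P.pQ q *
    mutualInfo (fun x : XA × XB => P.pA q x.1 * P.pB q x.2) fun x => ch.relayKernel x.1 x.2 := by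
  have := condMutualInfo_eq_sum_mutualInfo (w := P.pQ)
    (p := fun q (x : XA × XB) => P.pA q x.1 * P.pB q x.2)
    (V := fun _ x => ch.relayKernel x.1 x.2)
    (fun q => prod_mem_stdSimplex (P.pA_mem q) (P.pB_mem q))
    (fun c x => ch.relayKernel_mem x.1 x.2)
  unfold infoABR joint1
  convert this using 1
  congr 1
  ext a t c
  unfold HalfDuplexChannel.relayKernel
  ring

theorem infoRB_eq : P.infoRB ch = ∑ q, P.pQ q *
    mutualInfo (P.pR q) (ch.terminalKernel fun z => z.2.1) := by
  have := condMutualInfo_eq_sum_mutualInfo (w := P.pQ) (p := P.pR)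
    (V := fun _ => ch.terminalKernel fun z => z.2.1)
    P.pR_mem (fun c x => ch.terminalKernel_mem _ x)
  unfold infoRB joint2
  convert this using 1
  congr 1
  ext a t c
  rw [ch.terminalKernel_snd_fst, Finset.mul_sum]

theorem infoRA_eq : P.infoRA ch = ∑ q, P.pQ q *
    mutualInfo (P.pR q) (ch.terminalKernel Prod.fst) := by
  have := condMutualInfo_eq_sum_mutualInfo (w := P.pQ) (p := P.pR)
    (V := fun _ => ch.terminalKernel Prod.fst)
    P.pR_mem (fun c x => ch.terminalKernel_mem _ x)
  unfold infoRA joint2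
  convert this using 1
  congr 1
  ext a t c
  rw [ch.terminalKernel_fst, Finset.mul_sum]

/-- All five informations are bounded by a constant that depends on the channel only. -/
theorem exists_abs_info_le : ∃ B : ℝ, ∀ (m : ℕ) (P : InputDist m XA XB XR),
    |P.infoAR ch| ≤ B ∧ |P.infoBR ch| ≤ B ∧ |P.infoABR ch| ≤ B ∧ |P.infoRB ch| ≤ B ∧
      |P.infoRA ch| ≤ B := by
  have hl2 : 0 < Real.log 2 := Real.log_pos one_lt_two
  have hpos : ∀ x y : ℕ, 0 ≤ (x * y : ℝ) / Real.log 2 := fun x y => by positivity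
  let b : ℕ → ℕ → ℝ := fun x y => (x * y : ℝ) / Real.log 2
  refine ⟨b (Fintype.card XA) (Fintype.card (Option YR)) +
    b (Fintype.card XB) (Fintype.card (Option YR)) +
    b (Fintype.card (XA × XB)) (Fintype.card (Option YR)) +
    b (Fintype.card XR) (Fintype.card (Option YB)) +
    b (Fintype.card XR) (Fintype.card (Option YA)), fun m P => ?_⟩
  have h1 : |P.infoAR ch| ≤ b (Fintype.card XA) (Fintype.card (Option YR)) := by
    rw [P.infoAR_eq]
    exact abs_sum_mul_le P.pQ_mem fun q => abs_sum_mul_le (P.pB_mem q) fun xb =>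
      abs_mutualInfo_le (P.pA_mem q) fun xa => ch.relayKernel_mem xa xb
  have h2 : |P.infoBR ch| ≤ b (Fintype.card XB) (Fintype.card (Option YR)) := by
    rw [P.infoBR_eq]
    exact abs_sum_mul_le P.pQ_mem fun q => abs_sum_mul_le (P.pA_mem q) fun xa =>
      abs_mutualInfo_le (P.pB_mem q) fun xb => ch.relayKernel_mem xa xb
  have h3 : |P.infoABR ch| ≤ b (Fintype.card (XA × XB)) (Fintype.card (Option YR)) := by
    rw [P.infoABR_eq]
    exact abs_sum_mul_le P.pQ_mem fun q => abs_mutualInfo_le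
      (prod_mem_stdSimplex (P.pA_mem q) (P.pB_mem q)) fun x => ch.relayKernel_mem x.1 x.2
  have h4 : |P.infoRB ch| ≤ b (Fintype.card XR) (Fintype.card (Option YB)) := by
    rw [P.infoRB_eq]
    exact abs_sum_mul_le P.pQ_mem fun q =>
      abs_mutualInfo_le (P.pR_mem q) fun x => ch.terminalKernel_mem _ x
  have h5 : |P.infoRA ch| ≤ b (Fintype.card XR) (Fintype.card (Option YA)) := by
    rw [P.infoRA_eq]
    exact abs_sum_mul_le P.pQ_mem fun q =>
      abs_mutualInfo_le (P.pR_mem q) fun x => ch.terminalKernel_mem _ x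
  have g1 := hpos (Fintype.card XA) (Fintype.card (Option YR))
  have g2 := hpos (Fintype.card XB) (Fintype.card (Option YR))
  have g3 := hpos (Fintype.card (XA × XB)) (Fintype.card (Option YR))
  have g4 := hpos (Fintype.card XR) (Fintype.card (Option YB))
  have g5 := hpos (Fintype.card XR) (Fintype.card (Option YA))
  refine ⟨?_, ?_, ?_, ?_, ?_⟩ <;> linarith

end InputDist

end Kernels

/-! ### Factorization of the block law of a half-duplex code. -/

section Gate

variable {T : Type*}

open Classical in
/-- The output law `v` if the channel is in use, and the point mass at `none` otherwise. -/
def gate (b : Prop) (v : Option T → ℝ) (t : Option T) : ℝ :=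
  if b then v t else if t = none then 1 else 0

theorem gate_mem [Fintype T] {b : Prop} {v : Option T → ℝ} (hv : v ∈ stdSimplex ℝ (Option T)) :
    gate b v ∈ stdSimplex ℝ (Option T) := by
  classical
  by_cases hb : b
  · convert hv using 1
    ext t
    simp [gate, hb]
  · refine ⟨fun t => ?_, ?_⟩
    · simp only [gate, hb, if_false]
      split_ifs <;> norm_num
    · simp [gate, hb]

end Gate

namespace Code

variable {XA XB XR YA YB YR T : Type*} [Fintype YA] [Fintype YB] [Fintype YR] [Fintype T]
  {n Ma Mb : ℕ}
  (C : Code XA XB XR YA YB YR n Ma Mb) (ch : HalfDuplexChannel XA XB XR YA YB YR)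

/-- In a half-duplex channel the outputs of a code may be computed as if the terminals ignored
their outputs. -/
theorem outputProb_eq (wa : Fin Ma) (wb : Fin Mb)
    (y : Fin n → Option YA × Option YB × Option YR) :
    C.outputProb ch wa wb y = ∏ k : Fin n, ch.prob
      (C.encA wa k fun _ => none) (C.encB wb k fun _ => none)
      (C.encR k fun j => (y ⟨j, j.2.trans k.2⟩).2.2) (y k) := by
  unfold outputProb
  -- If a terminal hears a symbol in phase 1, both products vanish. Otherwise every past that enters
  -- a phase 1 terminal encoder is constantly `none`, and in phase 2 the terminals are silent
  -- whatever they heard.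
  by_cases hy : ∃ j : Fin n, (j : ℕ) < C.phase1 ∧ ((y j).1 ≠ none ∨ (y j).2.1 ≠ none)
  · obtain ⟨j, hj, hyj⟩ := hy
    have hz : ∀ p q r, ch.prob (C.encA wa j p) (C.encB wb j q) r (y j) = 0 := by
      intro p q r
      by_contra h
      have h2 := ch.halfDuplex _ _ _ _ h
      rcases hyj with h3 | h3
      · exact C.encA_phase1 wa j p hj (h2.1.2 h3)
      · exact C.encB_phase1 wb j q hj (h2.2.1.2 h3)
    rw [Finset.prod_eq_zero (Finset.mem_univ j) (hz _ _ _),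
      Finset.prod_eq_zero (Finset.mem_univ j) (hz _ _ _)]
  · push Not at hy
    refine Finset.prod_congr rfl fun k _ => ?_
    rcases lt_or_ge (k : ℕ) C.phase1 with hk | hk
    · congr 2
      · funext j
        exact (hy ⟨j, j.2.trans k.2⟩ (lt_trans j.2 hk)).1
      · funext j
        exact (hy ⟨j, j.2.trans k.2⟩ (lt_trans j.2 hk)).2
    · rw [C.encA_phase2 wa k _ hk, C.encA_phase2 wa k _ hk, C.encB_phase2 wb k _ hk,
        C.encB_phase2 wb k _ hk]

/-- The joint law of the outputs at the relay and at a terminal: the relay outputs are independent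
given the messages, and the terminal outputs are independent given the relay outputs. -/
theorem sum_outputProb_mul (wa : Fin Ma) (wb : Fin Mb)
    (g : Option YA × Option YB × Option YR → Option T)
    (hg : ∀ xa xb xr z, ch.prob (some xa) (some xb) xr z ≠ 0 → g z = none)
    {xA : Fin n → XA} {xB : Fin n → XB} {xR : (Fin n → Option YR) → Fin n → XR}
    (hA : ∀ k : Fin n, (k : ℕ) < C.phase1 → (C.encA wa k fun _ => none) = some (xA k))
    (hB : ∀ k : Fin n, (k : ℕ) < C.phase1 → (C.encB wb k fun _ => none) = some (xB k))
    (hR : ∀ s (k : Fin n), C.phase1 ≤ (k : ℕ) →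
      (C.encR k fun j => s ⟨j, j.2.trans k.2⟩) = some (xR s k))
    (F : (Fin n → Option YR) → (Fin n → Option T) → ℝ) :
    ∑ y, C.outputProb ch wa wb y * F (fun k => (y k).2.2) (fun k => g (y k)) =
      ∑ s : Fin n → Option YR, (∏ k : Fin n, gate ((k : ℕ) < C.phase1)
          (ch.relayKernel (xA k) (xB k)) (s k)) *
        ∑ t : Fin n → Option T, (∏ k : Fin n, gate (C.phase1 ≤ (k : ℕ))
          (ch.terminalKernel g (xR s k)) (t k)) * F s t := by
  classical
  -- Summing over `s` and `t` with indicators makes the relay input a function of `s` instead of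
  -- `y`, after which the sum over `y` factors over time.
  have h1 : ∀ y : Fin n → Option YA × Option YB × Option YR,
      C.outputProb ch wa wb y * F (fun k => (y k).2.2) (fun k => g (y k)) =
      ∑ s : Fin n → Option YR, ∑ t : Fin n → Option T,
        (∏ k : Fin n, if (y k).2.2 = s k ∧ g (y k) = t k then
          ch.prob (C.encA wa k fun _ => none) (C.encB wb k fun _ => none)
            (C.encR k fun j => s ⟨j, j.2.trans k.2⟩) (y k) else 0) * F s t := by
    intro y
    rw [Finset.sum_eq_single fun k => (y k).2.2, Finset.sum_eq_single fun k => g (y k)]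
    · simp [outputProb_eq]
    · intro t _ ht
      obtain ⟨k, hk⟩ := Function.ne_iff.1 ht
      rw [Finset.prod_eq_zero (Finset.mem_univ k), zero_mul]
      simp [Ne.symm hk]
    · simp
    · intro s _ hs
      obtain ⟨k, hk⟩ := Function.ne_iff.1 hs
      refine Finset.sum_eq_zero fun t _ => ?_
      rw [Finset.prod_eq_zero (Finset.mem_univ k), zero_mul]
      simp [Ne.symm hk]
    · simp
  simp_rw [h1]
  rw [Finset.sum_comm]
  refine Finset.sum_congr rfl fun s _ => ?_
  rw [Finset.sum_comm, Finset.mul_sum]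
  refine Finset.sum_congr rfl fun t _ => ?_
  rw [← Finset.sum_mul, ← mul_assoc, ← Finset.prod_mul_distrib,
    sum_pi_prod (fun (k : Fin n) z => if z.2.2 = s k ∧ g z = t k then
          ch.prob (C.encA wa k fun _ => none) (C.encB wb k fun _ => none)
            (C.encR k fun j => s ⟨j, j.2.trans k.2⟩) z else 0)]
  congr 1
  refine Finset.prod_congr rfl fun k _ => ?_
  -- In each phase the transmitting side observes `none`: by `hg` for the terminal in phase 1, by
  -- `halfDuplex` for the relay in phase 2. This is the point mass supplied by the closed gate.
  rcases lt_or_ge (k : ℕ) C.phase1 with hk | hk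
  · rw [hA k hk, hB k hk, C.encR_phase1 k _ hk]
    simp only [gate, hk, not_le.2 hk, if_true, if_false]
    by_cases ht : t k = none
    · rw [ht]
      simp only [if_true, mul_one]
      rw [Fintype.sum_prod_type]
      unfold HalfDuplexChannel.relayKernel
      refine Finset.sum_congr rfl fun ya _ => ?_
      rw [Fintype.sum_prod_type]
      refine Finset.sum_congr rfl fun yb _ => ?_
      rw [Finset.sum_eq_single (s k)]
      · by_cases hp : ch.prob (some (xA k)) (some (xB k)) none (ya, yb, s k) = 0
        · simp [hp]
        · simp [hg _ _ _ _ hp]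
      · intro b _ hb
        simp [hb]
      · simp
    · rw [if_neg ht, mul_zero]
      refine Finset.sum_eq_zero fun z _ => ?_
      split_ifs with h
      · by_contra hp
        exact ht (h.2 ▸ hg _ _ _ _ hp)
      · rfl
  · rw [hR s k hk, C.encA_phase2 wa k _ hk, C.encB_phase2 wb k _ hk]
    simp only [gate, hk, not_lt.2 hk, if_true, if_false]
    have hn : ∀ z, ch.prob none none (some (xR s k)) z ≠ 0 → z.2.2 = none := by
      intro z hz
      by_contra h
      simpa using (ch.halfDuplex _ _ _ _ hz).2.2.2 h
    by_cases hs : s k = none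
    · rw [hs]
      simp only [if_true, one_mul]
      unfold HalfDuplexChannel.terminalKernel
      refine Finset.sum_congr rfl fun z _ => ?_
      by_cases hp : ch.prob none none (some (xR s k)) z = 0
      · simp [hp]
      · simp [hn z hp]
    · rw [if_neg hs, zero_mul]
      refine Finset.sum_eq_zero fun z _ => ?_
      split_ifs with h
      · by_contra hp
        exact hs (h.1 ▸ hn z hp)
      · rfl

end Code

/-! ### Indicators, image laws and blind guessing. -/

section EmpiricalLaw

open Classical in
/-- The indicator of a proposition. -/
def ind (p : Prop) : ℝ :=
  if p then 1 else 0

theorem ind_eq_zero_or_one (p : Prop) : ind p = 0 ∨ ind p = 1 := by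
  unfold ind
  split_ifs <;> simp

theorem ind_of {p : Prop} (h : p) : ind p = 1 := if_pos h

theorem ind_of_not {p : Prop} (h : ¬p) : ind p = 0 := if_neg h

theorem ind_nonneg (p : Prop) : 0 ≤ ind p := by
  unfold ind
  split_ifs <;> simp

theorem ind_le_one (p : Prop) : ind p ≤ 1 := by
  unfold ind
  split_ifs <;> simp

theorem ind_mono {p q : Prop} (h : p → q) : ind p ≤ ind q := by
  by_cases hp : p
  · rw [ind_of hp, ind_of (h hp)]
  · rw [ind_of_not hp]
    exact ind_nonneg q

theorem sum_ind_eq {A : Type*} [Fintype A] (a : A) : ∑ b, ind (a = b) = 1 := by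
  classical
  unfold ind
  rw [Finset.sum_eq_single a]
  · simp
  · intro b _ hb
    simp [hb.symm]
  · simp

variable {U X : Type*} [Fintype U] [Fintype X]

open Classical in
/-- The law of `f` under the mass function `μ`. -/
def lawOf (μ : U → ℝ) (f : U → X) (x : X) : ℝ :=
  ∑ u, if f u = x then μ u else 0

theorem sum_lawOf_mul (μ : U → ℝ) (f : U → X) (h : X → ℝ) :
    ∑ x, lawOf μ f x * h x = ∑ u, μ u * h (f u) := by
  classical
  unfold lawOf
  simp_rw [Finset.sum_mul]
  rw [Finset.sum_comm]
  simp

theorem lawOf_mem {μ : U → ℝ} (hμ : μ ∈ stdSimplex ℝ U) (f : U → X) :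
    lawOf μ f ∈ stdSimplex ℝ X := by
  classical
  refine ⟨fun x => Finset.sum_nonneg fun u _ => ?_, ?_⟩
  · split_ifs
    · exact hμ.1 u
    · exact le_rfl
  · simpa [hμ.2] using sum_lawOf_mul μ f fun _ => 1

theorem le_lawOf {U X : Type*} [Fintype U] {μ : U → ℝ} (hμ : ∀ u, 0 ≤ μ u) (f : U → X) (u : U) :
    μ u ≤ lawOf μ f (f u) := by
  classical
  have := Finset.single_le_sum (f := fun v => if f v = f u then μ v else 0)
    (fun v _ => by split_ifs; exacts [hμ v, le_rfl]) (Finset.mem_univ u)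
  simpa [lawOf] using this

theorem uniform_mem_stdSimplex (U : Type*) [Fintype U] [Nonempty U] :
    (fun _ : U => 1 / (Fintype.card U : ℝ)) ∈ stdSimplex ℝ U := by
  refine ⟨fun _ => by positivity, ?_⟩
  rw [Finset.sum_const, Finset.card_univ, nsmul_eq_mul]
  field_simp

/-- A uniform message that is independent of the observation is guessed correctly with
probability `1 / |A|`. -/
theorem sum_uniform_guess {A C τ : Type*} [Fintype A] [Fintype C] [Fintype τ] {ν : C → ℝ}
    (hν : ν ∈ stdSimplex ℝ C) {r : C → τ → ℝ} (hr : ∀ c, r c ∈ stdSimplex ℝ τ) (d : C → τ → A) :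
    ∑ u : A × C, 1 / (Fintype.card A : ℝ) * ν u.2 *
      ∑ t, r u.2 t * ind (d u.2 t = u.1) = 1 / Fintype.card A := by
  rw [Fintype.sum_prod_type_right]
  simp_rw [← Finset.mul_sum]
  have : ∀ c, ∑ a, ∑ t, r c t * ind (d c t = a) = 1 := by
    intro c
    rw [Finset.sum_comm]
    simp_rw [← Finset.mul_sum, sum_ind_eq, mul_one, (hr c).2]
  simp_rw [this, mul_one, ← Finset.mul_sum, hν.2, mul_one]

end EmpiricalLaw

/-! ### Phase lengths, and divergences of gated laws. -/

section Counting

theorem card_filter_lt {n m : ℕ} (h : m ≤ n) :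
    (Finset.univ.filter fun k : Fin n => (k : ℕ) < m).card = m := by
  rw [Fin.card_filter_val_lt, min_eq_right h]

theorem card_filter_ge {n m : ℕ} (h : m ≤ n) :
    ((Finset.univ.filter fun k : Fin n => m ≤ (k : ℕ)).card : ℝ) = n - m := by
  have := Finset.card_filter_add_card_filter_not (s := (Finset.univ : Finset (Fin n)))
    fun k => (k : ℕ) < m
  rw [card_filter_lt h] at this
  simp only [not_lt, Finset.card_univ, Fintype.card_fin] at this
  have h2 : (m : ℝ) + ((Finset.univ.filter fun k : Fin n => m ≤ (k : ℕ)).card : ℝ) = n := by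
    exact_mod_cast this
  linarith

end Counting

section GateInfo

variable {T : Type*} [Fintype T]

theorem sum_gate_mul_logb (b : Prop) [Decidable b] (v q : Option T → ℝ) :
    ∑ t, gate b v t * Real.logb 2 (gate b v t / gate b q t) =
      if b then ∑ t, v t * Real.logb 2 (v t / q t) else 0 := by
  split_ifs with h
  · simp [gate, h]
  · refine Finset.sum_eq_zero fun t _ => ?_
    by_cases ht : t = none <;> simp [gate, h, ht]

theorem sum_ite_eq_sum_filter {ι : Type*} [Fintype ι] (p : ι → Prop) [DecidablePred p]
    (f : ι → ℝ) : ∑ k, (if p k then f k else 0) = ∑ k ∈ Finset.univ.filter p, f k :=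
  (Finset.sum_filter _ _).symm

end GateInfo

variable {XA XB XR YA YB YR : Type*} [Fintype YA] [Fintype YB] [Fintype YR]
  (ch : HalfDuplexChannel XA XB XR YA YB YR)

/-! ### Time sharing with at most four values. -/

section TimeSharing

variable [Fintype XA] [Fintype XB] [Fintype XR]

namespace HalfDuplexChannel

/-- `I(Xa; Yr | Xb)` in the first phase for independent inputs. -/
def rateA (pA : XA → ℝ) (pB : XB → ℝ) : ℝ :=
  ∑ xb, pB xb * mutualInfo pA fun xa => ch.relayKernel xa xb

/-- `I(Xb; Yr | Xa)` in the first phase for independent inputs. -/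
def rateB (pA : XA → ℝ) (pB : XB → ℝ) : ℝ :=
  ∑ xa, pA xa * mutualInfo pB fun xb => ch.relayKernel xa xb

/-- `I(Xa, Xb; Yr)` in the first phase for independent inputs. -/
def rateAB (pA : XA → ℝ) (pB : XB → ℝ) : ℝ :=
  mutualInfo (fun x : XA × XB => pA x.1 * pB x.2) fun x => ch.relayKernel x.1 x.2

end HalfDuplexChannel

/-- The mean of the rate triples lies in the convex hull of a subset of a 3-dimensional space, so
Carathéodory's theorem applies. The relay law is the same for all `q`, so that the phase 2 bounds,
proved for one input law, hold for the same `P`. -/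
theorem exists_timeSharing [Nonempty XA] [Nonempty XB] {ι : Type*} (s : Finset ι)
    {pA : ι → XA → ℝ} {pB : ι → XB → ℝ} (hA : ∀ k, pA k ∈ stdSimplex ℝ XA)
    (hB : ∀ k, pB k ∈ stdSimplex ℝ XB) {pR : XR → ℝ} (hR : pR ∈ stdSimplex ℝ XR) :
    ∃ m ≤ 4, ∃ P : InputDist m XA XB XR, (∀ q, P.pR q = pR) ∧
      ∑ k ∈ s, ch.rateA (pA k) (pB k) = s.card * P.infoAR ch ∧
      ∑ k ∈ s, ch.rateB (pA k) (pB k) = s.card * P.infoBR ch ∧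
      ∑ k ∈ s, ch.rateAB (pA k) (pB k) = s.card * P.infoABR ch := by
  classical
  -- With no channel use to average over, any distribution serves.
  rcases s.eq_empty_or_nonempty with rfl | hs
  · refine ⟨1, by norm_num, ⟨fun _ => 1, fun _ _ => 1 / (Fintype.card XA : ℝ),
      fun _ _ => 1 / (Fintype.card XB : ℝ), fun _ => pR,
      ⟨fun _ => zero_le_one, by simp⟩, fun _ => uniform_mem_stdSimplex XA,
      fun _ => uniform_mem_stdSimplex XB, fun _ => hR⟩, fun _ => rfl, ?_, ?_, ?_⟩ <;> simp
  let v : (XA → ℝ) × (XB → ℝ) → ℝ × ℝ × ℝ := fun p =>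
    (ch.rateA p.1 p.2, ch.rateB p.1 p.2, ch.rateAB p.1 p.2)
  let S : Set (ℝ × ℝ × ℝ) := v '' (stdSimplex ℝ XA ×ˢ stdSimplex ℝ XB)
  have hcard : (0 : ℝ) < s.card := by exact_mod_cast hs.card_pos
  have hmem : ∑ k ∈ s, (1 / (s.card : ℝ)) • v (pA k, pB k) ∈ convexHull ℝ S := by
    refine (convex_convexHull ℝ S).sum_mem (fun _ _ => by positivity) ?_
      fun k _ => subset_convexHull ℝ S ⟨_, ⟨hA k, hB k⟩, rfl⟩
    rw [Finset.sum_const, nsmul_eq_mul]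
    field_simp
  obtain ⟨κ, _, z, w, hz, haff, hw0, hw1, hwz⟩ := eq_pos_convex_span_of_mem_convexHull hmem
  -- Affinely independent points in dimension 3 number at most 4.
  have hκ : Fintype.card κ ≤ 4 := by
    have := haff.card_le_finrank_succ
    refine this.trans ?_
    have h3 : Module.finrank ℝ (vectorSpan ℝ (Set.range z)) ≤ 3 :=
      (Submodule.finrank_le _).trans (by simp)
    omega
  have hz' : ∀ i, ∃ p ∈ stdSimplex ℝ XA ×ˢ stdSimplex ℝ XB, v p = z i := fun i =>
    hz ⟨i, rfl⟩
  choose p hp hpz using hz'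
  let e := Fintype.equivFin κ
  let P : InputDist (Fintype.card κ) XA XB XR :=
    ⟨fun q => w (e.symm q), fun q => (p (e.symm q)).1, fun q => (p (e.symm q)).2, fun _ => pR,
      ⟨fun q => (hw0 _).le, by rw [← hw1]; exact e.symm.sum_comp w⟩,
      fun q => (hp _).1, fun q => (hp _).2, fun _ => hR⟩
  have hsum : ∑ i, w i • v (p i) = ∑ k ∈ s, (1 / (s.card : ℝ)) • v (pA k, pB k) := by
    rw [← hwz]
    simp_rw [hpz]
  refine ⟨_, hκ, P, fun _ => rfl, ?_, ?_, ?_⟩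
  · have h1 := congrArg (fun x => x.1) hsum
    simp only [Prod.fst_sum, Prod.smul_fst, smul_eq_mul, ← Finset.mul_sum] at h1
    have h2 : P.infoAR ch = ∑ i, w i * (v (p i)).1 := by
      rw [P.infoAR_eq]
      exact e.symm.sum_comp fun i => w i * (v (p i)).1
    rw [h2, h1]
    field_simp
    rfl
  · have h1 := congrArg (fun x => x.2.1) hsum
    simp only [Prod.snd_sum, Prod.fst_sum, Prod.smul_fst, Prod.smul_snd, smul_eq_mul,
      ← Finset.mul_sum] at h1
    have h2 : P.infoBR ch = ∑ i, w i * (v (p i)).2.1 := by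
      rw [P.infoBR_eq]
      exact e.symm.sum_comp fun i => w i * (v (p i)).2.1
    rw [h2, h1]
    field_simp
    rfl
  · have h1 := congrArg (fun x => x.2.2) hsum
    simp only [Prod.snd_sum, Prod.smul_snd, smul_eq_mul, ← Finset.mul_sum] at h1
    have h2 : P.infoABR ch = ∑ i, w i * (v (p i)).2.2 := by
      rw [P.infoABR_eq]
      exact e.symm.sum_comp fun i => w i * (v (p i)).2.2
    rw [h2, h1]
    field_simp
    rfl

end TimeSharing

/-! ### Codewords, and error probabilities in product form. -/

namespace Code

variable {n Ma Mb : ℕ} (C : Code XA XB XR YA YB YR n Ma Mb)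

theorem exists_eq_some_of_imp_ne_none {X : Type*} [Nonempty X] {o : Option X} {p : Prop}
    (h : p → o ≠ none) : ∃ x, p → o = some x := by
  cases o with
  | none => exact ⟨Classical.arbitrary X, fun hp => absurd rfl (h hp)⟩
  | some x => exact ⟨x, fun _ => rfl⟩

/-- By `outputProb_eq` only the terminal encoders at the all-`none` past matter, so terminals have
true codewords, while the relay input stays a function of its outputs. Symbols outside the active
phase are arbitrary. -/
theorem exists_codewords {XA XB XR YA YB YR : Type*} {n Ma Mb : ℕ}
    (C : Code XA XB XR YA YB YR n Ma Mb) [Nonempty XA] [Nonempty XB] [Nonempty XR] :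
    ∃ (xA : Fin Ma → Fin n → XA) (xB : Fin Mb → Fin n → XB)
      (xR : (Fin n → Option YR) → Fin n → XR),
      (∀ wa (k : Fin n), (k : ℕ) < C.phase1 → (C.encA wa k fun _ => none) = some (xA wa k)) ∧
      (∀ wb (k : Fin n), (k : ℕ) < C.phase1 → (C.encB wb k fun _ => none) = some (xB wb k)) ∧
      (∀ s (k : Fin n), C.phase1 ≤ (k : ℕ) →
        (C.encR k fun j => s ⟨j, j.2.trans k.2⟩) = some (xR s k)) := by
  choose xA hA using fun wa (k : Fin n) => exists_eq_some_of_imp_ne_none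
    (C.encA_phase1 wa k fun _ => none)
  choose xB hB using fun wb (k : Fin n) => exists_eq_some_of_imp_ne_none
    (C.encB_phase1 wb k fun _ => none)
  choose xR hR using fun (s : Fin n → Option YR) (k : Fin n) => exists_eq_some_of_imp_ne_none
    (C.encR_phase2 k fun j => s ⟨j, j.2.trans k.2⟩)
  exact ⟨xA, xB, xR, hA, hB, hR⟩

variable {xA : Fin Ma → Fin n → XA} {xB : Fin Mb → Fin n → XB}
  {xR : (Fin n → Option YR) → Fin n → XR}

/-- The messages together with the relay outputs form the variable given which the terminal outputs
are a product law, as the Fano bound requires. -/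
theorem eventProb_terminal {T : Type*} [Fintype T]
    {g : Option YA × Option YB × Option YR → Option T}
    (hg : ∀ xa xb xr z, ch.prob (some xa) (some xb) xr z ≠ 0 → g z = none)
    (hA : ∀ wa (k : Fin n), (k : ℕ) < C.phase1 → (C.encA wa k fun _ => none) = some (xA wa k))
    (hB : ∀ wb (k : Fin n), (k : ℕ) < C.phase1 → (C.encB wb k fun _ => none) = some (xB wb k))
    (hR : ∀ s (k : Fin n), C.phase1 ≤ (k : ℕ) →
      (C.encR k fun j => s ⟨j, j.2.trans k.2⟩) = some (xR s k))
    (D : Fin Ma → Fin Mb → (Fin n → Option T) → Prop) :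
    C.eventProb ch (fun wa wb y => D wa wb fun k => g (y k)) =
      ∑ u : (Fin Ma × Fin Mb) × (Fin n → Option YR),
        1 / ((Ma : ℝ) * Mb) * (∏ k : Fin n, gate ((k : ℕ) < C.phase1)
          (ch.relayKernel (xA u.1.1 k) (xB u.1.2 k)) (u.2 k)) *
        ∑ t : Fin n → Option T, (∏ k : Fin n, gate (C.phase1 ≤ (k : ℕ))
          (ch.terminalKernel g (xR u.2 k)) (t k)) * ind (D u.1.1 u.1.2 t) := by
  unfold eventProb
  rw [Fintype.sum_prod_type, Fintype.sum_prod_type, Finset.sum_div]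
  refine Finset.sum_congr rfl fun wa _ => ?_
  rw [Finset.sum_div]
  refine Finset.sum_congr rfl fun wb _ => ?_
  have := C.sum_outputProb_mul ch wa wb g hg (hA wa) (hB wb) hR
    fun _ t => ind (D wa wb t)
  simp only [ind, mul_ite, mul_one, mul_zero] at this ⊢
  rw [this, Finset.sum_div]
  exact Finset.sum_congr rfl fun s _ => by ring

theorem eventProb_relay
    (hA : ∀ wa (k : Fin n), (k : ℕ) < C.phase1 → (C.encA wa k fun _ => none) = some (xA wa k))
    (hB : ∀ wb (k : Fin n), (k : ℕ) < C.phase1 → (C.encB wb k fun _ => none) = some (xB wb k))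
    (hR : ∀ s (k : Fin n), C.phase1 ≤ (k : ℕ) →
      (C.encR k fun j => s ⟨j, j.2.trans k.2⟩) = some (xR s k))
    (D : Fin Ma → Fin Mb → (Fin n → Option YR) → Prop) :
    C.eventProb ch (fun wa wb y => D wa wb fun k => (y k).2.2) =
      ∑ u : Fin Ma × Fin Mb, 1 / ((Ma : ℝ) * Mb) *
        ∑ s : Fin n → Option YR, (∏ k : Fin n, gate ((k : ℕ) < C.phase1)
          (ch.relayKernel (xA u.1 k) (xB u.2 k)) (s k)) * ind (D u.1 u.2 s) := by
  unfold eventProb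
  rw [Fintype.sum_prod_type, Finset.sum_div]
  refine Finset.sum_congr rfl fun wa _ => ?_
  rw [Finset.sum_div]
  refine Finset.sum_congr rfl fun wb _ => ?_
  -- With a trivial terminal observation the inner sum is a total mass, equal to 1.
  have := C.sum_outputProb_mul (T := Empty) ch wa wb (fun _ => none) (fun _ _ _ _ _ => rfl)
    (hA wa) (hB wb) hR fun s _ => ind (D wa wb s)
  simp only [← Finset.sum_mul, (pi_prod_mem_stdSimplex fun k =>
    gate_mem (ch.terminalKernel_mem _ _)).2, one_mul] at this
  simp only [ind, mul_ite, mul_one, mul_zero] at this ⊢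
  rw [this]
  ring

end Code

variable {XA XB XR YA YB YR : Type*} [Fintype XA] [Fintype XB]
  [Fintype YA] [Fintype YB] [Fintype YR]
  (ch : HalfDuplexChannel XA XB XR YA YB YR)

section

variable {Ma Mb : ℕ} [NeZero Ma] [NeZero Mb]

theorem uniform_pair_mem :
    (fun _ : Fin Ma × Fin Mb => 1 / ((Ma : ℝ) * Mb)) ∈ stdSimplex ℝ (Fin Ma × Fin Mb) := by
  simpa using uniform_mem_stdSimplex (Fin Ma × Fin Mb)

theorem uniform_fin_mem : (fun _ : Fin Ma => 1 / (Ma : ℝ)) ∈ stdSimplex ℝ (Fin Ma) := by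
  simpa using uniform_mem_stdSimplex (Fin Ma)

end

/-! ### Converse for phase 1: the multiple access bounds. -/

section RelayBound

variable {n Ma Mb n₁ : ℕ} [NeZero Ma] [NeZero Mb]

/-- Common core of the three relay bounds, which differ only in the reference law `r` and the event
`D`. Outside phase 1 both laws are the point mass at `none` and contribute no divergence. -/
theorem relay_fano {XA XB XR YA YB YR : Type*} [Fintype YA] [Fintype YB] [Fintype YR]
    (ch : HalfDuplexChannel XA XB XR YA YB YR)
    (xA : Fin Ma → Fin n → XA) (xB : Fin Mb → Fin n → XB)
    {r : Fin n → Fin Ma × Fin Mb → Option YR → ℝ}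
    (hr : ∀ k u, r k u ∈ stdSimplex ℝ (Option YR))
    (hr0 : ∀ k u s, r k u s = 0 → ch.relayKernel (xA u.1 k) (xB u.2 k) s = 0)
    (D : Fin Ma × Fin Mb → (Fin n → Option YR) → Prop) {M : ℝ} (hM : 0 < M)
    (hQ : ∑ u, 1 / ((Ma : ℝ) * Mb) * ∑ s : Fin n → Option YR,
      (∏ k : Fin n, gate ((k : ℕ) < n₁) (r k u) (s k)) * ind (D u s) ≤ 1 / M) :
    (∑ u : Fin Ma × Fin Mb, 1 / ((Ma : ℝ) * Mb) * ∑ s : Fin n → Option YR,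
      (∏ k : Fin n, gate ((k : ℕ) < n₁) (ch.relayKernel (xA u.1 k) (xB u.2 k)) (s k)) *
        ind (D u s)) * Real.logb 2 M - 1 ≤
    ∑ k ∈ Finset.univ.filter fun k : Fin n => (k : ℕ) < n₁, ∑ u : Fin Ma × Fin Mb, 1 / ((Ma : ℝ) * Mb) *
      ∑ s, ch.relayKernel (xA u.1 k) (xB u.2 k) s *
        Real.logb 2 (ch.relayKernel (xA u.1 k) (xB u.2 k) s / r k u s) := by
  have := prob_mul_logb_sub_one_le_sum_divergence uniform_pair_mem
    (W := fun (k : Fin n) (u : Fin Ma × Fin Mb) =>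
      gate ((k : ℕ) < n₁) (ch.relayKernel (xA u.1 k) (xB u.2 k)))
    (q := fun k u => gate ((k : ℕ) < n₁) (r k u))
    (fun k u => gate_mem (ch.relayKernel_mem _ _)) (fun k u => gate_mem (hr k u))
    (by
      intro k u t _
      unfold gate
      split_ifs
      · exact hr0 k u t
      · simp
      · simp)
    (fun u s => ind (D u s)) (fun u s => ind_eq_zero_or_one _) hM hQ
  refine this.trans (le_of_eq ?_)
  rw [← sum_ite_eq_sum_filter]
  refine Finset.sum_congr rfl fun k _ => ?_
  simp_rw [sum_gate_mul_logb]
  split_ifs <;> simp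

variable (xA : Fin Ma → Fin n → XA) (xB : Fin Mb → Fin n → XB)

/-- The law of the `k`-th symbol of a codeword of a uniform message. -/
def symbolLaw {M : ℕ} {X : Type*} [Fintype X] (x : Fin M → Fin n → X) (k : Fin n) : X → ℝ :=
  lawOf (fun _ : Fin M => 1 / (M : ℝ)) fun w => x w k

theorem symbolLaw_mem {M : ℕ} [NeZero M] {X : Type*} [Fintype X] (x : Fin M → Fin n → X)
    (k : Fin n) : symbolLaw x k ∈ stdSimplex ℝ X :=
  lawOf_mem uniform_fin_mem _

theorem symbolLaw_ne_zero {M : ℕ} [NeZero M] {X : Type*} [Fintype X] (x : Fin M → Fin n → X)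
    (k : Fin n) (w : Fin M) : symbolLaw x k (x w k) ≠ 0 := by
  have h : 0 < (1 / (M : ℝ)) := one_div_pos.2 (by exact_mod_cast NeZero.pos M)
  exact (h.trans_le (le_lawOf (fun _ => h.le) (fun w => x w k) w)).ne'

theorem sum_symbolLaw_mul {M : ℕ} {X : Type*} [Fintype X] (x : Fin M → Fin n → X) (k : Fin n)
    (h : X → ℝ) : ∑ a, symbolLaw x k a * h a = ∑ w, 1 / (M : ℝ) * h (x w k) :=
  sum_lawOf_mul _ _ _

theorem sum_symbolLaw_mul_symbolLaw_mul {n Ma Mb : ℕ}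
    {XA XB : Type*} [Fintype XA] [Fintype XB]
    (xA : Fin Ma → Fin n → XA) (xB : Fin Mb → Fin n → XB) (k : Fin n)
    (h : XA × XB → ℝ) : ∑ x : XA × XB, symbolLaw xA k x.1 * symbolLaw xB k x.2 * h x =
      ∑ u : Fin Ma × Fin Mb, 1 / ((Ma : ℝ) * Mb) * h (xA u.1 k, xB u.2 k) := by
  rw [Fintype.sum_prod_type, Fintype.sum_prod_type]
  simp_rw [mul_assoc, ← Finset.mul_sum]
  rw [sum_symbolLaw_mul xA k fun a => ∑ b, symbolLaw xB k b * h (a, b)]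
  simp_rw [sum_symbolLaw_mul, ← Finset.mul_sum, ← mul_assoc, one_div_mul_one_div]

/-- The reference law keeps the message of `b` and averages the letter of `a`, so it carries no
information about the message of `a`. By independence of the messages the divergences average to the
conditional mutual information of product letter laws. -/
theorem relay_fano_fst (d : (Fin n → Option YR) → Fin Ma) :
    (∑ u : Fin Ma × Fin Mb, 1 / ((Ma : ℝ) * Mb) * ∑ s : Fin n → Option YR,
      (∏ k : Fin n, gate ((k : ℕ) < n₁) (ch.relayKernel (xA u.1 k) (xB u.2 k)) (s k)) *
        ind (d s = u.1)) * Real.logb 2 Ma - 1 ≤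
    ∑ k ∈ Finset.univ.filter fun k : Fin n => (k : ℕ) < n₁, ch.rateA (symbolLaw xA k) (symbolLaw xB k) := by
  have hM : (0 : ℝ) < Ma := by exact_mod_cast NeZero.pos Ma
  have := relay_fano ch (n₁ := n₁) xA xB
    (r := fun k u s => ∑ a, symbolLaw xA k a * ch.relayKernel a (xB u.2 k) s)
    (fun k u => sum_mul_mem_stdSimplex (symbolLaw_mem xA k) fun a => ch.relayKernel_mem _ _)
    (fun k u s h => by
      by_contra h0
      exact (sum_mul_pos (symbolLaw_mem xA k) (fun a => ch.relayKernel_mem a (xB u.2 k))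
        (symbolLaw_ne_zero xA k u.1) h0).ne' h)
    (fun u s => d s = u.1) hM (by
      have := sum_uniform_guess (A := Fin Ma) (uniform_fin_mem (Ma := Mb))
        (r := fun (wb : Fin Mb) (s : Fin n → Option YR) => ∏ k : Fin n, gate ((k : ℕ) < n₁)
          (fun s => ∑ a, symbolLaw xA k a * ch.relayKernel a (xB wb k) s) (s k))
        (fun wb => pi_prod_mem_stdSimplex fun k => gate_mem
          (sum_mul_mem_stdSimplex (symbolLaw_mem xA k) fun a => ch.relayKernel_mem _ _))
        (fun _ s => d s)
      refine le_of_eq (Eq.trans ?_ (this.trans (by simp)))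
      refine Finset.sum_congr rfl fun u _ => ?_
      congr 1
      simp only [Fintype.card_fin]
      field_simp)
  refine this.trans (le_of_eq (Finset.sum_congr rfl fun k _ => ?_))
  unfold HalfDuplexChannel.rateA mutualInfo
  rw [sum_symbolLaw_mul, Fintype.sum_prod_type_right]
  refine Finset.sum_congr rfl fun wb _ => ?_
  rw [sum_symbolLaw_mul, Finset.mul_sum]
  refine Finset.sum_congr rfl fun wa _ => ?_
  rw [← mul_assoc]
  congr 1
  field_simp

theorem relay_fano_snd (d : (Fin n → Option YR) → Fin Mb) :
    (∑ u : Fin Ma × Fin Mb, 1 / ((Ma : ℝ) * Mb) * ∑ s : Fin n → Option YR,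
      (∏ k : Fin n, gate ((k : ℕ) < n₁) (ch.relayKernel (xA u.1 k) (xB u.2 k)) (s k)) *
        ind (d s = u.2)) * Real.logb 2 Mb - 1 ≤
    ∑ k ∈ Finset.univ.filter fun k : Fin n => (k : ℕ) < n₁, ch.rateB (symbolLaw xA k) (symbolLaw xB k) := by
  have hM : (0 : ℝ) < Mb := by exact_mod_cast NeZero.pos Mb
  have := relay_fano ch (n₁ := n₁) xA xB
    (r := fun k u s => ∑ b, symbolLaw xB k b * ch.relayKernel (xA u.1 k) b s)
    (fun k u => sum_mul_mem_stdSimplex (symbolLaw_mem xB k) fun a => ch.relayKernel_mem _ _)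
    (fun k u s h => by
      by_contra h0
      exact (sum_mul_pos (symbolLaw_mem xB k) (fun b => ch.relayKernel_mem (xA u.1 k) b)
        (symbolLaw_ne_zero xB k u.2) h0).ne' h)
    (fun u s => d s = u.2) hM (by
      have := sum_uniform_guess (A := Fin Mb) (uniform_fin_mem (Ma := Ma))
        (r := fun (wa : Fin Ma) (s : Fin n → Option YR) => ∏ k : Fin n, gate ((k : ℕ) < n₁)
          (fun s => ∑ b, symbolLaw xB k b * ch.relayKernel (xA wa k) b s) (s k))
        (fun wa => pi_prod_mem_stdSimplex fun k => gate_mem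
          (sum_mul_mem_stdSimplex (symbolLaw_mem xB k) fun a => ch.relayKernel_mem _ _))
        (fun _ s => d s)
      refine le_of_eq (Eq.trans ?_ (this.trans (by simp)))
      rw [Fintype.sum_prod_type, Fintype.sum_prod_type_right]
      refine Finset.sum_congr rfl fun u _ => Finset.sum_congr rfl fun v _ => ?_
      congr 1
      simp only [Fintype.card_fin]
      field_simp)
  refine this.trans (le_of_eq (Finset.sum_congr rfl fun k _ => ?_))
  unfold HalfDuplexChannel.rateB mutualInfo
  rw [sum_symbolLaw_mul, Fintype.sum_prod_type]
  refine Finset.sum_congr rfl fun wb _ => ?_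
  rw [sum_symbolLaw_mul, Finset.mul_sum]
  refine Finset.sum_congr rfl fun wa _ => ?_
  rw [← mul_assoc]
  congr 1
  field_simp

/-- Here the reference law averages both letters and ignores the messages altogether, so the pair is
guessed with probability `1 / (Ma * Mb)`. -/
theorem relay_fano_pair (d : (Fin n → Option YR) → Fin Ma × Fin Mb) :
    (∑ u : Fin Ma × Fin Mb, 1 / ((Ma : ℝ) * Mb) * ∑ s : Fin n → Option YR,
      (∏ k : Fin n, gate ((k : ℕ) < n₁) (ch.relayKernel (xA u.1 k) (xB u.2 k)) (s k)) *
        ind (d s = u)) * Real.logb 2 (Ma * Mb) - 1 ≤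
    ∑ k ∈ Finset.univ.filter fun k : Fin n => (k : ℕ) < n₁, ch.rateAB (symbolLaw xA k) (symbolLaw xB k) := by
  have hMa : (0 : ℝ) < Ma := by exact_mod_cast NeZero.pos Ma
  have hMb : (0 : ℝ) < Mb := by exact_mod_cast NeZero.pos Mb
  have hp := fun k => prod_mem_stdSimplex (symbolLaw_mem xA k) (symbolLaw_mem xB k)
  have hr := fun k => sum_mul_mem_stdSimplex (hp k)
    (V := fun x => ch.relayKernel x.1 x.2) fun x => ch.relayKernel_mem _ _
  have := relay_fano ch (n₁ := n₁) xA xB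
    (r := fun k _ s => ∑ x : XA × XB, symbolLaw xA k x.1 * symbolLaw xB k x.2 *
      ch.relayKernel x.1 x.2 s)
    (fun k _ => hr k)
    (fun k u s h => by
      by_contra h0
      exact (sum_mul_pos (hp k) (V := fun x => ch.relayKernel x.1 x.2) (a := (xA u.1 k, xB u.2 k))
        (fun b => ch.relayKernel_mem _ _) (mul_ne_zero (symbolLaw_ne_zero xA k u.1)
          (symbolLaw_ne_zero xB k u.2)) h0).ne' h)
    (fun u s => d s = u) (mul_pos hMa hMb) (by
      rw [← Finset.mul_sum, Finset.sum_comm]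
      have := (pi_prod_mem_stdSimplex fun k : Fin n => gate_mem (b := (k : ℕ) < n₁) (hr k)).2
      simp_rw [← Finset.mul_sum, sum_ind_eq, mul_one, this, mul_one]
      exact le_rfl)
  refine this.trans (le_of_eq (Finset.sum_congr rfl fun k _ => ?_))
  unfold HalfDuplexChannel.rateAB mutualInfo
  rw [sum_symbolLaw_mul_symbolLaw_mul]

end RelayBound

section Complement

variable {U τ : Type*} [Fintype U] [Fintype τ]

theorem sum_mul_sum_mul_ind_not {μ : U → ℝ} (hμ : μ ∈ stdSimplex ℝ U) {w : U → τ → ℝ}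
    (hw : ∀ u, w u ∈ stdSimplex ℝ τ) (D : U → τ → Prop) :
    ∑ u, μ u * ∑ t, w u t * ind (D u t) = 1 - ∑ u, μ u * ∑ t, w u t * ind (¬D u t) := by
  have h : ∀ u t, w u t * ind (D u t) = w u t - w u t * ind (¬D u t) := by
    intro u t
    by_cases hD : D u t
    · rw [ind_of hD, ind_of_not (not_not.2 hD)]; ring
    · rw [ind_of_not hD, ind_of hD]; ring
  simp_rw [h, Finset.sum_sub_distrib, (hw _).2, mul_sub, mul_one, Finset.sum_sub_distrib, hμ.2]

theorem sum_mul_sum_mul_ind_mono {μ : U → ℝ} (hμ : ∀ u, 0 ≤ μ u) {w : U → τ → ℝ}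
    (hw : ∀ u t, 0 ≤ w u t) {f g : U → τ → ℝ} (h : ∀ u t, f u t ≤ g u t) :
    ∑ u, μ u * ∑ t, w u t * f u t ≤ ∑ u, μ u * ∑ t, w u t * g u t :=
  Finset.sum_le_sum fun u _ => mul_le_mul_of_nonneg_left
    (Finset.sum_le_sum fun t _ => mul_le_mul_of_nonneg_left (h u t) (hw u t)) (hμ u)

end Complement

/-! ### Converse for phase 2: the broadcast bounds. -/

section BroadcastBound

variable {XR : Type*} [Fintype XR]

/-- The law `p` is that of the letter at a uniformly chosen time of phase 2. The last clause gives
the absolute continuity that the Fano bound needs. -/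
theorem exists_averageLaw [Nonempty XR] {V : Type*} [Fintype V] {μ : V → ℝ}
    (hμ : μ ∈ stdSimplex ℝ V) {n n₁ : ℕ} (hn : n₁ ≤ n) (f : V → Fin n → XR) :
    ∃ p ∈ stdSimplex ℝ XR,
      (∀ h : XR → ℝ, ((n : ℝ) - n₁) * ∑ x, p x * h x =
        ∑ k ∈ Finset.univ.filter fun k : Fin n => n₁ ≤ (k : ℕ), ∑ v, μ v * h (f v k)) ∧
      ∀ (k : Fin n) v, n₁ ≤ (k : ℕ) → μ v ≠ 0 → p (f v k) ≠ 0 := by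
  -- If phase 2 is empty there is no time to choose, and any law will do.
  rcases hn.eq_or_lt with rfl | hlt
  · refine ⟨_, uniform_mem_stdSimplex XR, fun h => ?_, fun k v hk => ?_⟩
    · rw [sub_self, zero_mul, Finset.filter_false_of_mem, Finset.sum_empty]
      exact fun k _ => not_le.2 k.2
    · exact absurd k.2 (not_lt.2 hk)
  have hpos : (0 : ℝ) < n - n₁ := sub_pos.2 (by exact_mod_cast hlt)
  let ν : Fin n × V → ℝ := fun kv => if n₁ ≤ (kv.1 : ℕ) then μ kv.2 / (n - n₁) else 0
  have hν : ν ∈ stdSimplex ℝ (Fin n × V) := by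
    refine ⟨fun kv => ?_, ?_⟩
    · simp only [ν]
      split_ifs
      · exact div_nonneg (hμ.1 _) hpos.le
      · exact le_rfl
    · rw [Fintype.sum_prod_type]
      have : ∀ k : Fin n, ∑ v, ν (k, v) = if n₁ ≤ (k : ℕ) then 1 / ((n : ℝ) - n₁) else 0 := by
        intro k
        simp only [ν]
        split_ifs
        · rw [← Finset.sum_div, hμ.2]
        · simp
      simp_rw [this]
      rw [sum_ite_eq_sum_filter, Finset.sum_const, nsmul_eq_mul, card_filter_ge hn]
      field_simp
  refine ⟨lawOf ν fun kv => f kv.2 kv.1, lawOf_mem hν _, fun h => ?_, fun k v hk hv => ?_⟩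
  · rw [sum_lawOf_mul, Fintype.sum_prod_type, ← sum_ite_eq_sum_filter, Finset.mul_sum]
    refine Finset.sum_congr rfl fun k _ => ?_
    simp only [ν]
    split_ifs
    · rw [Finset.mul_sum]
      refine Finset.sum_congr rfl fun v _ => ?_
      field_simp
    · simp
  · have h1 := le_lawOf hν.1 (fun kv => f kv.2 kv.1) (k, v)
    have h2 : 0 < ν (k, v) := by
      simp only [ν, hk, if_true]
      exact div_pos (lt_of_le_of_ne (hμ.1 v) hv.symm) hpos
    exact (h2.trans_le h1).ne'

/-- The reference law at every phase 2 time is the output law of the one averaged input `p`. The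
divergences then sum exactly to `n - n₁` times the mutual information at `p`, without an appeal to
its concavity. The event is controlled under any law of the outputs that ignores `u` and `s`. -/
theorem broadcast_fano {U S T : Type*} [Fintype U] [Fintype S] [Fintype T] {μ : U × S → ℝ}
    (hμ : μ ∈ stdSimplex ℝ (U × S)) {n n₁ : ℕ} {f : S → Fin n → XR}
    {V : XR → Option T → ℝ} (hV : ∀ x, V x ∈ stdSimplex ℝ (Option T))
    {p : XR → ℝ} (hp : p ∈ stdSimplex ℝ XR)
    (hpf : ∀ h : XR → ℝ, ((n : ℝ) - n₁) * ∑ x, p x * h x =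
        ∑ k ∈ Finset.univ.filter fun k : Fin n => n₁ ≤ (k : ℕ), ∑ v, μ v * h (f v.2 k))
    (hp0 : ∀ (k : Fin n) v, n₁ ≤ (k : ℕ) → μ v ≠ 0 → p (f v.2 k) ≠ 0)
    (D : U → (Fin n → Option T) → Prop) {M : ℝ} (hM : 0 < M)
    (hQ : ∀ r ∈ stdSimplex ℝ (Fin n → Option T),
      ∑ u, (∑ s, μ (u, s)) * ∑ t, r t * ind (D u t) ≤ 1 / M) :
    (∑ v : U × S, μ v * ∑ t : Fin n → Option T,
      (∏ k : Fin n, gate (n₁ ≤ (k : ℕ)) (V (f v.2 k)) (t k)) * ind (D v.1 t)) *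
        Real.logb 2 M - 1 ≤ ((n : ℝ) - n₁) * mutualInfo p V := by
  have hr := sum_mul_mem_stdSimplex hp hV
  have := prob_mul_logb_sub_one_le_sum_divergence hμ
    (W := fun (k : Fin n) (v : U × S) => gate (n₁ ≤ (k : ℕ)) (V (f v.2 k)))
    (q := fun k _ => gate (n₁ ≤ (k : ℕ)) fun t => ∑ b, p b * V b t)
    (fun k v => gate_mem (hV _)) (fun k v => gate_mem hr)
    (by
      intro k v t hv
      unfold gate
      split_ifs with hk
      · intro h
        by_contra h0
        exact (sum_mul_pos hp hV (hp0 k v hk hv) h0).ne' h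
      · simp
      · simp)
    (fun v t => ind (D v.1 t)) (fun v t => ind_eq_zero_or_one _) hM (by
      rw [Fintype.sum_prod_type]
      simp_rw [← Finset.sum_mul]
      exact hQ _ (pi_prod_mem_stdSimplex fun k => gate_mem hr))
  refine this.trans (le_of_eq ?_)
  unfold mutualInfo
  rw [hpf, ← sum_ite_eq_sum_filter]
  refine Finset.sum_congr rfl fun k _ => ?_
  simp_rw [sum_gate_mul_logb]
  split_ifs <;> simp

end BroadcastBound

/-! ### The outer bound for a single code. -/

section Converse

variable {XA XB XR YA YB YR : Type*} [Fintype XA] [Fintype XB] [Fintype XR]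
  [Fintype YA] [Fintype YB] [Fintype YR] [Nonempty XA] [Nonempty XB] [Nonempty XR]
  (ch : HalfDuplexChannel XA XB XR YA YB YR)

/-- The single-letter outer bound for one code. -/
theorem Code.exists_inputDist {n Ma Mb : ℕ} [NeZero Ma] [NeZero Mb]
    (C : Code XA XB XR YA YB YR n Ma Mb) :
    ∃ m ≤ 4, ∃ P : InputDist m XA XB XR,
      (1 - C.errAR ch) * Real.logb 2 Ma - 1 ≤ C.phase1 * P.infoAR ch ∧
      (1 - C.errBR ch) * Real.logb 2 Mb - 1 ≤ C.phase1 * P.infoBR ch ∧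
      (1 - (C.errAR ch + C.errBR ch)) * Real.logb 2 (Ma * Mb) - 1 ≤ C.phase1 * P.infoABR ch ∧
      (1 - C.errAB ch) * Real.logb 2 Ma - 1 ≤ (n - C.phase1) * P.infoRB ch ∧
      (1 - C.errBA ch) * Real.logb 2 Mb - 1 ≤ (n - C.phase1) * P.infoRA ch := by
  obtain ⟨xA, xB, xR, hA, hB, hR⟩ := C.exists_codewords
  have hMa : (1 : ℝ) ≤ Ma := by exact_mod_cast NeZero.pos Ma
  have hMb : (1 : ℝ) ≤ Mb := by exact_mod_cast NeZero.pos Mb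
  let w : Fin Ma × Fin Mb → (Fin n → Option YR) → ℝ := fun u s =>
    ∏ k : Fin n, gate ((k : ℕ) < C.phase1) (ch.relayKernel (xA u.1 k) (xB u.2 k)) (s k)
  have hw : ∀ u, w u ∈ stdSimplex ℝ _ := fun u =>
    pi_prod_mem_stdSimplex fun k => gate_mem (ch.relayKernel_mem _ _)
  let c : ℝ := 1 / ((Ma : ℝ) * Mb)
  have hc : (fun _ => c) ∈ stdSimplex ℝ (Fin Ma × Fin Mb) := uniform_pair_mem
  -- Joint law of the messages and the relay outputs.
  let μ : (Fin Ma × Fin Mb) × (Fin n → Option YR) → ℝ := fun v => c * w v.1 v.2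
  have hμs : ∀ u, ∑ s, μ (u, s) = c := fun u => by
    simp only [μ, ← Finset.mul_sum, (hw u).2, mul_one]
  have hμ : μ ∈ stdSimplex ℝ _ := by
    refine ⟨fun v => mul_nonneg (hc.1 v.1) ((hw _).1 _), ?_⟩
    rw [Fintype.sum_prod_type]
    simp_rw [hμs]
    exact hc.2
  obtain ⟨pR, hpR, hpf, hp0⟩ := exists_averageLaw hμ C.phase1_le fun v => xR v.2
  obtain ⟨m, hm, P, hPR, h1, h2, h3⟩ := exists_timeSharing ch
    (Finset.univ.filter fun k : Fin n => (k : ℕ) < C.phase1)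
    (symbolLaw_mem xA) (symbolLaw_mem xB) hpR
  rw [card_filter_lt C.phase1_le] at h1 h2 h3
  have eAR : C.errAR ch = ∑ u : Fin Ma × Fin Mb, c * ∑ s, w u s * ind ((C.decR s).1 ≠ u.1) :=
    C.eventProb_relay ch hA hB hR fun wa _ s => (C.decR s).1 ≠ wa
  have eBR : C.errBR ch = ∑ u : Fin Ma × Fin Mb, c * ∑ s, w u s * ind ((C.decR s).2 ≠ u.2) :=
    C.eventProb_relay ch hA hB hR fun _ wb s => (C.decR s).2 ≠ wb
  refine ⟨m, hm, P, ?_, ?_, ?_, ?_, ?_⟩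
  · rw [← h1]
    refine le_trans (le_of_eq ?_)
      (relay_fano_fst ch (n₁ := C.phase1) xA xB fun s => (C.decR s).1)
    rw [eAR, ← sum_mul_sum_mul_ind_not hc hw]
  · rw [← h2]
    refine le_trans (le_of_eq ?_)
      (relay_fano_snd ch (n₁ := C.phase1) xA xB fun s => (C.decR s).2)
    rw [eBR, ← sum_mul_sum_mul_ind_not hc hw]
  · rw [← h3]
    refine le_trans (sub_le_sub_right (mul_le_mul_of_nonneg_right ?_
      (Real.logb_nonneg one_lt_two (by nlinarith))) 1)
      (relay_fano_pair ch (n₁ := C.phase1) xA xB C.decR)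
    -- Union bound: the pair is wrong only if one of its components is.
    have h := sum_mul_sum_mul_ind_not hc hw fun u s => C.decR s = u
    refine le_trans ?_ h.ge
    refine sub_le_sub_left ?_ 1
    rw [eAR, eBR, ← Finset.sum_add_distrib]
    simp_rw [← mul_add, ← Finset.sum_add_distrib, ← mul_add]
    refine sum_mul_sum_mul_ind_mono hc.1 (fun u => (hw u).1) fun u s => ?_
    by_cases ha : (C.decR s).1 = u.1
    · by_cases hb : (C.decR s).2 = u.2
      · rw [ind_of_not (not_not.2 (Prod.ext ha hb))]
        exact add_nonneg (ind_nonneg _) (ind_nonneg _)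
      · rw [ind_of (p := (C.decR s).2 ≠ u.2) hb]
        exact (ind_le_one _).trans (le_add_of_nonneg_left (ind_nonneg _))
    · rw [ind_of (p := (C.decR s).1 ≠ u.1) ha]
      exact (ind_le_one _).trans (le_add_of_nonneg_right (ind_nonneg _))
  -- As `P.pR` does not depend on `q`, time sharing has no effect in phase 2.
  · have hI : P.infoRB ch = mutualInfo pR (ch.terminalKernel fun z => z.2.1) := by
      rw [P.infoRB_eq]
      simp_rw [hPR, ← Finset.sum_mul, P.pQ_mem.2, one_mul]
    rw [hI]
    refine le_trans (le_of_eq ?_) (broadcast_fano hμ (ch.terminalKernel_mem _) hpR hpf hp0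
      (fun u t => C.decB t u.2 = u.1) (by linarith : (0 : ℝ) < Ma) ?_)
    · rw [errAB, C.eventProb_terminal ch ch.snd_fst_eq_none hA hB hR
        fun wa wb t => C.decB t wb ≠ wa]
      rw [sum_mul_sum_mul_ind_not hμ fun v => pi_prod_mem_stdSimplex fun k =>
        gate_mem (ch.terminalKernel_mem _ _)]
      simp only [ne_eq, not_not, sub_sub_cancel]
    · intro r hr
      simp_rw [hμs]
      refine le_of_eq (Eq.trans ?_ ((sum_uniform_guess (A := Fin Ma) (uniform_fin_mem (Ma := Mb))
        (r := fun _ => r) (fun _ => hr) fun wb t => C.decB t wb).trans (by simp)))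
      refine Finset.sum_congr rfl fun u _ => ?_
      congr 1
      simp only [Fintype.card_fin, c]
      field_simp
  · have hI : P.infoRA ch = mutualInfo pR (ch.terminalKernel Prod.fst) := by
      rw [P.infoRA_eq]
      simp_rw [hPR, ← Finset.sum_mul, P.pQ_mem.2, one_mul]
    rw [hI]
    refine le_trans (le_of_eq ?_) (broadcast_fano hμ (ch.terminalKernel_mem _) hpR hpf hp0
      (fun u t => C.decA t u.1 = u.2) (by linarith : (0 : ℝ) < Mb) ?_)
    · rw [errBA, C.eventProb_terminal ch ch.fst_eq_none hA hB hR
        fun wa wb t => C.decA t wa ≠ wb]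
      rw [sum_mul_sum_mul_ind_not hμ fun v => pi_prod_mem_stdSimplex fun k =>
        gate_mem (ch.terminalKernel_mem _ _)]
      simp only [ne_eq, not_not, sub_sub_cancel]
    · intro r hr
      simp_rw [hμs]
      refine le_of_eq (Eq.trans ?_ ((sum_uniform_guess (A := Fin Mb) (uniform_fin_mem (Ma := Ma))
        (r := fun _ => r) (fun _ => hr) fun wa t => C.decA t wa).trans (by simp)))
      rw [Fintype.sum_prod_type, Fintype.sum_prod_type_right]
      refine Finset.sum_congr rfl fun u _ => Finset.sum_congr rfl fun v _ => ?_
      congr 1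
      simp only [Fintype.card_fin, c]
      field_simp

end Converse

/-! ### From one code to the limit. -/

section MessageSets

theorem one_le_floor_two_rpow {x : ℝ} (hx : 0 ≤ x) : 1 ≤ ⌊(2 : ℝ) ^ x⌋₊ :=
  Nat.le_floor (by simpa using Real.one_le_rpow one_le_two hx)

/-- A real number `y ≥ 1` is less than `⌊y⌋₊ + 1 ≤ 2 * ⌊y⌋₊`, so rounding costs at most one bit. The
sum rate rounds twice, whence the `2` in `eventually_sub_lt_of_fano`. -/
theorem sub_one_le_logb_floor {x : ℝ} (hx : 0 ≤ x) :
    x - 1 ≤ Real.logb 2 (⌊(2 : ℝ) ^ x⌋₊ : ℝ) := by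
  have h1 : (1 : ℝ) ≤ ⌊(2 : ℝ) ^ x⌋₊ := by exact_mod_cast one_le_floor_two_rpow hx
  have h2 := Nat.lt_floor_add_one ((2 : ℝ) ^ x)
  rw [Real.le_logb_iff_rpow_le one_lt_two (by linarith), Real.rpow_sub two_pos, Real.rpow_one]
  linarith

end MessageSets

/-- The limit form of Fano's inequality. -/
theorem eventually_sub_lt_of_fano {l e I L : ℕ → ℝ} {Δ R B : ℝ}
    (hl : Tendsto (fun n : ℕ => l n / n) atTop (𝓝 Δ)) (he : Tendsto e atTop (𝓝 0))
    (hI : ∀ n, |I n| ≤ B) (hL : ∀ n : ℕ, n * R - 2 ≤ L n)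
    (h : ∀ n, (1 - e n) * L n - 1 ≤ l n * I n) {ε : ℝ} (hε : 0 < ε) :
    ∀ᶠ n in atTop, R - ε < Δ * I n := by
  -- After division by `n`, the losses from errors, rounding and Fano's one bit vanish. The uniform
  -- bound `B` pays for replacing the phase fraction by its limit `Δ`.
  have hlim : Tendsto (fun n : ℕ => (1 - e n) * (R - 2 / (n : ℝ)) - 1 / (n : ℝ) -
      |l n / n - Δ| * B) atTop (𝓝 ((1 - 0) * (R - 0) - 0 - |Δ - Δ| * B)) := by
    have h1 := tendsto_const_div_atTop_nhds_zero_nat (1 : ℝ)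
    have h2 := tendsto_const_div_atTop_nhds_zero_nat (2 : ℝ)
    exact ((((tendsto_const_nhds.sub he).mul (tendsto_const_nhds.sub h2)).sub h1).sub
      ((hl.sub tendsto_const_nhds).abs.mul_const B))
  have hR : R - ε < (1 - 0) * (R - 0) - 0 - |Δ - Δ| * B := by
    simp [hε]
  filter_upwards [hlim.eventually_const_lt hR, eventually_gt_atTop 0,
    he.eventually_lt_const one_pos] with n h1 hn h2
  have hn' : (0 : ℝ) < n := by exact_mod_cast hn
  have h3 : (1 - e n) * (n * R - 2) - 1 ≤ l n * I n :=
    (sub_le_sub_right (mul_le_mul_of_nonneg_left (hL n) (by linarith)) 1).trans (h n)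
  have h4 : (1 - e n) * (R - 2 / (n : ℝ)) - 1 / (n : ℝ) ≤ l n / n * I n := by
    have := div_le_div_of_nonneg_right h3 hn'.le
    refine le_trans (le_of_eq ?_) (this.trans (le_of_eq ?_))
    · field_simp
    · ring
  have h5 : l n / n * I n - Δ * I n ≤ |l n / n - Δ| * B := by
    rw [← sub_mul]
    refine (le_abs_self _).trans ?_
    rw [abs_mul]
    exact mul_le_mul_of_nonneg_left (hI n) (abs_nonneg _)
  linarith

section Converse

variable {XA XB XR YA YB YR : Type*} [Fintype XA] [Fintype XB] [Fintype XR]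
  [Fintype YA] [Fintype YB] [Fintype YR] [Nonempty XA] [Nonempty XB] [Nonempty XR]
  (ch : HalfDuplexChannel XA XB XR YA YB YR)

/-- The distributions `P n` need not converge: for each `ε` a single large `n` already puts the
lowered pair inside the set, and `ε` tends to `0` only afterwards. -/
theorem mem_closure_of_achievable {Δ₁ Δ₂ : ℝ} {R : ℝ × ℝ} (hR : Achievable ch Δ₁ Δ₂ R.1 R.2) :
    R ∈ closure {R : ℝ × ℝ | ∃ m : ℕ, m ≤ 5 ∧ ∃ P : InputDist m XA XB XR,
        R.1 < min (Δ₁ * P.infoAR ch) (Δ₂ * P.infoRB ch) ∧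
        R.2 < min (Δ₁ * P.infoBR ch) (Δ₂ * P.infoRA ch) ∧
        R.1 + R.2 < Δ₁ * P.infoABR ch} := by
  obtain ⟨hRa, hRb, C, hΔ₁, hΔ₂, hAB, hBA, hAR, hBR⟩ := hR
  have hna : ∀ n : ℕ, 0 ≤ (n : ℝ) * R.1 := fun n => mul_nonneg n.cast_nonneg hRa
  have hnb : ∀ n : ℕ, 0 ≤ (n : ℝ) * R.2 := fun n => mul_nonneg n.cast_nonneg hRb
  have hex : ∀ n : ℕ, ∃ m ≤ 4, ∃ P : InputDist m XA XB XR, _ := fun n =>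
    haveI : NeZero ⌊(2 : ℝ) ^ ((n : ℝ) * R.1)⌋₊ :=
      ⟨Nat.one_le_iff_ne_zero.1 (one_le_floor_two_rpow (hna n))⟩
    haveI : NeZero ⌊(2 : ℝ) ^ ((n : ℝ) * R.2)⌋₊ :=
      ⟨Nat.one_le_iff_ne_zero.1 (one_le_floor_two_rpow (hnb n))⟩
    (C n).exists_inputDist ch
  choose m hm P h1 h2 h3 h4 h5 using hex
  obtain ⟨B, hB⟩ := InputDist.exists_abs_info_le (XA := XA) (XB := XB) (XR := XR) ch
  have hLa : ∀ n : ℕ, n * R.1 - 1 ≤ Real.logb 2 (⌊(2 : ℝ) ^ ((n : ℝ) * R.1)⌋₊ : ℝ) :=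
    fun n => sub_one_le_logb_floor (hna n)
  have hLb : ∀ n : ℕ, n * R.2 - 1 ≤ Real.logb 2 (⌊(2 : ℝ) ^ ((n : ℝ) * R.2)⌋₊ : ℝ) :=
    fun n => sub_one_le_logb_floor (hnb n)
  have hLab : ∀ n : ℕ, n * (R.1 + R.2) - 2 ≤ Real.logb 2
      ((⌊(2 : ℝ) ^ ((n : ℝ) * R.1)⌋₊ : ℝ) * (⌊(2 : ℝ) ^ ((n : ℝ) * R.2)⌋₊ : ℝ)) := by
    intro n
    rw [Real.logb_mul]
    · linarith [hLa n, hLb n]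
    · exact_mod_cast Nat.one_le_iff_ne_zero.1 (one_le_floor_two_rpow (hna n))
    · exact_mod_cast Nat.one_le_iff_ne_zero.1 (one_le_floor_two_rpow (hnb n))
  have hε : ∀ ε : ℝ, 0 < ε → (R.1 - ε, R.2 - ε) ∈ {R : ℝ × ℝ | ∃ m : ℕ, m ≤ 5 ∧
      ∃ P : InputDist m XA XB XR,
        R.1 < min (Δ₁ * P.infoAR ch) (Δ₂ * P.infoRB ch) ∧
        R.2 < min (Δ₁ * P.infoBR ch) (Δ₂ * P.infoRA ch) ∧
        R.1 + R.2 < Δ₁ * P.infoABR ch} := by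
    intro ε hε
    have hsum : Tendsto (fun n => (C n).errAR ch + (C n).errBR ch) atTop (𝓝 0) := by
      simpa using hAR.add hBR
    have e1 := eventually_sub_lt_of_fano (R := R.1) hΔ₁ hAR (fun n => (hB _ (P n)).1)
      (fun n => by linarith [hLa n]) h1 hε
    have e2 := eventually_sub_lt_of_fano (R := R.2) hΔ₁ hBR (fun n => (hB _ (P n)).2.1)
      (fun n => by linarith [hLb n]) h2 hε
    have e3 := eventually_sub_lt_of_fano hΔ₁ hsum (fun n => (hB _ (P n)).2.2.1) hLab h3 hε
    have e4 := eventually_sub_lt_of_fano (R := R.1) hΔ₂ hAB (fun n => (hB _ (P n)).2.2.2.1)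
      (fun n => by linarith [hLa n]) h4 hε
    have e5 := eventually_sub_lt_of_fano (R := R.2) hΔ₂ hBA (fun n => (hB _ (P n)).2.2.2.2)
      (fun n => by linarith [hLb n]) h5 hε
    obtain ⟨n, f1, f2, f3, f4, f5⟩ :=
      (e1.and (e2.and (e3.and (e4.and e5)))).exists
    -- Lowering both coordinates lowers the sum by `2 * ε`, while `f3` needs only `ε`.
    exact ⟨m n, (hm n).trans (by norm_num), P n, lt_min f1 f4, lt_min f2 f5,
      by simp only; linarith⟩
  have hlim : Tendsto (fun k : ℕ => (R.1 - 1 / ((k : ℝ) + 1), R.2 - 1 / ((k : ℝ) + 1))) atTop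
      (𝓝 (R.1 - 0, R.2 - 0)) :=
    (tendsto_const_nhds.sub tendsto_one_div_add_atTop_nhds_zero_nat).prodMk_nhds
      (tendsto_const_nhds.sub tendsto_one_div_add_atTop_nhds_zero_nat)
  simp only [sub_zero] at hlim
  exact mem_closure_of_tendsto hlim (Eventually.of_forall fun k => hε _ (by positivity))

end Converse

/-! ### Random coding and maximum likelihood decoding. -/

section RandomCoding

variable {X T : Type*} [Fintype X] [Fintype T]

/-- The function that governs the random coding error of maximum likelihood decoding. -/
def gallager (ρ : ℝ) (p : X → ℝ) (V : X → T → ℝ) : ℝ :=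
  ∑ a, p a * ∑ t, V a t * ((∑ b, p b * V b t) / V a t) ^ ρ

/-- The probability that one of finitely many competitors, each of them independent of the true
codeword, is at least as likely as the true codeword. -/
theorem sum_mul_competitor_le {Ω J : Type*} [Fintype Ω] [Fintype J] {ν : Ω → ℝ}
    (hν : ∀ c, 0 ≤ ν c) {x : Ω → X} {x' : J → Ω → X} {p : X → ℝ} (hp : ∀ a, 0 ≤ p a)
    {V : X → T → ℝ} (hV : ∀ a t, 0 ≤ V a t)
    (hx : ∀ f : X → ℝ, ∑ c, ν c * f (x c) = ∑ a, p a * f a)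
    (hxx : ∀ j (f : X → X → ℝ), ∑ c, ν c * f (x c) (x' j c) = ∑ a, ∑ b, p a * p b * f a b)
    {ρ : ℝ} (hρ : 0 < ρ) (hρ1 : ρ ≤ 1) :
    ∑ c, ν c * ∑ t, V (x c) t * ind (∃ j, V (x c) t ≤ V (x' j c) t) ≤
      (Fintype.card J : ℝ) ^ ρ * gallager ρ p V := by
  let N : ℝ := Fintype.card J
  have hN : 0 ≤ N := Nat.cast_nonneg _
  let r : X → T → ℝ := fun a t => (∑ b, p b * V b t) / V a t
  have hr : ∀ a t, 0 ≤ r a t := fun a t =>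
    div_nonneg (Finset.sum_nonneg fun b _ => mul_nonneg (hp b) (hV b t)) (hV a t)
  -- `F` collects the outputs for which the union bound `N * r` is useless and 1 is used instead.
  -- `G` handles the others: a winning competitor allows `V a t` to be replaced by `V b t`, whose
  -- average over `b` is the output law.
  let F : X → ℝ := fun a => ∑ t, V a t * ind (1 ≤ N * r a t)
  let G : X → X → ℝ := fun a b => ∑ t, ind (V a t ≠ 0 ∧ N * r a t < 1) * V b t
  have h1 : ∀ c, ∑ t, V (x c) t * ind (∃ j, V (x c) t ≤ V (x' j c) t) ≤
      F (x c) + ∑ j, G (x c) (x' j c) := by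
    intro c
    simp only [F, G]
    rw [Finset.sum_comm, ← Finset.sum_add_distrib]
    refine Finset.sum_le_sum fun t _ => ?_
    have hpos : 0 ≤ ∑ j, ind (V (x c) t ≠ 0 ∧ N * r (x c) t < 1) * V (x' j c) t :=
      Finset.sum_nonneg fun j _ => mul_nonneg (ind_nonneg _) (hV _ _)
    by_cases h0 : V (x c) t = 0
    · simpa [h0] using hpos
    by_cases hu : 1 ≤ N * r (x c) t
    · rw [ind_of hu]
      have := mul_le_mul_of_nonneg_left (ind_le_one (∃ j, V (x c) t ≤ V (x' j c) t)) (hV (x c) t)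
      linarith
    · rw [ind_of_not hu, mul_zero, zero_add]
      by_cases hj : ∃ j, V (x c) t ≤ V (x' j c) t
      · rw [ind_of hj, mul_one]
        obtain ⟨j, hj⟩ := hj
        refine hj.trans ?_
        have := Finset.single_le_sum
          (f := fun j => ind (V (x c) t ≠ 0 ∧ N * r (x c) t < 1) * V (x' j c) t)
          (fun j _ => mul_nonneg (ind_nonneg _) (hV _ _)) (Finset.mem_univ j)
        simpa only [ind_of (p := V (x c) t ≠ 0 ∧ N * r (x c) t < 1) ⟨h0, not_le.1 hu⟩,
          one_mul] using this
      · rw [ind_of_not hj, mul_zero]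
        exact hpos
  have h2 : ∑ c, ν c * (F (x c) + ∑ j, G (x c) (x' j c)) =
      ∑ a, p a * (F a + N * ∑ b, p b * G a b) := by
    simp_rw [mul_add, Finset.sum_add_distrib, hx]
    congr 1
    simp_rw [Finset.mul_sum]
    rw [Finset.sum_comm]
    simp_rw [hxx]
    rw [Finset.sum_const, Finset.card_univ, nsmul_eq_mul, Finset.mul_sum]
    refine Finset.sum_congr rfl fun a _ => ?_
    rw [Finset.mul_sum]
    exact Finset.sum_congr rfl fun b _ => by ring
  refine (Finset.sum_le_sum fun c _ => mul_le_mul_of_nonneg_left (h1 c) (hν c)).trans ?_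
  rw [h2]
  unfold gallager
  rw [Finset.mul_sum]
  refine Finset.sum_le_sum fun a _ => ?_
  rw [mul_left_comm]
  refine mul_le_mul_of_nonneg_left ?_ (hp a)
  simp only [F, G]
  simp_rw [Finset.mul_sum]
  rw [Finset.sum_comm, ← Finset.sum_add_distrib]
  refine Finset.sum_le_sum fun t _ => ?_
  have h3 : ∑ b, N * (p b * (ind (V a t ≠ 0 ∧ N * r a t < 1) * V b t)) =
      ind (V a t ≠ 0 ∧ N * r a t < 1) * (N * ∑ b, p b * V b t) := by
    simp_rw [Finset.mul_sum]
    exact Finset.sum_congr rfl fun b _ => by ring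
  have h4 : N ^ ρ * (V a t * r a t ^ ρ) = V a t * (N * r a t) ^ ρ := by
    rw [mul_left_comm, ← Real.mul_rpow hN (hr a t)]
  rw [h3]
  refine le_trans ?_ h4.ge
  by_cases h0 : V a t = 0
  · rw [ind_of_not (p := V a t ≠ 0 ∧ N * r a t < 1) (fun h => h.1 h0), h0]
    simp
  -- Both cases are `min 1 v ≤ v ^ ρ` for `v = N * r a t` and `0 < ρ ≤ 1`.
  by_cases hu : 1 ≤ N * r a t
  · rw [ind_of hu, ind_of_not (p := V a t ≠ 0 ∧ N * r a t < 1) (fun h => not_lt.2 hu h.2),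
      zero_mul, add_zero]
    exact mul_le_mul_of_nonneg_left (Real.one_le_rpow hu hρ.le) (hV a t)
  · rw [ind_of_not hu, ind_of (p := V a t ≠ 0 ∧ N * r a t < 1) ⟨h0, not_le.1 hu⟩, mul_zero,
      zero_add, one_mul]
    have h4 : N * ∑ b, p b * V b t = V a t * (N * r a t) := by
      simp only [r]
      field_simp
    rw [h4]
    exact mul_le_mul_of_nonneg_left (Real.self_le_rpow_of_le_one (mul_nonneg hN (hr a t))
      (not_le.1 hu).le hρ1) (hV a t)

end RandomCoding

/-! ### Random codes for the multiple access phase. -/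

section Multiple

theorem card_subtype_ne {M : ℕ} (i : Fin M) : Fintype.card {i' // i' ≠ i} = M - 1 := by
  simp

/-- Random coding over a multiple access channel with maximum likelihood decoding. -/
theorem exists_multipleAccess_code {XA XB T : Type*} [Fintype XA] [Fintype XB] [Fintype T]
    {Ma Mb : ℕ} [NeZero Ma] [NeZero Mb] {pA : XA → ℝ} {pB : XB → ℝ} (hA : pA ∈ stdSimplex ℝ XA)
    (hB : pB ∈ stdSimplex ℝ XB) {W : XA → XB → T → ℝ} (hW : ∀ a b t, 0 ≤ W a b t)
    {ρ₁ ρ₂ ρ₃ : ℝ} (h₁ : 0 < ρ₁) (h₁' : ρ₁ ≤ 1) (h₂ : 0 < ρ₂) (h₂' : ρ₂ ≤ 1) (h₃ : 0 < ρ₃)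
    (h₃' : ρ₃ ≤ 1) :
    ∃ (ca : Fin Ma → XA) (cb : Fin Mb → XB) (d : T → Fin Ma × Fin Mb),
      ∑ u : Fin Ma × Fin Mb, 1 / ((Ma : ℝ) * Mb) *
        ∑ t, W (ca u.1) (cb u.2) t * ind (d t ≠ u) ≤
      ((Ma - 1 : ℕ) : ℝ) ^ ρ₁ * (∑ b, pB b * gallager ρ₁ pA fun a => W a b) +
      ((Mb - 1 : ℕ) : ℝ) ^ ρ₂ * (∑ a, pA a * gallager ρ₂ pB fun b => W a b) +
      (((Ma - 1) * (Mb - 1) : ℕ) : ℝ) ^ ρ₃ *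
        gallager ρ₃ (fun x : XA × XB => pA x.1 * pB x.2) fun x => W x.1 x.2 := by
  have hd : ∀ c : (Fin Ma → XA) × (Fin Mb → XB), ∃ d : T → Fin Ma × Fin Mb,
      ∀ t (u : Fin Ma × Fin Mb),
      W (c.1 u.1) (c.2 u.2) t ≤ W (c.1 (d t).1) (c.2 (d t).2) t := by
    intro c
    have : ∀ t, ∃ v : Fin Ma × Fin Mb, ∀ u : Fin Ma × Fin Mb,
        W (c.1 u.1) (c.2 u.2) t ≤ W (c.1 v.1) (c.2 v.2) t := fun t =>
      Finite.exists_max fun u : Fin Ma × Fin Mb => W (c.1 u.1) (c.2 u.2) t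
    choose d hd using this
    exact ⟨d, hd⟩
  choose d hd using hd
  have hAc := pi_prod_mem_stdSimplex fun _ : Fin Ma => hA
  have hBc := pi_prod_mem_stdSimplex fun _ : Fin Mb => hB
  have hν := prod_mem_stdSimplex hAc hBc
  set b₁ := ((Ma - 1 : ℕ) : ℝ) ^ ρ₁ * (∑ b, pB b * gallager ρ₁ pA fun a => W a b)
  set b₂ := ((Mb - 1 : ℕ) : ℝ) ^ ρ₂ * (∑ a, pA a * gallager ρ₂ pB fun b => W a b)
  set b₃ := (((Ma - 1) * (Mb - 1) : ℕ) : ℝ) ^ ρ₃ *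
        gallager ρ₃ (fun x : XA × XB => pA x.1 * pB x.2) fun x => W x.1 x.2
  have key : ∀ u : Fin Ma × Fin Mb, ∑ c : (Fin Ma → XA) × (Fin Mb → XB),
      ((∏ i, pA (c.1 i)) * ∏ j, pB (c.2 j)) *
        ∑ t, W (c.1 u.1) (c.2 u.2) t * ind (d c t ≠ u) ≤ b₁ + b₂ + b₃ := by
    intro u
    -- Errors are split by which components are wrong, so that in each class the competing input is
    -- independent of the true one, given the codeword of a correctly decoded message.
    let E₁ : (Fin Ma → XA) × (Fin Mb → XB) → T → ℝ := fun c t =>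
      ind (∃ i : {i // i ≠ u.1}, W (c.1 u.1) (c.2 u.2) t ≤ W (c.1 i) (c.2 u.2) t)
    let E₂ : (Fin Ma → XA) × (Fin Mb → XB) → T → ℝ := fun c t =>
      ind (∃ j : {j // j ≠ u.2}, W (c.1 u.1) (c.2 u.2) t ≤ W (c.1 u.1) (c.2 j) t)
    let E₃ : (Fin Ma → XA) × (Fin Mb → XB) → T → ℝ := fun c t =>
      ind (∃ v : {i // i ≠ u.1} × {j // j ≠ u.2},
        W (c.1 u.1) (c.2 u.2) t ≤ W (c.1 v.1) (c.2 v.2) t)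
    have hE : ∀ c t, ind (d c t ≠ u) ≤ E₁ c t + E₂ c t + E₃ c t := by
      intro c t
      have n₁ : 0 ≤ E₁ c t := ind_nonneg _
      have n₂ : 0 ≤ E₂ c t := ind_nonneg _
      have n₃ : 0 ≤ E₃ c t := ind_nonneg _
      by_cases hu : d c t = u
      · rw [ind_of_not (not_not.2 hu)]
        positivity
      have hle := ind_le_one (d c t ≠ u)
      have hdu := hd c t u
      by_cases ha : (d c t).1 = u.1
      · have hb : (d c t).2 ≠ u.2 := fun hb => hu (Prod.ext ha hb)
        have : E₂ c t = 1 := ind_of ⟨⟨_, hb⟩, by rw [ha] at hdu; exact hdu⟩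
        linarith
      · by_cases hb : (d c t).2 = u.2
        · have : E₁ c t = 1 := ind_of ⟨⟨_, ha⟩, by rw [hb] at hdu; exact hdu⟩
          linarith
        · have : E₃ c t = 1 := ind_of ⟨⟨⟨_, ha⟩, ⟨_, hb⟩⟩, hdu⟩
          linarith
    have hb₁ : ∑ c : (Fin Ma → XA) × (Fin Mb → XB), ((∏ i, pA (c.1 i)) * ∏ j, pB (c.2 j)) *
        ∑ t, W (c.1 u.1) (c.2 u.2) t * E₁ c t ≤ b₁ := by
      rw [Fintype.sum_prod_type_right]
      have h : ∀ cb : Fin Mb → XB, ∑ ca : Fin Ma → XA, ((∏ i, pA (ca i)) * ∏ j, pB (cb j)) *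
          ∑ t, W (ca u.1) (cb u.2) t * E₁ (ca, cb) t ≤ (∏ j, pB (cb j)) *
          (((Ma - 1 : ℕ) : ℝ) ^ ρ₁ * gallager ρ₁ pA fun a => W a (cb u.2)) := by
        intro cb
        have := sum_mul_competitor_le (J := {i // i ≠ u.1}) (Ω := Fin Ma → XA) hAc.1
          (x := fun c => c u.1) (x' := fun i c => c i) hA.1 (fun a t => hW a (cb u.2) t)
          (fun f => sum_pi_prod_mul_apply (fun _ => pA) u.1 (fun _ _ => hA.2) f)
          (fun i f => sum_pi_prod_mul_apply₂ pA hA.2 i.2.symm f) h₁ h₁'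
        rw [card_subtype_ne] at this
        refine le_trans (le_of_eq ?_) (mul_le_mul_of_nonneg_left this (hBc.1 cb))
        rw [Finset.mul_sum]
        exact Finset.sum_congr rfl fun ca _ => by ring
      refine (Finset.sum_le_sum fun cb _ => h cb).trans (le_of_eq ?_)
      rw [sum_pi_prod_mul_apply (fun _ => pB) u.2 (fun _ _ => hB.2)
        (fun b => ((Ma - 1 : ℕ) : ℝ) ^ ρ₁ * gallager ρ₁ pA fun a => W a b)]
      simp only [b₁]
      rw [Finset.mul_sum]
      exact Finset.sum_congr rfl fun b _ => by ring
    have hb₂ : ∑ c : (Fin Ma → XA) × (Fin Mb → XB), ((∏ i, pA (c.1 i)) * ∏ j, pB (c.2 j)) *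
        ∑ t, W (c.1 u.1) (c.2 u.2) t * E₂ c t ≤ b₂ := by
      rw [Fintype.sum_prod_type]
      have h : ∀ ca : Fin Ma → XA, ∑ cb : Fin Mb → XB, ((∏ i, pA (ca i)) * ∏ j, pB (cb j)) *
          ∑ t, W (ca u.1) (cb u.2) t * E₂ (ca, cb) t ≤ (∏ i, pA (ca i)) *
          (((Mb - 1 : ℕ) : ℝ) ^ ρ₂ * gallager ρ₂ pB fun b => W (ca u.1) b) := by
        intro ca
        have := sum_mul_competitor_le (J := {j // j ≠ u.2}) (Ω := Fin Mb → XB) hBc.1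
          (x := fun c => c u.2) (x' := fun j c => c j) hB.1 (fun b t => hW (ca u.1) b t)
          (fun f => sum_pi_prod_mul_apply (fun _ => pB) u.2 (fun _ _ => hB.2) f)
          (fun j f => sum_pi_prod_mul_apply₂ pB hB.2 j.2.symm f) h₂ h₂'
        rw [card_subtype_ne] at this
        refine le_trans (le_of_eq ?_) (mul_le_mul_of_nonneg_left this (hAc.1 ca))
        rw [Finset.mul_sum]
        exact Finset.sum_congr rfl fun cb _ => by ring
      refine (Finset.sum_le_sum fun ca _ => h ca).trans (le_of_eq ?_)
      rw [sum_pi_prod_mul_apply (fun _ => pA) u.1 (fun _ _ => hA.2)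
        (fun a => ((Mb - 1 : ℕ) : ℝ) ^ ρ₂ * gallager ρ₂ pB fun b => W a b)]
      simp only [b₂]
      rw [Finset.mul_sum]
      exact Finset.sum_congr rfl fun b _ => by ring
    have hb₃ : ∑ c : (Fin Ma → XA) × (Fin Mb → XB), ((∏ i, pA (c.1 i)) * ∏ j, pB (c.2 j)) *
        ∑ t, W (c.1 u.1) (c.2 u.2) t * E₃ c t ≤ b₃ := by
      have := sum_mul_competitor_le (J := {i // i ≠ u.1} × {j // j ≠ u.2})
        (Ω := (Fin Ma → XA) × (Fin Mb → XB)) hν.1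
        (x := fun c => (c.1 u.1, c.2 u.2)) (x' := fun v c => (c.1 v.1, c.2 v.2))
        (prod_mem_stdSimplex hA hB).1 (V := fun x => W x.1 x.2) (fun x t => hW x.1 x.2 t)
        (fun f => by
          rw [Fintype.sum_prod_type, Fintype.sum_prod_type]
          simp_rw [mul_assoc, ← Finset.mul_sum]
          rw [← sum_pi_prod_mul_apply (fun _ => pA) u.1 (fun _ _ => hA.2)]
          refine Finset.sum_congr rfl fun ca _ => ?_
          congr 1
          exact sum_pi_prod_mul_apply (fun _ => pB) u.2 (fun _ _ => hB.2) fun b => f (ca u.1, b))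
        (fun v f => by
          have e1 : ∀ ca : Fin Ma → XA, ∑ cb : Fin Mb → XB, (∏ j, pB (cb j)) *
              f (ca u.1, cb u.2) (ca v.1, cb v.2) = ∑ b, ∑ b', pB b * pB b' *
              f (ca u.1, b) (ca v.1, b') := fun ca =>
            sum_pi_prod_mul_apply₂ pB hB.2 v.2.2.symm fun b b' => f (ca u.1, b) (ca v.1, b')
          refine Eq.trans (b := ∑ a, ∑ a', pA a * pA a' * ∑ b, ∑ b', pB b * pB b' *
            f (a, b) (a', b')) ?_ ?_
          · rw [Fintype.sum_prod_type]
            simp_rw [mul_assoc (∏ i, pA _), ← Finset.mul_sum, e1]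
            exact sum_pi_prod_mul_apply₂ pA hA.2 v.1.2.symm fun a a' => ∑ b, ∑ b', pB b * pB b' *
              f (a, b) (a', b')
          · simp_rw [Fintype.sum_prod_type, Finset.mul_sum]
            refine Finset.sum_congr rfl fun a _ => ?_
            rw [Finset.sum_comm]
            refine Finset.sum_congr rfl fun b _ => Finset.sum_congr rfl fun a' _ =>
              Finset.sum_congr rfl fun b' _ => by ring)
        h₃ h₃'
      rw [Fintype.card_prod, card_subtype_ne, card_subtype_ne] at this
      exact this
    have hsum : ∑ c : (Fin Ma → XA) × (Fin Mb → XB), ((∏ i, pA (c.1 i)) * ∏ j, pB (c.2 j)) *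
        ∑ t, W (c.1 u.1) (c.2 u.2) t * ind (d c t ≠ u) ≤
        ∑ c : (Fin Ma → XA) × (Fin Mb → XB), ((∏ i, pA (c.1 i)) * ∏ j, pB (c.2 j)) *
        ∑ t, W (c.1 u.1) (c.2 u.2) t * (E₁ c t + E₂ c t + E₃ c t) :=
      Finset.sum_le_sum fun c _ => mul_le_mul_of_nonneg_left (Finset.sum_le_sum fun t _ =>
        mul_le_mul_of_nonneg_left (hE c t) (hW _ _ _)) (hν.1 c)
    refine hsum.trans ?_
    simp_rw [mul_add, Finset.sum_add_distrib, mul_add, Finset.sum_add_distrib]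
    linarith
  have havg : ∑ c : (Fin Ma → XA) × (Fin Mb → XB), ((∏ i, pA (c.1 i)) * ∏ j, pB (c.2 j)) *
      (∑ u : Fin Ma × Fin Mb, 1 / ((Ma : ℝ) * Mb) *
        ∑ t, W (c.1 u.1) (c.2 u.2) t * ind (d c t ≠ u)) ≤ b₁ + b₂ + b₃ := by
    have hu := uniform_pair_mem (Ma := Ma) (Mb := Mb)
    have h := Finset.sum_le_sum fun u (_ : u ∈ Finset.univ) =>
      mul_le_mul_of_nonneg_left (key u) (hu.1 u)
    rw [← Finset.sum_mul, hu.2, one_mul] at h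
    refine le_trans (le_of_eq ?_) h
    simp_rw [Finset.mul_sum]
    rw [Finset.sum_comm]
    refine Finset.sum_congr rfl fun u _ => Finset.sum_congr rfl fun c _ =>
      Finset.sum_congr rfl fun t _ => by ring
  -- Some codebook is no worse than the average one.
  obtain ⟨c, hc⟩ := exists_le_of_sum_mul_le hν havg
  exact ⟨c.1, c.2, d c, hc⟩

end Multiple

/-! ### Random codes for the broadcast phase with side information. -/

section Broadcast

/-- Random coding for two receivers, each of which knows one of the two messages. -/
theorem exists_broadcast_code {X TA TB : Type*} [Fintype X] [Fintype TA] [Fintype TB]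
    {Ma Mb : ℕ} [NeZero Ma] [NeZero Mb] {p : X → ℝ} (hp : p ∈ stdSimplex ℝ X)
    {VA : X → TA → ℝ} {VB : X → TB → ℝ} (hVA : ∀ x t, 0 ≤ VA x t) (hVB : ∀ x t, 0 ≤ VB x t)
    {ρ₁ ρ₂ : ℝ} (h₁ : 0 < ρ₁) (h₁' : ρ₁ ≤ 1) (h₂ : 0 < ρ₂) (h₂' : ρ₂ ≤ 1) :
    ∃ (c : Fin Ma × Fin Mb → X) (dA : TA → Fin Ma → Fin Mb) (dB : TB → Fin Mb → Fin Ma),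
      ∑ u : Fin Ma × Fin Mb, 1 / ((Ma : ℝ) * Mb) *
        (∑ t, VA (c u) t * ind (dA t u.1 ≠ u.2) + ∑ t, VB (c u) t * ind (dB t u.2 ≠ u.1)) ≤
      ((Mb - 1 : ℕ) : ℝ) ^ ρ₁ * gallager ρ₁ p VA + ((Ma - 1 : ℕ) : ℝ) ^ ρ₂ * gallager ρ₂ p VB := by
  -- A receiver maximizes the likelihood only over codewords compatible with its own message, so
  -- only the other message set counts as competition.
  have hdA : ∀ (c : Fin Ma × Fin Mb → X) t wa, ∃ wb, ∀ v,
      VA (c (wa, v)) t ≤ VA (c (wa, wb)) t := fun c t wa =>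
    Finite.exists_max fun v => VA (c (wa, v)) t
  have hdB : ∀ (c : Fin Ma × Fin Mb → X) t wb, ∃ wa, ∀ v,
      VB (c (v, wb)) t ≤ VB (c (wa, wb)) t := fun c t wb =>
    Finite.exists_max fun v => VB (c (v, wb)) t
  choose dA hdA using hdA
  choose dB hdB using hdB
  have hν := pi_prod_mem_stdSimplex fun _ : Fin Ma × Fin Mb => hp
  set b₁ := ((Mb - 1 : ℕ) : ℝ) ^ ρ₁ * gallager ρ₁ p VA
  set b₂ := ((Ma - 1 : ℕ) : ℝ) ^ ρ₂ * gallager ρ₂ p VB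
  have hb₁ : ∀ u : Fin Ma × Fin Mb, ∑ c : Fin Ma × Fin Mb → X, (∏ i, p (c i)) *
      ∑ t, VA (c u) t * ind (dA c t u.1 ≠ u.2) ≤ b₁ := by
    intro u
    have := sum_mul_competitor_le (J := {j // j ≠ u.2}) (Ω := Fin Ma × Fin Mb → X) hν.1
      (x := fun c => c u) (x' := fun j c => c (u.1, j)) hp.1 hVA
      (fun f => sum_pi_prod_mul_apply (fun _ => p) u (fun _ _ => hp.2) f)
      (fun j f => sum_pi_prod_mul_apply₂ p hp.2 (fun h => j.2 (congrArg Prod.snd h).symm) f) h₁ h₁'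
    rw [card_subtype_ne] at this
    refine le_trans (Finset.sum_le_sum fun c _ => mul_le_mul_of_nonneg_left
      (Finset.sum_le_sum fun t _ => mul_le_mul_of_nonneg_left ?_ (hVA _ _)) (hν.1 c)) this
    exact ind_mono fun h => ⟨⟨_, h⟩, hdA c t u.1 u.2⟩
  have hb₂ : ∀ u : Fin Ma × Fin Mb, ∑ c : Fin Ma × Fin Mb → X, (∏ i, p (c i)) *
      ∑ t, VB (c u) t * ind (dB c t u.2 ≠ u.1) ≤ b₂ := by
    intro u
    have := sum_mul_competitor_le (J := {j // j ≠ u.1}) (Ω := Fin Ma × Fin Mb → X) hν.1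
      (x := fun c => c u) (x' := fun i c => c (i, u.2)) hp.1 hVB
      (fun f => sum_pi_prod_mul_apply (fun _ => p) u (fun _ _ => hp.2) f)
      (fun j f => sum_pi_prod_mul_apply₂ p hp.2 (fun h => j.2 (congrArg Prod.fst h).symm) f) h₂ h₂'
    rw [card_subtype_ne] at this
    refine le_trans (Finset.sum_le_sum fun c _ => mul_le_mul_of_nonneg_left
      (Finset.sum_le_sum fun t _ => mul_le_mul_of_nonneg_left ?_ (hVB _ _)) (hν.1 c)) this
    exact ind_mono fun h => ⟨⟨_, h⟩, hdB c t u.2 u.1⟩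
  -- The errors of the two receivers are added before averaging, so that one codebook serves both.
  have havg : ∑ c : Fin Ma × Fin Mb → X, (∏ i, p (c i)) *
      (∑ u : Fin Ma × Fin Mb, 1 / ((Ma : ℝ) * Mb) *
        (∑ t, VA (c u) t * ind (dA c t u.1 ≠ u.2) + ∑ t, VB (c u) t * ind (dB c t u.2 ≠ u.1)))
      ≤ b₁ + b₂ := by
    have hu := uniform_pair_mem (Ma := Ma) (Mb := Mb)
    have h := Finset.sum_le_sum fun u (_ : u ∈ Finset.univ) =>
      mul_le_mul_of_nonneg_left (add_le_add (hb₁ u) (hb₂ u)) (hu.1 u)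
    rw [← Finset.sum_mul, hu.2, one_mul] at h
    refine le_trans (le_of_eq ?_) h
    simp_rw [← Finset.sum_add_distrib, ← mul_add, Finset.mul_sum]
    rw [Finset.sum_comm]
    refine Finset.sum_congr rfl fun u _ => Finset.sum_congr rfl fun c _ => by
      ring
  obtain ⟨c, hc⟩ := exists_le_of_sum_mul_le hν havg
  exact ⟨c, dA c, dB c, hc⟩

end Broadcast

/-! ### Multiplicativity of the random coding function. -/

section Gallager

variable {X T : Type*} [Fintype X] [Fintype T]

/-- The output law of a product input is a product, so the ratio inside the power is one too, and
real powers are multiplicative on nonnegative factors. -/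
theorem gallager_pi {ι : Type*} [Fintype ι] [DecidableEq ι] (ρ : ℝ) {p : ι → X → ℝ}
    (hp : ∀ k a, 0 ≤ p k a) {V : ι → X → T → ℝ} (hV : ∀ k a t, 0 ≤ V k a t) :
    gallager ρ (fun x : ι → X => ∏ k, p k (x k)) (fun x (t : ι → T) => ∏ k, V k (x k) (t k)) =
      ∏ k, gallager ρ (p k) (V k) := by
  unfold gallager
  rw [← sum_pi_prod (fun k a => p k a * ∑ t, V k a t * ((∑ b, p k b * V k b t) / V k a t) ^ ρ)]
  refine Finset.sum_congr rfl fun x _ => ?_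
  rw [Finset.prod_mul_distrib]
  congr 1
  rw [← sum_pi_prod (fun k t => V k (x k) t * ((∑ b, p k b * V k b t) / V k (x k) t) ^ ρ)]
  refine Finset.sum_congr rfl fun t _ => ?_
  rw [Finset.prod_mul_distrib, Real.finsetProd_rpow]
  · simp_rw [← Finset.prod_mul_distrib]
    rw [sum_pi_prod (fun k b => p k b * V k b (t k)), Finset.prod_div_distrib]
  · exact fun k _ => div_nonneg (Finset.sum_nonneg fun b _ => mul_nonneg (hp k b) (hV k b _))
      (hV _ _ _)

theorem gallager_gate (ρ : ℝ) {p : X → ℝ} (hp : p ∈ stdSimplex ℝ X) (b : Prop) [Decidable b]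
    (V : X → Option T → ℝ) :
    gallager ρ p (fun a => gate b (V a)) = if b then gallager ρ p V else 1 := by
  split_ifs with h
  · congr 1
    funext a t
    simp [gate, h]
  · unfold gallager
    simp [gate, h, hp.2]

theorem gallager_comp_equiv {Y : Type*} [Fintype Y] (e : Y ≃ X) (ρ : ℝ) (p : X → ℝ)
    (V : X → T → ℝ) : gallager ρ (fun y => p (e y)) (fun y => V (e y)) = gallager ρ p V := by
  unfold gallager
  rw [← e.sum_comp]
  refine Finset.sum_congr rfl fun y _ => ?_
  congr 1
  refine Finset.sum_congr rfl fun t _ => ?_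
  rw [e.sum_comp fun b => p b * V b t]

theorem prod_ite_lt {n n₁ : ℕ} (h : n₁ ≤ n) (G : ℝ) :
    ∏ k : Fin n, (if (k : ℕ) < n₁ then G else 1) = G ^ n₁ := by
  rw [← Finset.prod_filter, Finset.prod_const, card_filter_lt h]

theorem prod_ite_ge {n n₁ : ℕ} (h : n₁ ≤ n) (G : ℝ) :
    ∏ k : Fin n, (if n₁ ≤ (k : ℕ) then G else 1) = G ^ (n - n₁) := by
  have h1 := card_filter_ge h
  have h2 : (Finset.univ.filter fun k : Fin n => n₁ ≤ (k : ℕ)).card = n - n₁ := by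
    rw [← Nat.cast_sub h] at h1
    exact_mod_cast h1
  rw [← Finset.prod_filter, Finset.prod_const, h2]

end Gallager

/-! ### Positivity of the error exponent below the mutual information. -/

section Exponent

/-- As a function of `ρ` the last expression vanishes at `0`, and its derivative there is `Real.log
2` times the left side of `h`; hence it is negative for small positive `ρ`. -/
theorem exists_exponent_neg {I : Type*} [Fintype I] {c r : I → ℝ} (hc : c ∈ stdSimplex ℝ I)
    (hr : ∀ i, c i ≠ 0 → 0 < r i) {Δ R : ℝ} (h : R + Δ * ∑ i, c i * Real.logb 2 (r i) < 0) :
    ∃ ρ : ℝ, 0 < ρ ∧ ρ ≤ 1 ∧ 0 < ∑ i, c i * r i ^ ρ ∧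
      ρ * R * Real.log 2 + Δ * Real.log (∑ i, c i * r i ^ ρ) < 0 := by
  have hl2 : 0 < Real.log 2 := Real.log_pos one_lt_two
  have hpos : ∀ ρ : ℝ, 0 < ∑ i, c i * r i ^ ρ := by
    intro ρ
    obtain ⟨i, hi⟩ : ∃ i, c i ≠ 0 := by
      by_contra! h0
      have := hc.2
      simp [h0] at this
    have hnn : ∀ i, 0 ≤ c i * r i ^ ρ := by
      intro i
      by_cases h0 : c i = 0
      · simp [h0]
      · exact mul_nonneg (hc.1 i) (Real.rpow_nonneg (hr i h0).le _)
    exact Finset.sum_pos' (fun i _ => hnn i) ⟨i, Finset.mem_univ i,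
      mul_pos (lt_of_le_of_ne (hc.1 i) hi.symm) (Real.rpow_pos_of_pos (hr i hi) _)⟩
  have hd : HasDerivAt (fun ρ : ℝ => ∑ i, c i * r i ^ ρ) (∑ i, c i * Real.log (r i)) 0 := by
    refine HasDerivAt.fun_sum fun i _ => ?_
    by_cases h0 : c i = 0
    · simpa [h0] using hasDerivAt_const (0 : ℝ) (0 : ℝ)
    · have := ((Real.hasStrictDerivAt_const_rpow (hr i h0) 0).hasDerivAt).const_mul (c i)
      simpa using this
  have h0 : ∑ i, c i * r i ^ (0 : ℝ) = 1 := by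
    simpa using hc.2
  have hf : HasDerivAt (fun ρ : ℝ => ρ * R * Real.log 2 + Δ * Real.log (∑ i, c i * r i ^ ρ))
      (1 * R * Real.log 2 + Δ * ((∑ i, c i * Real.log (r i)) / ∑ i, c i * r i ^ (0 : ℝ))) 0 :=
    (((hasDerivAt_id (0 : ℝ)).mul_const R).mul_const (Real.log 2)).add
      ((hd.log (hpos 0).ne').const_mul Δ)
  have hneg : 1 * R * Real.log 2 +
      Δ * ((∑ i, c i * Real.log (r i)) / ∑ i, c i * r i ^ (0 : ℝ)) < 0 := by
    rw [h0, div_one, one_mul]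
    have h1 : ∑ i, c i * Real.logb 2 (r i) = (∑ i, c i * Real.log (r i)) / Real.log 2 := by
      rw [Finset.sum_div]
      exact Finset.sum_congr rfl fun i _ => by rw [Real.logb, mul_div_assoc']
    rw [h1] at h
    have := mul_neg_of_neg_of_pos h hl2
    rw [add_mul, mul_assoc Δ, div_mul_cancel₀ _ hl2.ne'] at this
    exact this
  have hev := (hf.tendsto_slope_zero_right).eventually_lt_const hneg
  have hle : ∀ᶠ t : ℝ in 𝓝[>] 0, t ≤ 1 :=
    nhdsWithin_le_nhds (eventually_le_nhds one_pos)
  obtain ⟨t, ht, ht1, ht0⟩ := (hev.and (hle.and self_mem_nhdsWithin)).exists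
  have ht0' : 0 < t := ht0
  refine ⟨t, ht0', ht1, hpos t, ?_⟩
  simp only [zero_add, h0, Real.log_one, mul_zero, zero_mul, sub_zero, smul_eq_mul] at ht
  by_contra! hcon
  exact absurd ht (not_lt.2 (mul_nonneg (inv_nonneg.2 ht0'.le) hcon))

/-- The product is at most the exponential of `n` times a quantity that converges to the negative
number in `h`. -/
theorem tendsto_rpow_mul_pow_zero {N l : ℕ → ℕ} {R Δ G ρ : ℝ} (hρ : 0 < ρ) (hG : 0 < G)
    (h : ρ * R * Real.log 2 + Δ * Real.log G < 0)
    (hl : Tendsto (fun n : ℕ => (l n : ℝ) / n) atTop (𝓝 Δ))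
    (hN : ∀ n : ℕ, (N n : ℝ) ≤ 2 ^ ((n : ℝ) * R)) :
    Tendsto (fun n => (N n : ℝ) ^ ρ * G ^ l n) atTop (𝓝 0) := by
  have h1 : Tendsto (fun n : ℕ => (n : ℝ) *
      (ρ * R * Real.log 2 + (l n : ℝ) / n * Real.log G)) atTop atBot :=
    tendsto_natCast_atTop_atTop.atTop_mul_neg h (tendsto_const_nhds.add (hl.mul_const _))
  refine squeeze_zero' (Eventually.of_forall fun n => by positivity) ?_
    (Real.tendsto_exp_atBot.comp h1)
  filter_upwards [eventually_gt_atTop 0] with n hn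
  have hn' : (n : ℝ) ≠ 0 := by exact_mod_cast hn.ne'
  have h2 : (N n : ℝ) ^ ρ ≤ (2 ^ ((n : ℝ) * R)) ^ ρ :=
    Real.rpow_le_rpow (Nat.cast_nonneg _) (hN n) hρ.le
  refine (mul_le_mul_of_nonneg_right h2 (by positivity)).trans (le_of_eq ?_)
  rw [← Real.rpow_mul two_pos.le, Real.rpow_def_of_pos two_pos, ← Real.rpow_natCast,
    Real.rpow_def_of_pos hG, ← Real.exp_add, Function.comp]
  congr 1
  field_simp

/-- Below the mutual information some exponent makes the random coding error vanish. -/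
theorem exists_tendsto_gallager {C X T : Type*} [Fintype C] [Fintype X] [Fintype T] {w : C → ℝ}
    (hw : w ∈ stdSimplex ℝ C) {p : C → X → ℝ} (hp : ∀ c, p c ∈ stdSimplex ℝ X)
    {V : C → X → T → ℝ} (hV : ∀ c a, V c a ∈ stdSimplex ℝ T) {N l : ℕ → ℕ} {R Δ : ℝ}
    (hl : Tendsto (fun n : ℕ => (l n : ℝ) / n) atTop (𝓝 Δ))
    (h : (∀ n, N n = 0) ∨ ((∀ n : ℕ, (N n : ℝ) ≤ 2 ^ ((n : ℝ) * R)) ∧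
      R < Δ * ∑ c, w c * mutualInfo (p c) (V c))) :
    ∃ ρ : ℝ, 0 < ρ ∧ ρ ≤ 1 ∧ Tendsto (fun n => (N n : ℝ) ^ ρ *
      (∑ c, w c * gallager ρ (p c) (V c)) ^ l n) atTop (𝓝 0) := by
  -- Without competitors the bound is identically zero; this covers rate zero.
  rcases h with h | ⟨hN, hR⟩
  · refine ⟨1, one_pos, le_rfl, ?_⟩
    simp [h]
  -- `c` is the joint law of condition, input and output, and `r` is output probability over
  -- likelihood. The averaged `gallager` is the `ρ`-th moment of `r`, and the mean of `logb 2 r` is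
  -- minus the mutual information.
  let c : C × X × T → ℝ := fun i => w i.1 * (p i.1 i.2.1 * V i.1 i.2.1 i.2.2)
  let r : C × X × T → ℝ := fun i => (∑ b, p i.1 b * V i.1 b i.2.2) / V i.1 i.2.1 i.2.2
  have hc : c ∈ stdSimplex ℝ (C × X × T) := by
    refine ⟨fun i => mul_nonneg (hw.1 _) (mul_nonneg ((hp _).1 _) ((hV _ _).1 _)), ?_⟩
    simp only [c]
    simp_rw [Fintype.sum_prod_type, ← Finset.mul_sum, (hV _ _).2, mul_one, (hp _).2, mul_one, hw.2]
  have hr : ∀ i, c i ≠ 0 → 0 < r i := by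
    intro i hi
    have h1 := right_ne_zero_of_mul hi
    exact div_pos (sum_mul_pos (hp _) (hV _) (left_ne_zero_of_mul h1) (right_ne_zero_of_mul h1))
      (lt_of_le_of_ne ((hV _ _).1 _) (right_ne_zero_of_mul h1).symm)
  have hI : ∑ i, c i * Real.logb 2 (r i) = -∑ c, w c * mutualInfo (p c) (V c) := by
    simp only [c, r, mutualInfo]
    simp_rw [Fintype.sum_prod_type, mul_assoc, ← Finset.mul_sum]
    rw [← Finset.sum_neg_distrib]
    refine Finset.sum_congr rfl fun c _ => ?_
    rw [← mul_neg, ← Finset.sum_neg_distrib]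
    congr 1
    refine Finset.sum_congr rfl fun a _ => ?_
    rw [← mul_neg, ← Finset.sum_neg_distrib]
    congr 1
    refine Finset.sum_congr rfl fun t _ => ?_
    rw [← mul_neg, ← Real.logb_inv, inv_div]
  have hG : ∀ ρ : ℝ, ∑ i, c i * r i ^ ρ = ∑ c, w c * gallager ρ (p c) (V c) := by
    intro ρ
    simp only [c, r, gallager]
    simp_rw [Fintype.sum_prod_type, mul_assoc, ← Finset.mul_sum]
  obtain ⟨ρ, h1, h2, h3, h4⟩ := exists_exponent_neg hc hr (Δ := Δ) (R := R) (by
    rw [hI]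
    linarith)
  rw [hG] at h3 h4
  exact ⟨ρ, h1, h2, tendsto_rpow_mul_pow_zero h1 h3 h4 hl hN⟩

end Exponent

/-! ### Random time sharing over a block. -/

section TimeSharing

theorem sum_pi_prod_mul_prod {ι X : Type*} [Fintype ι] [DecidableEq ι] [Fintype X]
    (p : X → ℝ) (f : ι → X → ℝ) :
    ∑ x : ι → X, (∏ k, p (x k)) * ∏ k, f k (x k) = ∏ k, ∑ a, p a * f k a := by
  simp_rw [← Finset.prod_mul_distrib]
  exact sum_pi_prod fun k a => p a * f k a

theorem sum_mul_ite {X : Type*} [Fintype X] {p : X → ℝ} (hp : p ∈ stdSimplex ℝ X) (b : Prop)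
    [Decidable b] (f : X → ℝ) :
    ∑ x, p x * (if b then f x else 1) = if b then ∑ x, p x * f x else 1 := by
  split_ifs
  · rfl
  · simpa using hp.2

/-- Random time sharing makes the block random coding function a power. -/
theorem sum_pi_mul_gallager {ι Q X T : Type*} [Fintype ι] [DecidableEq ι] [Fintype Q] [Fintype X]
    [Fintype T] (ρ : ℝ) {w : Q → ℝ} (hw : w ∈ stdSimplex ℝ Q) {p : Q → X → ℝ}
    (hp : ∀ q, p q ∈ stdSimplex ℝ X) {V : X → Option T → ℝ}
    (hV : ∀ a, V a ∈ stdSimplex ℝ (Option T)) (s : ι → Prop) [DecidablePred s] :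
    ∑ q : ι → Q, (∏ k, w (q k)) * gallager ρ (fun a : ι → X => ∏ k, p (q k) (a k))
      (fun a (t : ι → Option T) => ∏ k, gate (s k) (V (a k)) (t k)) =
    ∏ k, if s k then ∑ q, w q * gallager ρ (p q) V else 1 := by
  have h : ∀ q : ι → Q, gallager ρ (fun a : ι → X => ∏ k, p (q k) (a k))
      (fun a (t : ι → Option T) => ∏ k, gate (s k) (V (a k)) (t k)) =
      ∏ k, if s k then gallager ρ (p (q k)) V else 1 := by
    intro q
    refine (gallager_pi ρ (fun k => (hp (q k)).1) (V := fun k a => gate (s k) (V a))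
      fun k a => (gate_mem (hV a)).1).trans ?_
    exact Finset.prod_congr rfl fun k _ => gallager_gate ρ (hp _) _ _
  simp_rw [h]
  rw [sum_pi_prod_mul_prod w fun k q => if s k then gallager ρ (p q) V else 1]
  exact Finset.prod_congr rfl fun k _ => sum_mul_ite hw _ _

/-- Variant for errors in one of the two multiple access messages: the other sender's input `b` is
correctly decoded and acts as part of the channel. -/
theorem sum_pi_mul_sum_pi_mul_gallager {ι Q B X T : Type*} [Fintype ι] [DecidableEq ι]
    [Fintype Q] [Fintype B] [Fintype X] [Fintype T] (ρ : ℝ) {w : Q → ℝ}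
    (hw : w ∈ stdSimplex ℝ Q) {r : Q → B → ℝ} (hr : ∀ q, r q ∈ stdSimplex ℝ B) {p : Q → X → ℝ}
    (hp : ∀ q, p q ∈ stdSimplex ℝ X) {V : B → X → Option T → ℝ}
    (hV : ∀ b a, V b a ∈ stdSimplex ℝ (Option T)) (s : ι → Prop) [DecidablePred s] :
    ∑ q : ι → Q, (∏ k, w (q k)) * ∑ b : ι → B, (∏ k, r (q k) (b k)) *
      gallager ρ (fun a : ι → X => ∏ k, p (q k) (a k))
        (fun a (t : ι → Option T) => ∏ k, gate (s k) (V (b k) (a k)) (t k)) =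
    ∏ k, if s k then ∑ q, w q * ∑ b, r q b * gallager ρ (p q) (V b) else 1 := by
  have h : ∀ (q : ι → Q) (b : ι → B), gallager ρ (fun a : ι → X => ∏ k, p (q k) (a k))
      (fun a (t : ι → Option T) => ∏ k, gate (s k) (V (b k) (a k)) (t k)) =
      ∏ k, if s k then gallager ρ (p (q k)) (V (b k)) else 1 := by
    intro q b
    refine (gallager_pi ρ (fun k => (hp (q k)).1) (V := fun k a => gate (s k) (V (b k) a))
      fun k a => (gate_mem (hV _ a)).1).trans ?_
    exact Finset.prod_congr rfl fun k _ => gallager_gate ρ (hp _) _ _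
  have h' : ∀ q : ι → Q, ∑ b : ι → B, (∏ k, r (q k) (b k)) *
      (∏ k, if s k then gallager ρ (p (q k)) (V (b k)) else 1) =
      ∏ k, if s k then ∑ b, r (q k) b * gallager ρ (p (q k)) (V b) else 1 := by
    intro q
    simp_rw [← Finset.prod_mul_distrib]
    rw [sum_pi_prod fun k b => r (q k) b * if s k then gallager ρ (p (q k)) (V b) else 1]
    exact Finset.prod_congr rfl fun k _ => sum_mul_ite (hr _) _ _
  simp_rw [h, h']
  rw [sum_pi_prod_mul_prod w fun k q =>
    if s k then ∑ b, r q b * gallager ρ (p q) (V b) else 1]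
  exact Finset.prod_congr rfl fun k _ => sum_mul_ite hw _ _

end TimeSharing

/-! ### Block codes for each phase. -/

section BlockCodes

variable {XA XB XR YA YB YR : Type*} [Fintype XA] [Fintype XB] [Fintype XR]
  [Fintype YA] [Fintype YB] [Fintype YR]
  (ch : HalfDuplexChannel XA XB XR YA YB YR) {m : ℕ} (P : InputDist m XA XB XR)
  {n n₁ Ma Mb : ℕ} [NeZero Ma] [NeZero Mb]

theorem exists_phase1_code (hn : n₁ ≤ n) {ρ₁ ρ₂ ρ₃ : ℝ} (h₁ : 0 < ρ₁) (h₁' : ρ₁ ≤ 1)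
    (h₂ : 0 < ρ₂) (h₂' : ρ₂ ≤ 1) (h₃ : 0 < ρ₃) (h₃' : ρ₃ ≤ 1) :
    ∃ (xA : Fin Ma → Fin n → XA) (xB : Fin Mb → Fin n → XB)
      (d : (Fin n → Option YR) → Fin Ma × Fin Mb),
      ∑ u : Fin Ma × Fin Mb, 1 / ((Ma : ℝ) * Mb) * ∑ s : Fin n → Option YR,
        (∏ k : Fin n, gate ((k : ℕ) < n₁) (ch.relayKernel (xA u.1 k) (xB u.2 k)) (s k)) *
          ind (d s ≠ u) ≤
      ((Ma - 1 : ℕ) : ℝ) ^ ρ₁ * (∑ q, P.pQ q * ∑ b, P.pB q b *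
        gallager ρ₁ (P.pA q) fun a => ch.relayKernel a b) ^ n₁ +
      ((Mb - 1 : ℕ) : ℝ) ^ ρ₂ * (∑ q, P.pQ q * ∑ a, P.pA q a *
        gallager ρ₂ (P.pB q) fun b => ch.relayKernel a b) ^ n₁ +
      (((Ma - 1) * (Mb - 1) : ℕ) : ℝ) ^ ρ₃ * (∑ q, P.pQ q *
        gallager ρ₃ (fun x : XA × XB => P.pA q x.1 * P.pB q x.2)
          fun x => ch.relayKernel x.1 x.2) ^ n₁ := by
  have hK : ∀ (k : Fin n) a b t, 0 ≤ gate ((k : ℕ) < n₁) (ch.relayKernel a b) t :=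
    fun k a b => (gate_mem (ch.relayKernel_mem a b)).1
  let W : (Fin n → XA) → (Fin n → XB) → (Fin n → Option YR) → ℝ := fun a b s =>
    ∏ k : Fin n, gate ((k : ℕ) < n₁) (ch.relayKernel (a k) (b k)) (s k)
  let f₁ : (Fin n → Fin m) → ℝ := fun q => ∑ b : Fin n → XB, (∏ k, P.pB (q k) (b k)) *
    gallager ρ₁ (fun a : Fin n → XA => ∏ k, P.pA (q k) (a k)) fun a => W a b
  let f₂ : (Fin n → Fin m) → ℝ := fun q => ∑ a : Fin n → XA, (∏ k, P.pA (q k) (a k)) *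
    gallager ρ₂ (fun b : Fin n → XB => ∏ k, P.pB (q k) (b k)) fun b => W a b
  let f₃ : (Fin n → Fin m) → ℝ := fun q => gallager ρ₃
    (fun x : (Fin n → XA) × (Fin n → XB) => (∏ k, P.pA (q k) (x.1 k)) * ∏ k, P.pB (q k) (x.2 k))
    fun x => W x.1 x.2
  have e₁ : ∑ q : Fin n → Fin m, (∏ k, P.pQ (q k)) * f₁ q = (∑ q, P.pQ q * ∑ b, P.pB q b *
        gallager ρ₁ (P.pA q) fun a => ch.relayKernel a b) ^ n₁ := by
    rw [← prod_ite_lt hn]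
    exact sum_pi_mul_sum_pi_mul_gallager ρ₁ P.pQ_mem P.pB_mem P.pA_mem
      (V := fun b a => ch.relayKernel a b) (fun b a => ch.relayKernel_mem a b) _
  have e₂ : ∑ q : Fin n → Fin m, (∏ k, P.pQ (q k)) * f₂ q = (∑ q, P.pQ q * ∑ a, P.pA q a *
        gallager ρ₂ (P.pB q) fun b => ch.relayKernel a b) ^ n₁ := by
    rw [← prod_ite_lt hn]
    exact sum_pi_mul_sum_pi_mul_gallager ρ₂ P.pQ_mem P.pA_mem P.pB_mem
      (V := fun a b => ch.relayKernel a b) (fun a b => ch.relayKernel_mem a b) _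
  have e₃ : ∑ q : Fin n → Fin m, (∏ k, P.pQ (q k)) * f₃ q = (∑ q, P.pQ q *
        gallager ρ₃ (fun x : XA × XB => P.pA q x.1 * P.pB q x.2)
          fun x => ch.relayKernel x.1 x.2) ^ n₁ := by
    rw [← prod_ite_lt hn, ← sum_pi_mul_gallager ρ₃ P.pQ_mem
      (fun q => prod_mem_stdSimplex (P.pA_mem q) (P.pB_mem q))
      (fun x => ch.relayKernel_mem x.1 x.2)]
    refine Finset.sum_congr rfl fun q _ => ?_
    congr 1
    -- A pair of input words is regarded as one word of input pairs, to which multiplicativity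
    -- applies.
    refine (gallager_comp_equiv (Equiv.arrowProdEquivProdArrow (Fin n)
      (fun _ => XA) fun _ => XB) _ _ _).symm.trans ?_
    simp only [Finset.prod_mul_distrib]
    rfl
  -- The time-sharing sequence is drawn i.i.d., which makes the mean bound a power; then one
  -- sequence no worse than the mean is fixed.
  obtain ⟨q, hq⟩ := exists_le_of_sum_mul_le (pi_prod_mem_stdSimplex fun _ : Fin n => P.pQ_mem)
    (f := fun q => ((Ma - 1 : ℕ) : ℝ) ^ ρ₁ * f₁ q + ((Mb - 1 : ℕ) : ℝ) ^ ρ₂ * f₂ q +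
      (((Ma - 1) * (Mb - 1) : ℕ) : ℝ) ^ ρ₃ * f₃ q) (b := _) (by
      simp_rw [mul_add, Finset.sum_add_distrib, mul_left_comm (∏ k, P.pQ _), ← Finset.mul_sum,
        e₁, e₂, e₃]
      exact le_rfl)
  obtain ⟨xA, xB, d, h⟩ := exists_multipleAccess_code (Ma := Ma) (Mb := Mb)
    (pi_prod_mem_stdSimplex fun k => P.pA_mem (q k))
    (pi_prod_mem_stdSimplex fun k => P.pB_mem (q k)) (W := W)
    (fun a b t => Finset.prod_nonneg fun k _ => hK k _ _ _) h₁ h₁' h₂ h₂' h₃ h₃'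
  exact ⟨xA, xB, d, h.trans hq⟩

/-- The time-sharing sequence fixed here may differ from that of phase 1: the phases interact only
through the decoded pair. -/
theorem exists_phase2_code (hn : n₁ ≤ n) {ρ₁ ρ₂ : ℝ} (h₁ : 0 < ρ₁) (h₁' : ρ₁ ≤ 1)
    (h₂ : 0 < ρ₂) (h₂' : ρ₂ ≤ 1) :
    ∃ (c : Fin Ma × Fin Mb → Fin n → XR) (dA : (Fin n → Option YA) → Fin Ma → Fin Mb)
      (dB : (Fin n → Option YB) → Fin Mb → Fin Ma),
      ∑ u : Fin Ma × Fin Mb, 1 / ((Ma : ℝ) * Mb) *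
        (∑ t : Fin n → Option YA, (∏ k : Fin n, gate (n₁ ≤ (k : ℕ))
          (ch.terminalKernel Prod.fst (c u k)) (t k)) * ind (dA t u.1 ≠ u.2) +
        ∑ t : Fin n → Option YB, (∏ k : Fin n, gate (n₁ ≤ (k : ℕ))
          (ch.terminalKernel (fun z => z.2.1) (c u k)) (t k)) * ind (dB t u.2 ≠ u.1)) ≤
      ((Mb - 1 : ℕ) : ℝ) ^ ρ₁ * (∑ q, P.pQ q *
        gallager ρ₁ (P.pR q) (ch.terminalKernel Prod.fst)) ^ (n - n₁) +
      ((Ma - 1 : ℕ) : ℝ) ^ ρ₂ * (∑ q, P.pQ q *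
        gallager ρ₂ (P.pR q) (ch.terminalKernel fun z => z.2.1)) ^ (n - n₁) := by
  have hKA : ∀ (k : Fin n) x t, 0 ≤ gate (n₁ ≤ (k : ℕ)) (ch.terminalKernel Prod.fst x) t :=
    fun k x => (gate_mem (ch.terminalKernel_mem _ x)).1
  have hKB : ∀ (k : Fin n) x t,
      0 ≤ gate (n₁ ≤ (k : ℕ)) (ch.terminalKernel (fun z => z.2.1) x) t :=
    fun k x => (gate_mem (ch.terminalKernel_mem _ x)).1
  let f₁ : (Fin n → Fin m) → ℝ := fun q => gallager ρ₁
    (fun x : Fin n → XR => ∏ k, P.pR (q k) (x k)) fun x (t : Fin n → Option YA) => ∏ k : Fin n,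
      gate (n₁ ≤ (k : ℕ)) (ch.terminalKernel Prod.fst (x k)) (t k)
  let f₂ : (Fin n → Fin m) → ℝ := fun q => gallager ρ₂
    (fun x : Fin n → XR => ∏ k, P.pR (q k) (x k)) fun x (t : Fin n → Option YB) => ∏ k : Fin n,
      gate (n₁ ≤ (k : ℕ)) (ch.terminalKernel (fun z => z.2.1) (x k)) (t k)
  have e₁ : ∑ q : Fin n → Fin m, (∏ k, P.pQ (q k)) * f₁ q = (∑ q, P.pQ q *
        gallager ρ₁ (P.pR q) (ch.terminalKernel Prod.fst)) ^ (n - n₁) := by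
    rw [← prod_ite_ge hn]
    exact sum_pi_mul_gallager ρ₁ P.pQ_mem P.pR_mem (ch.terminalKernel_mem _) _
  have e₂ : ∑ q : Fin n → Fin m, (∏ k, P.pQ (q k)) * f₂ q = (∑ q, P.pQ q *
        gallager ρ₂ (P.pR q) (ch.terminalKernel fun z => z.2.1)) ^ (n - n₁) := by
    rw [← prod_ite_ge hn]
    exact sum_pi_mul_gallager ρ₂ P.pQ_mem P.pR_mem (ch.terminalKernel_mem _) _
  obtain ⟨q, hq⟩ := exists_le_of_sum_mul_le (pi_prod_mem_stdSimplex fun _ : Fin n => P.pQ_mem)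
    (f := fun q => ((Mb - 1 : ℕ) : ℝ) ^ ρ₁ * f₁ q + ((Ma - 1 : ℕ) : ℝ) ^ ρ₂ * f₂ q) (b := _) (by
      simp_rw [mul_add, Finset.sum_add_distrib, mul_left_comm (∏ k, P.pQ _), ← Finset.mul_sum,
        e₁, e₂]
      exact le_rfl)
  obtain ⟨c, dA, dB, h⟩ := exists_broadcast_code (Ma := Ma) (Mb := Mb)
    (pi_prod_mem_stdSimplex fun k => P.pR_mem (q k))
    (VA := fun (x : Fin n → XR) (t : Fin n → Option YA) => ∏ k : Fin n,
      gate (n₁ ≤ (k : ℕ)) (ch.terminalKernel Prod.fst (x k)) (t k))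
    (VB := fun (x : Fin n → XR) (t : Fin n → Option YB) => ∏ k : Fin n,
      gate (n₁ ≤ (k : ℕ)) (ch.terminalKernel (fun z => z.2.1) (x k)) (t k))
    (fun x t => Finset.prod_nonneg fun k _ => hKA k _ _)
    (fun x t => Finset.prod_nonneg fun k _ => hKB k _ _) h₁ h₁' h₂ h₂'
  exact ⟨c, dA, dB, h.trans hq⟩

end BlockCodes

/-! ### Decode-and-forward. -/

section BlockCode

variable {XA XB XR YA YB YR : Type*} {n n₁ Ma Mb : ℕ}

/-- The outputs before time `n₁`. -/
def truncate (n₁ : ℕ) {Y : Type*} (s : Fin n → Option Y) (j : Fin n) : Option Y :=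
  if (j : ℕ) < n₁ then s j else none

/-- Decode-and-forward: the relay decodes both messages from its outputs in the first phase and
sends a codeword indexed by the pair of messages in the second phase. -/
def blockCode (hn : n₁ ≤ n) (xA : Fin Ma → Fin n → XA) (xB : Fin Mb → Fin n → XB)
    (d : (Fin n → Option YR) → Fin Ma × Fin Mb) (c : Fin Ma × Fin Mb → Fin n → XR)
    (dA : (Fin n → Option YA) → Fin Ma → Fin Mb) (dB : (Fin n → Option YB) → Fin Mb → Fin Ma) :
    Code XA XB XR YA YB YR n Ma Mb where
  phase1 := n₁
  phase1_le := hn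
  encA wa k _ := if (k : ℕ) < n₁ then some (xA wa k) else none
  encB wb k _ := if (k : ℕ) < n₁ then some (xB wb k) else none
  -- Padding with `none` after time `n₁` keeps the relay's estimate the same throughout phase 2, and
  -- equal to the one used by `decR`.
  encR k past := if hk : n₁ ≤ (k : ℕ) then
    some (c (d fun j => if hj : (j : ℕ) < n₁ then past ⟨j, hj.trans_le hk⟩ else none) k) else none
  encA_phase1 w k past hk := by simp [hk]
  encB_phase1 w k past hk := by simp [hk]
  encR_phase1 k past hk := by simp [hk]
  encA_phase2 w k past hk := by simp [hk]
  encB_phase2 w k past hk := by simp [hk]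
  encR_phase2 k past hk := by simp [hk]
  decA := dA
  decB := dB
  decR s := d (truncate n₁ s)

section Encoder

variable (hn : n₁ ≤ n) (xA : Fin Ma → Fin n → XA) (xB : Fin Mb → Fin n → XB)
  (d : (Fin n → Option YR) → Fin Ma × Fin Mb) (c : Fin Ma × Fin Mb → Fin n → XR)
  (dA : (Fin n → Option YA) → Fin Ma → Fin Mb) (dB : (Fin n → Option YB) → Fin Mb → Fin Ma)

theorem blockCode_encR (s : Fin n → Option YR) (k : Fin n) (hk : n₁ ≤ (k : ℕ)) :
    ((blockCode hn xA xB d c dA dB).encR k fun j => s ⟨j, j.2.trans k.2⟩) =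
      some (c (d (truncate n₁ s)) k) := by
  simp only [blockCode, hk, dif_pos]
  congr 4

/-- Truncation loses nothing on the support of the law: the closed gate is a point mass at `none`.
-/
theorem truncate_eq_of_prod_gate_ne_zero {v : Fin n → Option YR → ℝ} {s : Fin n → Option YR}
    (h : ∏ k : Fin n, gate ((k : ℕ) < n₁) (v k) (s k) ≠ 0) : truncate n₁ s = s := by
  funext k
  have hk := Finset.prod_ne_zero_iff.1 h k (Finset.mem_univ k)
  unfold truncate
  split_ifs with h1
  · rfl
  · by_contra h2
    exact hk (by simp [gate, h1, Ne.symm h2])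

end Encoder

variable [Fintype YA] [Fintype YB] [Fintype YR] (ch : HalfDuplexChannel XA XB XR YA YB YR)
  (hn : n₁ ≤ n) (xA : Fin Ma → Fin n → XA) (xB : Fin Mb → Fin n → XB)
  (d : (Fin n → Option YR) → Fin Ma × Fin Mb) (c : Fin Ma × Fin Mb → Fin n → XR)
  (dA : (Fin n → Option YA) → Fin Ma → Fin Mb) (dB : (Fin n → Option YB) → Fin Mb → Fin Ma)

/-- The error probability of the relay in the first phase, averaged over the messages. -/
def relayError (n₁ : ℕ) (xA : Fin Ma → Fin n → XA) (xB : Fin Mb → Fin n → XB)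
    (d : (Fin n → Option YR) → Fin Ma × Fin Mb) : ℝ :=
  ∑ u : Fin Ma × Fin Mb, 1 / ((Ma : ℝ) * Mb) * ∑ s : Fin n → Option YR,
    (∏ k : Fin n, gate ((k : ℕ) < n₁) (ch.relayKernel (xA u.1 k) (xB u.2 k)) (s k)) * ind (d s ≠ u)

theorem eventProb_nonneg (C : Code XA XB XR YA YB YR n Ma Mb)
    (E : Fin Ma → Fin Mb → (Fin n → Option YA × Option YB × Option YR) → Prop) :
    0 ≤ C.eventProb ch E := by
  unfold Code.eventProb
  refine div_nonneg (Finset.sum_nonneg fun _ _ => Finset.sum_nonneg fun _ _ =>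
    Finset.sum_nonneg fun y _ => ?_) (by positivity)
  split_ifs
  · exact Finset.prod_nonneg fun k _ => (ch.prob_mem _ _ _).1 _
  · exact le_rfl

theorem prod_relay_gate_nonneg (u : Fin Ma × Fin Mb) (s : Fin n → Option YR) :
    0 ≤ ∏ k : Fin n, gate ((k : ℕ) < n₁) (ch.relayKernel (xA u.1 k) (xB u.2 k)) (s k) :=
  Finset.prod_nonneg fun _ _ => (gate_mem (ch.relayKernel_mem _ _)).1 _

/-- `D` is general so that both relay error events are covered; each forces the decoded pair to be
wrong. -/
theorem blockCode_eventProb_relay_le (D : Fin Ma → Fin Mb → Fin Ma × Fin Mb → Prop)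
    (hD : ∀ wa wb v, D wa wb v → v ≠ (wa, wb)) :
    (blockCode hn xA xB d c dA dB).eventProb ch
      (fun wa wb y => D wa wb (d (truncate n₁ fun k => (y k).2.2))) ≤
      relayError ch n₁ xA xB d := by
  have h := (blockCode hn xA xB d c dA dB).eventProb_relay ch (xA := xA) (xB := xB)
    (fun wa k hk => if_pos hk) (fun wb k hk => if_pos hk)
    (blockCode_encR hn xA xB d c dA dB) fun wa wb s => D wa wb (d (truncate n₁ s))
  rw [h]
  refine Finset.sum_le_sum fun u _ => mul_le_mul_of_nonneg_left
    (Finset.sum_le_sum fun s _ => ?_) (by positivity)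
  by_cases h0 : ∏ k : Fin n, gate ((k : ℕ) < n₁) (ch.relayKernel (xA u.1 k) (xB u.2 k)) (s k) = 0
  · rw [h0, zero_mul]
    exact le_of_eq (mul_eq_zero_of_left h0 _)
  · rw [truncate_eq_of_prod_gate_ne_zero h0]
    exact mul_le_mul_of_nonneg_left (ind_mono (hD _ _ _)) (prod_relay_gate_nonneg ch xA xB u s)

/-- If the relay decodes correctly, the terminal sees the codeword of the true pair and fails as in
the broadcast code; otherwise its failure probability is bounded by 1. -/
theorem blockCode_eventProb_terminal_le {T : Type*} [Fintype T]
    {g : Option YA × Option YB × Option YR → Option T}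
    (hg : ∀ xa xb xr z, ch.prob (some xa) (some xb) xr z ≠ 0 → g z = none)
    (D : Fin Ma → Fin Mb → (Fin n → Option T) → Prop) :
    (blockCode hn xA xB d c dA dB).eventProb ch (fun wa wb y => D wa wb fun k => g (y k)) ≤
      relayError ch n₁ xA xB d + ∑ u : Fin Ma × Fin Mb, 1 / ((Ma : ℝ) * Mb) *
        ∑ t : Fin n → Option T, (∏ k : Fin n, gate (n₁ ≤ (k : ℕ))
          (ch.terminalKernel g (c u k)) (t k)) * ind (D u.1 u.2 t) := by
  have h := (blockCode hn xA xB d c dA dB).eventProb_terminal ch (xA := xA) (xB := xB) hg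
    (fun wa k hk => if_pos hk) (fun wb k hk => if_pos hk)
    (blockCode_encR hn xA xB d c dA dB) D
  have hV : ∀ v : Fin n → XR, (fun t : Fin n → Option T => ∏ k : Fin n, gate (n₁ ≤ (k : ℕ))
      (ch.terminalKernel g (v k)) (t k)) ∈ stdSimplex ℝ _ := fun v =>
    pi_prod_mem_stdSimplex fun k => gate_mem (ch.terminalKernel_mem g _)
  rw [h, relayError, ← Finset.sum_add_distrib, Fintype.sum_prod_type]
  refine Finset.sum_le_sum fun u _ => ?_
  rw [← mul_add]
  simp_rw [mul_assoc]
  rw [← Finset.mul_sum]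
  refine mul_le_mul_of_nonneg_left ?_ (by positivity)
  set e := ∑ t : Fin n → Option T, (∏ k : Fin n, gate (n₁ ≤ (k : ℕ))
    (ch.terminalKernel g (c u k)) (t k)) * ind (D u.1 u.2 t)
  have he : 0 ≤ e := Finset.sum_nonneg fun t _ => mul_nonneg ((hV _).1 t) (ind_nonneg _)
  have hw : (fun s : Fin n → Option YR => ∏ k : Fin n, gate ((k : ℕ) < n₁)
      (ch.relayKernel (xA u.1 k) (xB u.2 k)) (s k)) ∈ stdSimplex ℝ _ :=
    pi_prod_mem_stdSimplex fun k => gate_mem (ch.relayKernel_mem _ _)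
  have hs : (∑ s : Fin n → Option YR, (∏ k : Fin n, gate ((k : ℕ) < n₁)
      (ch.relayKernel (xA u.1 k) (xB u.2 k)) (s k)) * ind (d s ≠ u)) + e =
      ∑ s : Fin n → Option YR, (∏ k : Fin n, gate ((k : ℕ) < n₁)
      (ch.relayKernel (xA u.1 k) (xB u.2 k)) (s k)) * (ind (d s ≠ u) + e) := by
    simp_rw [mul_add, Finset.sum_add_distrib, ← Finset.sum_mul, hw.2, one_mul]
  rw [hs]
  refine Finset.sum_le_sum fun s _ => ?_
  by_cases h0 : ∏ k : Fin n, gate ((k : ℕ) < n₁) (ch.relayKernel (xA u.1 k) (xB u.2 k)) (s k) = 0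
  · rw [h0, zero_mul]
    exact le_of_eq (mul_eq_zero_of_left h0 _)
  refine mul_le_mul_of_nonneg_left ?_ (hw.1 s)
  rw [truncate_eq_of_prod_gate_ne_zero h0]
  by_cases hd : d s = u
  · rw [hd, ind_of_not (not_not.2 rfl), zero_add]
    exact le_rfl
  · rw [ind_of hd]
    refine le_trans ?_ (le_add_of_nonneg_right he)
    refine (Finset.sum_le_sum fun t _ => mul_le_mul_of_nonneg_left (ind_le_one _)
      ((hV (c (d s))).1 t)).trans (le_of_eq ?_)
    simp_rw [mul_one]
    exact (hV _).2

end BlockCode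

/-! ### Achievability. -/

section Achievability

variable {XA XB XR YA YB YR : Type*} [Fintype XA] [Fintype XB] [Fintype XR]
  [Fintype YA] [Fintype YB] [Fintype YR]
  (ch : HalfDuplexChannel XA XB XR YA YB YR)

theorem tendsto_floor_mul_div {Δ : ℝ} (hΔ : 0 ≤ Δ) :
    Tendsto (fun n : ℕ => (⌊Δ * (n : ℝ)⌋₊ : ℝ) / n) atTop (𝓝 Δ) :=
  (tendsto_nat_floor_mul_div_atTop hΔ).comp tendsto_natCast_atTop_atTop

theorem floor_two_rpow_sub_one_le {x : ℝ} :
    ((⌊(2 : ℝ) ^ x⌋₊ - 1 : ℕ) : ℝ) ≤ 2 ^ x :=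
  (Nat.cast_le.2 (Nat.sub_le _ _)).trans (Nat.floor_le (Real.rpow_nonneg two_pos.le _))

theorem floor_two_rpow_sub_one_eq_zero {x : ℝ} (hx : x = 0) : ⌊(2 : ℝ) ^ x⌋₊ - 1 = 0 := by
  simp [hx]

/-- A zero rate means a single message, hence no competitors, so each constraint is needed only when
the rates in it are nonzero. The alternatives are essential on the axes, where the strict inequality
may fail. -/
theorem achievable_of_lt {Δ₁ Δ₂ : ℝ} (hΔ₁ : 0 ≤ Δ₁) (hΔ₂ : 0 ≤ Δ₂) (hΔ : Δ₁ + Δ₂ = 1)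
    {Ra Rb : ℝ} (hRa : 0 ≤ Ra) (hRb : 0 ≤ Rb) {m : ℕ} (P : InputDist m XA XB XR)
    (hAR : Ra = 0 ∨ Ra < Δ₁ * P.infoAR ch) (hBR : Rb = 0 ∨ Rb < Δ₁ * P.infoBR ch)
    (hABR : Ra = 0 ∨ Rb = 0 ∨ Ra + Rb < Δ₁ * P.infoABR ch)
    (hRB : Ra = 0 ∨ Ra < Δ₂ * P.infoRB ch) (hRA : Rb = 0 ∨ Rb < Δ₂ * P.infoRA ch) :
    Achievable ch Δ₁ Δ₂ Ra Rb := by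
  refine ⟨hRa, hRb, ?_⟩
  let l : ℕ → ℕ := fun n => ⌊Δ₁ * (n : ℝ)⌋₊
  let Ma : ℕ → ℕ := fun n => ⌊(2 : ℝ) ^ ((n : ℝ) * Ra)⌋₊
  let Mb : ℕ → ℕ := fun n => ⌊(2 : ℝ) ^ ((n : ℝ) * Rb)⌋₊
  have hMa : ∀ n, NeZero (Ma n) := fun n => ⟨Nat.one_le_iff_ne_zero.1
    (one_le_floor_two_rpow (mul_nonneg n.cast_nonneg hRa))⟩
  have hMb : ∀ n, NeZero (Mb n) := fun n => ⟨Nat.one_le_iff_ne_zero.1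
    (one_le_floor_two_rpow (mul_nonneg n.cast_nonneg hRb))⟩
  have hln : ∀ n, l n ≤ n := fun n => by
    have h1 : Δ₁ * (n : ℝ) ≤ n := mul_le_of_le_one_left n.cast_nonneg (by linarith)
    exact (Nat.floor_le_floor h1).trans (Nat.floor_natCast n).le
  have hl : Tendsto (fun n : ℕ => (l n : ℝ) / n) atTop (𝓝 Δ₁) := tendsto_floor_mul_div hΔ₁
  have hl2 : Tendsto (fun n : ℕ => ((n : ℝ) - l n) / n) atTop (𝓝 Δ₂) := by
    have : Tendsto (fun n : ℕ => 1 - (l n : ℝ) / n) atTop (𝓝 (1 - Δ₁)) :=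
      tendsto_const_nhds.sub hl
    rw [show 1 - Δ₁ = Δ₂ by linarith] at this
    refine this.congr' ?_
    filter_upwards [eventually_gt_atTop 0] with n hn
    have : (n : ℝ) ≠ 0 := by exact_mod_cast hn.ne'
    field_simp
  have hl2' : Tendsto (fun n : ℕ => ((n - l n : ℕ) : ℝ) / n) atTop (𝓝 Δ₂) := by
    simpa only [Nat.cast_sub (hln _)] using hl2
  have nA : Ra = 0 → ∀ n, Ma n - 1 = 0 := fun h n => floor_two_rpow_sub_one_eq_zero (by simp [h])
  have nB : Rb = 0 → ∀ n, Mb n - 1 = 0 := fun h n => floor_two_rpow_sub_one_eq_zero (by simp [h])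
  have bA : ∀ n : ℕ, ((Ma n - 1 : ℕ) : ℝ) ≤ 2 ^ ((n : ℝ) * Ra) := fun n => floor_two_rpow_sub_one_le
  have bB : ∀ n : ℕ, ((Mb n - 1 : ℕ) : ℝ) ≤ 2 ^ ((n : ℝ) * Rb) := fun n => floor_two_rpow_sub_one_le
  -- Each of the five error classes gets its own `ρ`: three at the relay and one at each terminal.
  obtain ⟨ρ₁, p₁, p₁', t₁⟩ := exists_tendsto_gallager (C := Fin m × XB)
    (w := fun c => P.pQ c.1 * P.pB c.1 c.2) (p := fun c => P.pA c.1)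
    (V := fun c a => ch.relayKernel a c.2) (N := fun n => Ma n - 1) (R := Ra)
    ⟨fun c => mul_nonneg (P.pQ_mem.1 _) ((P.pB_mem _).1 _), by
      simp_rw [Fintype.sum_prod_type, ← Finset.mul_sum, (P.pB_mem _).2, mul_one, P.pQ_mem.2]⟩
    (fun c => P.pA_mem c.1) (fun c a => ch.relayKernel_mem a c.2) hl
    (hAR.imp nA fun h => ⟨bA, by
      rw [P.infoAR_eq] at h
      simpa only [Fintype.sum_prod_type, mul_assoc, ← Finset.mul_sum] using h⟩)
  obtain ⟨ρ₂, p₂, p₂', t₂⟩ := exists_tendsto_gallager (C := Fin m × XA)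
    (w := fun c => P.pQ c.1 * P.pA c.1 c.2) (p := fun c => P.pB c.1)
    (V := fun c b => ch.relayKernel c.2 b) (N := fun n => Mb n - 1) (R := Rb)
    ⟨fun c => mul_nonneg (P.pQ_mem.1 _) ((P.pA_mem _).1 _), by
      simp_rw [Fintype.sum_prod_type, ← Finset.mul_sum, (P.pA_mem _).2, mul_one, P.pQ_mem.2]⟩
    (fun c => P.pB_mem c.1) (fun c a => ch.relayKernel_mem c.2 a) hl
    (hBR.imp nB fun h => ⟨bB, by
      rw [P.infoBR_eq] at h
      simpa only [Fintype.sum_prod_type, mul_assoc, ← Finset.mul_sum] using h⟩)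
  obtain ⟨ρ₃, p₃, p₃', t₃⟩ := exists_tendsto_gallager (w := P.pQ)
    (p := fun q (x : XA × XB) => P.pA q x.1 * P.pB q x.2)
    (V := fun _ x => ch.relayKernel x.1 x.2) (N := fun n => (Ma n - 1) * (Mb n - 1))
    (R := Ra + Rb) P.pQ_mem (fun q => prod_mem_stdSimplex (P.pA_mem q) (P.pB_mem q))
    (fun c x => ch.relayKernel_mem x.1 x.2) hl (by
      rcases hABR with h | h | h
      · exact Or.inl fun n => by rw [nA h, zero_mul]
      · exact Or.inl fun n => by rw [nB h, mul_zero]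
      · refine Or.inr ⟨fun n => ?_, by rwa [P.infoABR_eq] at h⟩
        rw [mul_add, Real.rpow_add two_pos, Nat.cast_mul]
        exact mul_le_mul (bA n) (bB n) (Nat.cast_nonneg _) (Real.rpow_nonneg two_pos.le _))
  obtain ⟨ρ₄, p₄, p₄', t₄⟩ := exists_tendsto_gallager (w := P.pQ) (p := P.pR)
    (V := fun _ => ch.terminalKernel Prod.fst) (N := fun n => Mb n - 1) (R := Rb)
    P.pQ_mem P.pR_mem (fun _ => ch.terminalKernel_mem _) hl2'
    (hRA.imp nB fun h => ⟨bB, by rwa [P.infoRA_eq] at h⟩)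
  obtain ⟨ρ₅, p₅, p₅', t₅⟩ := exists_tendsto_gallager (w := P.pQ) (p := P.pR)
    (V := fun _ => ch.terminalKernel fun z => z.2.1) (N := fun n => Ma n - 1) (R := Ra)
    P.pQ_mem P.pR_mem (fun _ => ch.terminalKernel_mem _) hl2'
    (hRB.imp nA fun h => ⟨bA, by rwa [P.infoRB_eq] at h⟩)
  simp only [Fintype.sum_prod_type, mul_assoc, ← Finset.mul_sum] at t₁ t₂
  have ex1 := fun n => exists_phase1_code (Ma := Ma n) (Mb := Mb n) ch P (hln n)
    p₁ p₁' p₂ p₂' p₃ p₃'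
  have ex2 := fun n => exists_phase2_code (Ma := Ma n) (Mb := Mb n) ch P (hln n) p₄ p₄' p₅ p₅'
  choose xA xB d e1 using ex1
  choose c dA dB e2 using ex2
  let C : ∀ n : ℕ, Code XA XB XR YA YB YR n (Ma n) (Mb n) := fun n =>
    blockCode (hln n) (xA n) (xB n) (d n) (c n) (dA n) (dB n)
  have lim1 : Tendsto (fun n => relayError ch (l n) (xA n) (xB n) (d n)) atTop (𝓝 0) := by
    refine squeeze_zero (fun n => ?_) e1 (by simpa using (t₁.add t₂).add t₃)
    exact Finset.sum_nonneg fun u _ => mul_nonneg (by positivity) (Finset.sum_nonneg fun s _ =>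
      mul_nonneg (prod_relay_gate_nonneg ch _ _ _ _) (ind_nonneg _))
  have lim2 := by simpa using t₄.add t₅
  have hAterm : ∀ n (u : Fin (Ma n) × Fin (Mb n)), 0 ≤ ∑ t : Fin n → Option YA,
      (∏ k : Fin n, gate (l n ≤ (k : ℕ)) (ch.terminalKernel Prod.fst (c n u k)) (t k)) *
        ind (dA n t u.1 ≠ u.2) := fun n u => Finset.sum_nonneg fun t _ => mul_nonneg
    (Finset.prod_nonneg fun k _ => (gate_mem (ch.terminalKernel_mem _ _)).1 _) (ind_nonneg _)
  have hBterm : ∀ n (u : Fin (Ma n) × Fin (Mb n)), 0 ≤ ∑ t : Fin n → Option YB,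
      (∏ k : Fin n, gate (l n ≤ (k : ℕ)) (ch.terminalKernel (fun z => z.2.1) (c n u k)) (t k)) *
        ind (dB n t u.2 ≠ u.1) := fun n u => Finset.sum_nonneg fun t _ => mul_nonneg
    (Finset.prod_nonneg fun k _ => (gate_mem (ch.terminalKernel_mem _ _)).1 _) (ind_nonneg _)
  have lim3 := by simpa using lim1.add lim2
  refine ⟨C, hl, hl2, ?_, ?_, ?_, ?_⟩
  · refine squeeze_zero (fun n => eventProb_nonneg ch _ _) (fun n => ?_) lim3
    refine (blockCode_eventProb_terminal_le ch (hln n) (xA n) (xB n) (d n) (c n) (dA n) (dB n)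
      ch.snd_fst_eq_none fun wa wb t => dB n t wb ≠ wa).trans (add_le_add_right ?_ _)
    refine le_trans (Finset.sum_le_sum fun u _ => mul_le_mul_of_nonneg_left
      (le_add_of_nonneg_left (hAterm n u)) (by positivity)) (e2 n)
  · refine squeeze_zero (fun n => eventProb_nonneg ch _ _) (fun n => ?_) lim3
    refine (blockCode_eventProb_terminal_le ch (hln n) (xA n) (xB n) (d n) (c n) (dA n) (dB n)
      ch.fst_eq_none fun wa wb t => dA n t wa ≠ wb).trans (add_le_add_right ?_ _)
    refine le_trans (Finset.sum_le_sum fun u _ => mul_le_mul_of_nonneg_left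
      (le_add_of_nonneg_right (hBterm n u)) (by positivity)) (e2 n)
  · exact squeeze_zero (fun n => eventProb_nonneg ch _ _)
      (fun n => blockCode_eventProb_relay_le ch (hln n) (xA n) (xB n) (d n) (c n) (dA n) (dB n)
        (fun wa _ v => v.1 ≠ wa) fun wa wb v h h' => h (congrArg Prod.fst h')) lim1
  · exact squeeze_zero (fun n => eventProb_nonneg ch _ _)
      (fun n => blockCode_eventProb_relay_le ch (hln n) (xA n) (xB n) (d n) (c n) (dA n) (dB n)
        (fun _ wb v => v.2 ≠ wb) fun wa wb v h h' => h (congrArg Prod.snd h')) lim1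

end Achievability

end MABC

end

theorem theorem1 {XA XB XR YA YB YR : Type*}
    [Fintype XA] [Fintype XB] [Fintype XR] [Fintype YA] [Fintype YB] [Fintype YR]
    [Nonempty XA] [Nonempty XB] [Nonempty XR]
    (ch : MABC.HalfDuplexChannel XA XB XR YA YB YR)
    (Δ₁ Δ₂ : ℝ) (hΔ₁ : 0 ≤ Δ₁) (hΔ₂ : 0 ≤ Δ₂) (hΔ : Δ₁ + Δ₂ = 1) :
    MABC.capacityRegion ch Δ₁ Δ₂ =
      (closure {R : ℝ × ℝ | ∃ m : ℕ, m ≤ 5 ∧ ∃ P : MABC.InputDist m XA XB XR,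
        R.1 < min (Δ₁ * P.infoAR ch) (Δ₂ * P.infoRB ch) ∧
        R.2 < min (Δ₁ * P.infoBR ch) (Δ₂ * P.infoRA ch) ∧
        R.1 + R.2 < Δ₁ * P.infoABR ch}) ∩ {R : ℝ × ℝ | 0 ≤ R.1 ∧ 0 ≤ R.2} := by
  refine Set.Subset.antisymm ?_ ?_
  · refine closure_minimal (fun R hR => ⟨MABC.mem_closure_of_achievable ch hR, hR.1, hR.2.1⟩) ?_
    exact isClosed_closure.inter ((isClosed_le continuous_const continuous_fst).inter
      (isClosed_le continuous_const continuous_snd))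
  · rintro R ⟨hR, hR1, hR2⟩
    -- Points of the rate set near `R` may have negative coordinates. Clamping is continuous, fixes
    -- `R`, and maps the set into the achievable pairs, since a clamped coordinate has rate zero.
    let φ : ℝ × ℝ → ℝ × ℝ := fun R => (max R.1 0, max R.2 0)
    have hφ : Continuous φ := by fun_prop
    have hφR : φ R = R := Prod.ext (max_eq_left hR1) (max_eq_left hR2)
    rw [← hφR]
    refine map_mem_closure hφ hR ?_
    rintro S ⟨m, -, P, h1, h2, h3⟩
    have hmax : ∀ {x y : ℝ}, x < y → max x 0 = 0 ∨ max x 0 < y := by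
      intro x y hxy
      rcases le_total x 0 with h | h
      · exact Or.inl (max_eq_right h)
      · rw [max_eq_left h]
        exact Or.inr hxy
    refine MABC.achievable_of_lt ch hΔ₁ hΔ₂ hΔ (le_max_right _ _) (le_max_right _ _) P
      (hmax (h1.trans_le (min_le_left _ _))) (hmax (h2.trans_le (min_le_left _ _))) ?_
      (hmax (h1.trans_le (min_le_right _ _))) (hmax (h2.trans_le (min_le_right _ _)))
    -- Clamping can raise the sum above its bound, but only when one rate becomes zero and the sum
    -- constraint is void.
    rcases le_total S.1 0 with h | h
    · exact Or.inl (max_eq_right h)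
    rcases le_total S.2 0 with h' | h'
    · exact Or.inr (Or.inl (max_eq_right h'))
    · refine Or.inr (Or.inr ?_)
      rwa [show φ S = S from Prod.ext (max_eq_left h) (max_eq_left h')]
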